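/- **Setting.** Let $L^V, L^E$ be finite sets of node and edge labels and $\mathit{type}:L^E\to (L^V)^*$. A hypergraph fragment $R$ has a finite set of labelled nodes, a finite set of labelled edges $e$, each with a sequence $\mathit{att}(e)$ of (not necessarily distinct) endpoint nodes whose label sequence is $\mathit{type}(\mathit{lab}(e))$, and a sequence $\mathit{ext}$ of external nodes. A factor graph grammar (FGG) $G=(N,T,P,S)$ consists of disjoint finite sets $N,T\subseteq L^E$ of nonterminals and terminals, a finite set $P$ of rules $X\to R$ with $X\in N$ and $R$ a fragment with edge labels in $N\cup T$ and external label sequence $\mathit{type}(X)$, a start symbol $S\in N$ with $\mathit{type}(S)=\epsilon$, a set $\Omega(\ell)$ of values for every node label $\ell$, and a function $F(t):\Omega(\ell_1)\times\cdots\times\Omega(\ell_n)\to\mathbb R_{\ge 0}$ for every terminal $t$ with $\mathit{type}(t)=\ell_1\cdots\ell_n$. An $X$-type derivation is a finite tree whose root is a rule $X\to R$ with one child, a $\mathit{lab}(e)$-type derivation, for every nonterminal edge $e$ of $R$; its derived graph is obtained from $R$ by replacing every nonterminal edge $e$ by the derived graph $H_e$ of the corresponding child, identifying the $j$-th endpoint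 of $e$ with the $j$-th external node of $H_e$. The sum–product is $$Z_G=\sum_{D}\ \sum_{\xi}\ \prod_{e}F(\mathit{lab}(e))(\xi(\mathit{att}(e)))\in[0,\infty],$$ where $D$ runs over the $S$-type derivations, $\xi$ over the assignments of values to the nodes of the derived graph of $D$, and $e$ over the edges of that graph. $G$ is *recursive* if for some $X$ some $X$-type derivation contains an $X$-type derivation as a proper subtree, and *nonrecursive* otherwise. A recursive $G$ is *linearly recursive* if for no $X$ does an $X$-type derivation contain two disjoint $X$-type derivations as proper subtrees. **Theorem.** Let $G$ be an FGG with finite variable domains. (0) Consider the system of polynomial equations with nonnegative coefficients, in the unknowns $\psi_X(\xi)$ ($X\in N$) and $\tau_R(\xi)$ ($(X\to R)\in P$), where $\xi$ ranges over the tuples of values for $\mathit{type}(X)$: $$\psi_X(\xi)=\sum_{(X\to R)\in P}\tau_R(\xi),\qquad \tau_R(\xi)=\sum_{\xi'(\mathit{ext})=\xi}\ \prod_{e\in E_T}F(\mathit{lab}(e))(\xi'(\mathit{att}(e)))\prod_{e\in E_N}\psi_{\mathit{lab}(e)}(\xi'(\mathit{att}(e))),$$ where $\xi'$ runs over the assignments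 to the nodes of $R$, and $E_T$, $E_N$ are the terminal and nonterminal edges of $R$. This system is monotone on $[0,\infty]$-valued unknowns and has a least solution there. In it, $\psi_X(\xi)$ is the sum–product of all $X$-type derivations with external nodes assigned $\xi$, $\tau_R(\xi)$ is the same restricted to derivations with root $X\to R$, and $\psi_S()=Z_G$. Let moreover $|G|\ge 1$ be the number of rules of $G$, let $m\ge 1$ be such that $|\Omega(v)|\le m$ for every node $v$ of every right-hand side, and let $k\geq 0$ and $s$ be such that every right-hand side has at most $k+1$ nodes and has total size (the number of nodes, edges, endpoints of edges and external nodes, counted with multiplicity) at most $s$. Time is the number of steps of a random access machine with unit-cost operations, on natural numbers and exactly on elements of $[0,\infty]$, that is given the rules of $G$ and the tables of its factors in memory. (1) There are a program and an absolute constant $C$ such that the program computes $Z_G$ in time at most $C\,(s+1)\,|G|\,m^{k+1}$ for every nonrecursive $G$. (2) There are a program and an absolute constant $C$ such that the program computes $Z_G$ in time at most $C\,(s+1)\,|G|^3m^{3(k+1)}$ for every linearly recursive $G$. In particular, when the sizes of right-hand sides are bounded by a constant, these are $O(|G|m^{k+1})$ and $O(|G|^3m^{3(k+1)})$. -/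

import Mathlib

open scoped NNReal ENNReal

/-! Node labels `LV`, edge labels `LE` and `type : LE → List LV` are the global data; `Ω ℓ` is the
set of values of a variable labelled `ℓ`. -/

/-- The tuples of values `Ω(ℓ₁) × ⋯ × Ω(ℓₙ)` for `τ = ℓ₁ ⋯ ℓₙ`. -/
abbrev Args {LV : Type*} (Ω : LV → Type*) (τ : List LV) : Type _ :=
  ∀ i : Fin τ.length, Ω (τ.get i)

/-- A hypergraph fragment with edge labels in `L` whose sequence of external nodes has label
sequence `τ`. (A hypergraph is the case `τ = []`.) Neither the endpoints of an edge nor the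
external nodes need be distinct. -/
structure Fragment {LV : Type*} {LE : Type*} (type : LE → List LV) (L : Set LE) (τ : List LV) where
  V : Type
  E : Type
  finV : Fintype V
  finE : Fintype E
  labV : V → LV
  labE : E → LE
  labE_mem : ∀ e, labE e ∈ L
  att : ∀ e : E, Fin (type (labE e)).length → V
  labV_att : ∀ e i, labV (att e i) = (type (labE e)).get i
  ext : Fin τ.length → V
  labV_ext : ∀ i, labV (ext i) = τ.get i

attribute [instance] Fragment.finV Fragment.finE

namespace Fragment

variable {LV : Type*} {LE : Type*} {type : LE → List LV} {L : Set LE} {τ : List LV}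

/-- Assignments `ξ` of values to the nodes. -/
abbrev Asg (R : Fragment type L τ) (Ω : LV → Type*) : Type _ := ∀ v : R.V, Ω (R.labV v)

/-- `ξ(att(e))`. -/
def readAtt {Ω : LV → Type*} (R : Fragment type L τ) (ξ : R.Asg Ω) (e : R.E) :
    Args Ω (type (R.labE e)) :=
  fun i => cast (congrArg Ω (R.labV_att e i)) (ξ (R.att e i))

/-- `ξ(ext)`. -/
def readExt {Ω : LV → Type*} (R : Fragment type L τ) (ξ : R.Asg Ω) : Args Ω τ :=
  fun i => cast (congrArg Ω (R.labV_ext i)) (ξ (R.ext i))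

/-- Number of nodes, edges, endpoints of edges, and external nodes, i.e. the length of a
description of the fragment. -/
def size (R : Fragment type L τ) : ℕ :=
  Fintype.card R.V + Fintype.card R.E + ∑ e : R.E, (type (R.labE e)).length + τ.length

section Replace

variable {M : Set LE} (R : Fragment type L τ) (A : Set LE)
  (H : ∀ e : {e : R.E // R.labE e ∈ A}, Fragment type M (type (R.labE e.1)))

/-- The `j`-th endpoint of `e` is to be identified with the `j`-th external node of `H e`. -/
inductive Identify : R.V ⊕ (Σ e, (H e).V) → R.V ⊕ (Σ e, (H e).V) → Prop
  | mk (e : {e : R.E // R.labE e ∈ A}) (j : Fin (type (R.labE e.1)).length) :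
      Identify (Sum.inl (R.att e.1 j)) (Sum.inr ⟨e, (H e).ext j⟩)

/-- The labels of the nodes of the disjoint union of `R` and all `H e`. -/
def sumLabV : R.V ⊕ (Σ e, (H e).V) → LV := Sum.elim R.labV (fun x => (H x.1).labV x.2)

theorem sumLabV_identify (x y : R.V ⊕ (Σ e, (H e).V)) (h : Identify R A H x y) :
    sumLabV R A H x = sumLabV R A H y := by
  cases h with
  | mk e j => exact (R.labV_att e.1 j).trans ((H e).labV_ext j).symm

/-- Simultaneously replace every edge `e` of `R` with a label in `A` by `H e`: the nodes are those
of `R` and of all `H e` modulo the identifications, the edges are the other edges of `R` and the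
edges of all `H e`, and the external nodes are those of `R`. -/
noncomputable def replace (hL : ∀ t ∈ L, t ∉ A → t ∈ M) : Fragment type M τ where
  V := Quot (Identify R A H)
  E := {e : R.E // R.labE e ∉ A} ⊕ (Σ e, (H e).E)
  finV := Fintype.ofFinite _
  finE := Fintype.ofFinite _
  labV := Quot.lift (sumLabV R A H) (sumLabV_identify R A H)
  labE := Sum.elim (fun e => R.labE e.1) (fun x => (H x.1).labE x.2)
  labE_mem := by
    rintro (e | x)
    · exact hL _ (R.labE_mem e.1) e.2
    · exact (H x.1).labE_mem x.2
  att := fun e => match e with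
    | .inl e => fun i => Quot.mk _ (Sum.inl (R.att e.1 i))
    | .inr x => fun i => Quot.mk _ (Sum.inr ⟨x.1, (H x.1).att x.2 i⟩)
  labV_att := by
    rintro (e | x) i
    · exact R.labV_att e.1 i
    · exact (H x.1).labV_att x.2 i
  ext := fun i => Quot.mk _ (Sum.inl (R.ext i))
  labV_ext := fun i => R.labV_ext i

end Replace

end Fragment

/-- A factor graph grammar `(N, T, P, S)` with `Ω` and `F`. The finite set `P` of rules is given
as the finite type `Rule`, with left- and right-hand sides `lhs r → rhs r`. -/
structure FGG {LV : Type*} {LE : Type*} (type : LE → List LV) (Ω : LV → Type*) where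
  N : Finset LE
  T : Finset LE
  disjoint : Disjoint N T
  Rule : Type
  finRule : Fintype Rule
  lhs : Rule → LE
  lhs_mem : ∀ r, lhs r ∈ N
  rhs : ∀ r, Fragment type {t | t ∈ N ∨ t ∈ T} (type (lhs r))
  S : LE
  S_mem : S ∈ N
  type_S : type S = []
  F : ∀ t : {t // t ∈ T}, Args Ω (type t.1) → ℝ≥0

attribute [instance] FGG.finRule

namespace FGG

variable {LV : Type*} {LE : Type*} {type : LE → List LV} {Ω : LV → Type*}

/-- The nonterminal edges of the right-hand side of `r`. -/
abbrev NEdge (G : FGG type Ω) (r : G.Rule) : Type := {e : (G.rhs r).E // (G.rhs r).labE e ∈ G.N}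

/-- The terminal edges of the right-hand side of `r`. -/
abbrev TEdge (G : FGG type Ω) (r : G.Rule) : Type := {e : (G.rhs r).E // (G.rhs r).labE e ∈ G.T}

/-- `Deriv G X` is the set of `X`-type derivation trees: a rule with left-hand side `X` together
with, for every nonterminal edge of its right-hand side, a derivation tree of the type given by
the label of that edge. -/
inductive Deriv (G : FGG type Ω) : LE → Type _
  | node (r : G.Rule) (c : ∀ e : NEdge G r, Deriv G ((G.rhs r).labE e.1)) : Deriv G (G.lhs r)

/-- The derived graph of a derivation (all its edges have terminal labels). -/
noncomputable def derived (G : FGG type Ω) :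
    {X : LE} → Deriv G X → Fragment type {t | t ∈ G.T} (type X)
  | _, .node r c =>
      (G.rhs r).replace {t | t ∈ G.N} (fun e => derived G (c e))
        (fun _ h hN => h.resolve_left hN)

/-- The weight `w_H(ξ)` of an assignment of a terminal-labelled graph. -/
noncomputable def weight (G : FGG type Ω) {τ : List LV} (H : Fragment type {t | t ∈ G.T} τ)
    (ξ : H.Asg Ω) : ℝ≥0 :=
  ∏ e : H.E, G.F ⟨H.labE e, H.labE_mem e⟩ (H.readAtt ξ e)

/-- The sum–product `Z_G`, the sum of the weights of all assignments of the derived graphs of all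
`S`-type derivations; it is `∞` if the sum diverges. -/
noncomputable def Z (G : FGG type Ω) : ℝ≥0∞ :=
  ∑' D : Deriv G G.S, ∑' ξ : (G.derived D).Asg Ω, (G.weight (G.derived D) ξ : ℝ≥0∞)

/-- `D` contains a `Y`-type derivation as a proper subtree. -/
def Deriv.HasProper {G : FGG type Ω} (Y : LE) : {X : LE} → Deriv G X → Prop
  | _, .node r c => ∃ e : NEdge G r, (G.rhs r).labE e.1 = Y ∨ Deriv.HasProper Y (c e)

/-- `D` contains two disjoint `Y`-type derivations as proper subtrees: below some node of `D`,
they lie in the subtrees (possibly being these) of two different children. -/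
def Deriv.HasTwoDisjoint {G : FGG type Ω} (Y : LE) : {X : LE} → Deriv G X → Prop
  | _, .node r c =>
      (∃ e : NEdge G r, Deriv.HasTwoDisjoint Y (c e)) ∨
      ∃ e₁ e₂ : NEdge G r, e₁ ≠ e₂ ∧
        ((G.rhs r).labE e₁.1 = Y ∨ (c e₁).HasProper Y) ∧
        ((G.rhs r).labE e₂.1 = Y ∨ (c e₂).HasProper Y)

def Recursive (G : FGG type Ω) : Prop := ∃ (X : LE) (D : Deriv G X), D.HasProper X

def NonlinearlyRecursive (G : FGG type Ω) : Prop :=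
  G.Recursive ∧ ∃ (X : LE) (D : Deriv G X), D.HasTwoDisjoint X

def LinearlyRecursive (G : FGG type Ω) : Prop := G.Recursive ∧ ¬ G.NonlinearlyRecursive

/-! ### The system of equations -/

/-- The unknowns `ψ_X(ξ)` for nonterminals `X`, and `τ_R(ξ)` for rules `X → R`, where `ξ` is an
assignment to the endpoints of an edge labelled `X`. -/
inductive Unknown (G : FGG type Ω)
  | psi (X : {X // X ∈ G.N}) (ξ : Args Ω (type X.1))
  | tau (r : G.Rule) (ξ : Args Ω (type (G.lhs r)))

/-- The unknown `ψ_S()`. -/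
def startUnknown (G : FGG type Ω) : Unknown G :=
  .psi ⟨G.S, G.S_mem⟩ (fun i => absurd i.2 (by simp [G.type_S]))

open scoped Classical in
/-- The right-hand sides of the equations
`ψ_X(ξ) = ∑_{X → R} τ_R(ξ)` and
`τ_R(ξ) = ∑_{ξ' : ξ'(ext) = ξ} ∏_{e ∈ E_T} F(e)(ξ'(att(e))) ∏_{e ∈ E_N} ψ_{lab(e)}(ξ'(att(e)))`,
as polynomials in the unknowns with nonnegative coefficients. -/
noncomputable def system (G : FGG type Ω) [∀ ℓ, Fintype (Ω ℓ)] :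
    Unknown G → MvPolynomial (Unknown G) ℝ≥0
  | .psi X ξ => ∑ r : {r : G.Rule // G.lhs r = X.1},
      MvPolynomial.X (.tau r.1 (fun i => cast (by simp [r.2]) (ξ (i.cast (by rw [r.2])))))
  | .tau r ξ => ∑ ξ' : {ξ' : (G.rhs r).Asg Ω // (G.rhs r).readExt ξ' = ξ},
      MvPolynomial.C (∏ e : TEdge G r, G.F ⟨_, e.2⟩ ((G.rhs r).readAtt ξ'.1 e.1)) *
      ∏ e : NEdge G r, MvPolynomial.X (.psi ⟨_, e.2⟩ ((G.rhs r).readAtt ξ'.1 e.1))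

/-- The value of the right-hand side of the equation for `u` at `x`. -/
noncomputable def evalSystem (G : FGG type Ω) [∀ ℓ, Fintype (Ω ℓ)]
    (x : Unknown G → ℝ≥0∞) (u : Unknown G) : ℝ≥0∞ :=
  MvPolynomial.aeval x (G.system u)

/-- The sum–product of one derivation with its external nodes assigned the values `ξ`. -/
noncomputable def derivSum (G : FGG type Ω) {X : LE} (D : Deriv G X) (ξ : Args Ω (type X)) :
    ℝ≥0∞ :=
  ∑' ξ' : {ξ' : (G.derived D).Asg Ω // (G.derived D).readExt ξ' = ξ},
    (G.weight (G.derived D) ξ'.1 : ℝ≥0∞)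

/-- The sum–product of all `X`-type derivations with external nodes assigned `ξ`, and the
sum–product of those whose root is the rule `r`. -/
noncomputable def inside (G : FGG type Ω) : Unknown G → ℝ≥0∞
  | .psi X ξ => ∑' D : Deriv G X.1, G.derivSum D ξ
  | .tau r ξ => ∑' c : (∀ e : NEdge G r, Deriv G ((G.rhs r).labE e.1)),
      G.derivSum (Deriv.node r c) ξ

end FGG

/-! ### Machine model: a random access machine with unit costs

Programs work on arrays of natural numbers and arrays of elements of `[0, ∞]` (exact arithmetic, as
on a real RAM; an element of `[0, ∞]` is a real number or a flag). A program mentions finitely many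
arrays; every array is indexed by `ℕ`. Every operation, array access, test and assignment costs
one step. -/

namespace RAM

/-- Contents of the memory: `nat a i` and `val a i` are the `i`-th entries of array number `a`. -/
structure State where
  nat : ℕ → ℕ → ℕ
  val : ℕ → ℕ → ℝ≥0∞

/-- Natural number expressions; `sub` is truncated subtraction. -/
inductive NExpr
  | lit (n : ℕ)
  | get (a : ℕ) (i : NExpr)
  | add (e₁ e₂ : NExpr)
  | sub (e₁ e₂ : NExpr)
  | mul (e₁ e₂ : NExpr)

def NExpr.eval (σ : State) : NExpr → ℕ
  | .lit n => n
  | .get a i => σ.nat a (i.eval σ)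
  | .add e₁ e₂ => e₁.eval σ + e₂.eval σ
  | .sub e₁ e₂ => e₁.eval σ - e₂.eval σ
  | .mul e₁ e₂ => e₁.eval σ * e₂.eval σ

def NExpr.cost : NExpr → ℕ
  | .lit _ => 1
  | .get _ i => i.cost + 1
  | .add e₁ e₂ => e₁.cost + e₂.cost + 1
  | .sub e₁ e₂ => e₁.cost + e₂.cost + 1
  | .mul e₁ e₂ => e₁.cost + e₂.cost + 1

/-- Expressions with values in `[0, ∞]`; `sub` is truncated subtraction, and `0⁻¹ = ∞`,
`∞⁻¹ = 0`, `0 * ∞ = 0`. -/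
inductive VExpr
  | zero
  | one
  | get (a : ℕ) (i : NExpr)
  | add (e₁ e₂ : VExpr)
  | sub (e₁ e₂ : VExpr)
  | mul (e₁ e₂ : VExpr)
  | inv (e : VExpr)

noncomputable def VExpr.eval (σ : State) : VExpr → ℝ≥0∞
  | .zero => 0
  | .one => 1
  | .get a i => σ.val a (i.eval σ)
  | .add e₁ e₂ => e₁.eval σ + e₂.eval σ
  | .sub e₁ e₂ => e₁.eval σ - e₂.eval σ
  | .mul e₁ e₂ => e₁.eval σ * e₂.eval σ
  | .inv e => (e.eval σ)⁻¹

def VExpr.cost : VExpr → ℕ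
  | .zero => 1
  | .one => 1
  | .get _ i => i.cost + 1
  | .add e₁ e₂ => e₁.cost + e₂.cost + 1
  | .sub e₁ e₂ => e₁.cost + e₂.cost + 1
  | .mul e₁ e₂ => e₁.cost + e₂.cost + 1
  | .inv e => e.cost + 1

/-- Tests. -/
inductive Test
  | nle (e₁ e₂ : NExpr)
  | vle (e₁ e₂ : VExpr)
  | neg (b : Test)
  | conj (b₁ b₂ : Test)

def Test.Holds (σ : State) : Test → Prop
  | .nle e₁ e₂ => e₁.eval σ ≤ e₂.eval σ
  | .vle e₁ e₂ => e₁.eval σ ≤ e₂.eval σ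
  | .neg b => ¬ b.Holds σ
  | .conj b₁ b₂ => b₁.Holds σ ∧ b₂.Holds σ

def Test.cost : Test → ℕ
  | .nle e₁ e₂ => e₁.cost + e₂.cost + 1
  | .vle e₁ e₂ => e₁.cost + e₂.cost + 1
  | .neg b => b.cost + 1
  | .conj b₁ b₂ => b₁.cost + b₂.cost + 1

/-- Programs. -/
inductive Prog
  | skip
  | setNat (a : ℕ) (i e : NExpr)
  | setVal (a : ℕ) (i : NExpr) (e : VExpr)
  | seq (p q : Prog)
  | cond (b : Test) (p q : Prog)
  | loop (b : Test) (p : Prog)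

def State.updateNat (σ : State) (a i n : ℕ) : State :=
  { σ with nat := Function.update σ.nat a (Function.update (σ.nat a) i n) }

noncomputable def State.updateVal (σ : State) (a i : ℕ) (x : ℝ≥0∞) : State :=
  { σ with val := Function.update σ.val a (Function.update (σ.val a) i x) }

/-- `Exec p σ σ' t`: started in `σ`, the program `p` halts in `σ'` after exactly `t` steps. -/
inductive Exec : Prog → State → State → ℕ → Prop
  | skip (σ : State) : Exec .skip σ σ 1
  | setNat (σ : State) (a : ℕ) (i e : NExpr) :
      Exec (.setNat a i e) σ (σ.updateNat a (i.eval σ) (e.eval σ)) (i.cost + e.cost + 1)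
  | setVal (σ : State) (a : ℕ) (i : NExpr) (e : VExpr) :
      Exec (.setVal a i e) σ (σ.updateVal a (i.eval σ) (e.eval σ)) (i.cost + e.cost + 1)
  | seq {p q : Prog} {σ₁ σ₂ σ₃ : State} {t₁ t₂ : ℕ} :
      Exec p σ₁ σ₂ t₁ → Exec q σ₂ σ₃ t₂ → Exec (.seq p q) σ₁ σ₃ (t₁ + t₂)
  | condTrue {b : Test} {p q : Prog} {σ σ' : State} {t : ℕ} :
      b.Holds σ → Exec p σ σ' t → Exec (.cond b p q) σ σ' (b.cost + t + 1)
  | condFalse {b : Test} {p q : Prog} {σ σ' : State} {t : ℕ} :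
      ¬ b.Holds σ → Exec q σ σ' t → Exec (.cond b p q) σ σ' (b.cost + t + 1)
  | loopDone {b : Test} {p : Prog} {σ : State} :
      ¬ b.Holds σ → Exec (.loop b p) σ σ (b.cost + 1)
  | loopStep {b : Test} {p : Prog} {σ₁ σ₂ σ₃ : State} {t₁ t₂ : ℕ} :
      b.Holds σ₁ → Exec p σ₁ σ₂ t₁ → Exec (.loop b p) σ₂ σ₃ t₂ →
      Exec (.loop b p) σ₁ σ₃ (b.cost + t₁ + t₂ + 1)

/-- `p` started in `σ` halts within `T` steps with the value `z` in entry `0` of the output array,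
which is the array number `1` of the arrays with values in `[0, ∞]`. -/
def ComputesWithin (p : Prog) (σ : State) (z : ℝ≥0∞) (T : ℕ) : Prop :=
  ∃ (σ' : State) (t : ℕ), Exec p σ σ' t ∧ t ≤ T ∧ σ'.val 1 0 = z

/-- The position of the entry `(i, j)` of a table with two indices. -/
def cell (i j : ℕ) : ℕ := (i + j) * (i + j) + i

theorem cell_inj {i j i' j' : ℕ} (h : cell i j = cell i' j') : i = i' ∧ j = j' := by
  unfold cell at h
  have hs : i + j = i' + j' := by
    rcases lt_trichotomy (i + j) (i' + j') with h1 | h1 | h1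
    · nlinarith
    · exact h1
    · nlinarith
  rw [hs] at h
  omega

/-- The array that has the entry `value x` at position `pos x` for all `x`, and `0` elsewhere. -/
noncomputable def table {ι α : Type*} [Zero α] (pos : ι → ℕ) (value : ι → α) : ℕ → α :=
  Function.extend pos value (fun _ => 0)

end RAM

namespace FGG

open RAM

variable {LV : Type*} {LE : Type*} {type : LE → List LV} {Ω : LV → Type*}

/-- Numberings of labels, values, rules, and of the nodes and edges of each right-hand side, by
which a grammar is presented to a machine. -/
structure Numbering (G : FGG type Ω) [Fintype LV] [Fintype LE] [∀ ℓ, Fintype (Ω ℓ)] where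
  labV : LV ≃ Fin (Fintype.card LV)
  labE : LE ≃ Fin (Fintype.card LE)
  value : ∀ ℓ, Ω ℓ ≃ Fin (Fintype.card (Ω ℓ))
  rule : G.Rule ≃ Fin (Fintype.card G.Rule)
  node : ∀ r, (G.rhs r).V ≃ Fin (Fintype.card (G.rhs r).V)
  edge : ∀ r, (G.rhs r).E ≃ Fin (Fintype.card (G.rhs r).E)

section Encode

variable [Fintype LV] [Fintype LE] [∀ ℓ, Fintype (Ω ℓ)] (G : FGG type Ω) (ν : Numbering G)

/-- Position of a tuple of values in a table of all tuples: `∑ᵢ ξᵢ ∏_{j < i} |Ω(ℓⱼ)|`. -/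
def Numbering.tuple {G : FGG type Ω} (ν : Numbering G) {τ : List LV} (ξ : Args Ω τ) : ℕ :=
  (finPiFinEquiv (fun i => ν.value (τ.get i) (ξ i))).val

open scoped Classical in
/-- The arrays of natural numbers that describe the grammar:
`0` number of rules and start symbol; `1` domain sizes of node labels; `2`, `3` length and entries
of the types of edge labels; `4` whether an edge label is a nonterminal; `5` left-hand sides of
rules; `6`, `7` number of nodes and of edges of right-hand sides; `8` labels of nodes; `9` labels
of edges; `10` endpoints of edges; `11` external nodes. The other arrays are zero. -/
noncomputable def encodeNat : ℕ → ℕ → ℕ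
  | 0 => fun i => if i = 0 then Fintype.card G.Rule else if i = 1 then (ν.labE G.S).val else 0
  | 1 => table (fun ℓ : LV => (ν.labV ℓ).val) (fun ℓ => Fintype.card (Ω ℓ))
  | 2 => table (fun t : LE => (ν.labE t).val) (fun t => (type t).length)
  | 3 => table (fun x : (Σ t : LE, Fin (type t).length) => cell (ν.labE x.1).val x.2.val)
      (fun x => (ν.labV ((type x.1).get x.2)).val)
  | 4 => table (fun t : LE => (ν.labE t).val) (fun t => if t ∈ G.N then 1 else 0)
  | 5 => table (fun r : G.Rule => (ν.rule r).val) (fun r => (ν.labE (G.lhs r)).val)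
  | 6 => table (fun r : G.Rule => (ν.rule r).val) (fun r => Fintype.card (G.rhs r).V)
  | 7 => table (fun r : G.Rule => (ν.rule r).val) (fun r => Fintype.card (G.rhs r).E)
  | 8 => table (fun x : (Σ r : G.Rule, (G.rhs r).V) =>
        cell (ν.rule x.1).val (ν.node x.1 x.2).val)
      (fun x => (ν.labV ((G.rhs x.1).labV x.2)).val)
  | 9 => table (fun x : (Σ r : G.Rule, (G.rhs r).E) =>
        cell (ν.rule x.1).val (ν.edge x.1 x.2).val)
      (fun x => (ν.labE ((G.rhs x.1).labE x.2)).val)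
  | 10 => table
      (fun x : (Σ r : G.Rule, Σ e : (G.rhs r).E, Fin (type ((G.rhs r).labE e)).length) =>
        cell (cell (ν.rule x.1).val (ν.edge x.1 x.2.1).val) x.2.2.val)
      (fun x => (ν.node x.1 ((G.rhs x.1).att x.2.1 x.2.2)).val)
  | 11 => table (fun x : (Σ r : G.Rule, Fin (type (G.lhs r)).length) =>
        cell (ν.rule x.1).val x.2.val)
      (fun x => (ν.node x.1 ((G.rhs x.1).ext x.2)).val)
  | _ => fun _ => 0

/-- The array number `0` with values in `[0, ∞]` holds the values of all factors; the other arrays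
are zero. -/
noncomputable def encodeVal : ℕ → ℕ → ℝ≥0∞
  | 0 => table (fun x : (Σ t : {t // t ∈ G.T}, Args Ω (type t.1)) =>
        cell (ν.labE x.1.1).val (ν.tuple x.2))
      (fun x => (G.F x.1 x.2 : ℝ≥0∞))
  | _ => fun _ => 0

/-- The initial memory of a machine that is given the grammar `G` as its input. -/
noncomputable def encode : State where
  nat := encodeNat G ν
  val := encodeVal G ν

end Encode

end FGG

/-! ### A program logic for the machine -/

namespace RAM

/-! An assignment of a derived graph amounts to an assignment of the right-hand side at the root
together with assignments of the children's derived graphs whose external values match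
(`Fragment.replaceAsgEquiv`). So the sum–product of one derivation factors over the nonterminal
edges at its root (`derivSum_node`), and distributivity in [0, ∞] turns the sum over all choices of
children into the right-hand side of the equation for that rule. Hence `inside` solves the system.
It lies below every pre-fixed point, because finitely many derivations have bounded height, and the
sums over derivations of bounded height are estimated by induction on the height (`inside_le`).

For the machine the unknowns τ are eliminated. The others are indexed by keys, numbers that encode a
nonterminal and a tuple of values; `lfpK_encode` identifies the least fixed point over keys with
that of the system. One routine runs through the assignments of a right-hand side as a mixed radix
counter and adds each product of factors to the entry given by the external values (`wp_rule`), at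
cost O(s + 1) per assignment.

Recursion is defined through derivations that exist, so rules without derivations may form arbitrary
cycles and have to be recognised. The rank of a nonterminal is the number of nonterminals reachable
from it through productive rules, and 0 if it has no derivation. Along a productive rule of a
nonrecursive grammar the rank drops (`rank_lt`); for a linearly recursive grammar at most one
nonterminal edge keeps the rank (`eq_of_rank_eq`). Otherwise derivations could be glued together to
a forbidden one.

In the nonrecursive case a queue with counters touches each occurrence of a nonterminal at most
once. If a nonterminal fires after one rule, the queue collects the productive rules. If it fires
only after all its productive rules, a second run orders these rules so that values are complete
before they are used (`sum_take_eq_lfpK`). Each of them is then evaluated once.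

In the linear case the machine finds suitable ranks by raising them only where it is forced to. The
equations of one rank are linear over the values of lower ranks. Gauss–Jordan elimination over [0,
∞], with 1 + a + a² + ⋯ in the place of the inverse of 1 - a, yields their least solution even if it
is infinite (`elimStep_elim`, `elim_le`). Every unknown of a level comes from an assignment of a
rule of that level, so the sizes of the levels add up to at most |G| m^(k+1), and the sum of their
cubes is O((|G| m^(k+1))³). -/

@[simp] theorem State.updateNat_nat (σ : State) (a i n b j : ℕ) :
    (σ.updateNat a i n).nat b j = if b = a ∧ j = i then n else σ.nat b j := by
  simp only [State.updateNat, Function.update_apply]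
  by_cases h : b = a <;> by_cases h' : j = i <;> simp [h, h']

@[simp] theorem State.updateNat_val (σ : State) (a i n : ℕ) :
    (σ.updateNat a i n).val = σ.val := rfl

@[simp] theorem State.updateVal_nat (σ : State) (a i : ℕ) (x : ℝ≥0∞) :
    (σ.updateVal a i x).nat = σ.nat := rfl

@[simp] theorem State.updateVal_val (σ : State) (a i : ℕ) (x : ℝ≥0∞) (b j : ℕ) :
    (σ.updateVal a i x).val b j = if b = a ∧ j = i then x else σ.val b j := by
  simp only [State.updateVal, Function.update_apply]
  by_cases h : b = a <;> by_cases h' : j = i <;> simp [h, h']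

theorem State.updateNat_nat_of_ne (σ : State) {a b : ℕ} (i n : ℕ) (h : b ≠ a) :
    (σ.updateNat a i n).nat b = σ.nat b := by
  funext j; simp [h]

theorem State.updateVal_val_of_ne (σ : State) {a b : ℕ} (i : ℕ) (x : ℝ≥0∞) (h : b ≠ a) :
    (σ.updateVal a i x).val b = σ.val b := by
  funext j; simp [h]

attribute [simp] NExpr.eval VExpr.eval Test.Holds

/-- A scalar variable, stored in entry `0` of an array. -/
abbrev NExpr.var (a : ℕ) : NExpr := .get a (.lit 0)

/-- A scalar variable with values in `[0, ∞]`. -/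
abbrev VExpr.var (a : ℕ) : VExpr := .get a (.lit 0)

/-- The position of an entry of a table with two indices. -/
def NExpr.cell (i j : NExpr) : NExpr := .add (.mul (.add i j) (.add i j)) i

@[simp] theorem NExpr.eval_cell (σ : State) (i j : NExpr) :
    (NExpr.cell i j).eval σ = RAM.cell (i.eval σ) (j.eval σ) := rfl

/-- The test `e₁ < e₂`. -/
def Test.lt (e₁ e₂ : NExpr) : Test := .nle (.add e₁ (.lit 1)) e₂

@[simp] theorem Test.holds_lt (σ : State) (e₁ e₂ : NExpr) :
    (Test.lt e₁ e₂).Holds σ ↔ e₁.eval σ < e₂.eval σ := Iff.rfl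

/-- The test `e₁ = e₂`. -/
def Test.eq (e₁ e₂ : NExpr) : Test := .conj (.nle e₁ e₂) (.nle e₂ e₁)

@[simp] theorem Test.holds_eq (σ : State) (e₁ e₂ : NExpr) :
    (Test.eq e₁ e₂).Holds σ ↔ e₁.eval σ = e₂.eval σ := le_antisymm_iff.symm

/-- Assignment to a scalar variable. -/
abbrev Prog.assign (a : ℕ) (e : NExpr) : Prog := .setNat a (.lit 0) e

/-- Assignment to a scalar variable with values in `[0, ∞]`. -/
abbrev Prog.assignVal (a : ℕ) (e : VExpr) : Prog := .setVal a (.lit 0) e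

infixr:60 " ;; " => Prog.seq

/-- `for x < n do p`. -/
def Prog.forTo (x : ℕ) (n : NExpr) (p : Prog) : Prog :=
  .assign x (.lit 0) ;; .loop (.lt (.var x) n) (p ;; .assign x (.add (.var x) (.lit 1)))

/-- Whether a program may write to the array number `a` of natural numbers. -/
def Prog.writesNat (a : ℕ) : Prog → Bool
  | .skip => false
  | .setNat b _ _ => a == b
  | .setVal _ _ _ => false
  | .seq p q => p.writesNat a || q.writesNat a
  | .cond _ p q => p.writesNat a || q.writesNat a
  | .loop _ p => p.writesNat a

/-- Whether a program may write to the array number `a` with values in `[0, ∞]`. -/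
def Prog.writesVal (a : ℕ) : Prog → Bool
  | .skip => false
  | .setNat _ _ _ => false
  | .setVal b _ _ => a == b
  | .seq p q => p.writesVal a || q.writesVal a
  | .cond _ p q => p.writesVal a || q.writesVal a
  | .loop _ p => p.writesVal a

/-- `τ` differs from `σ` only in arrays that `p` writes to. -/
structure Agree (p : Prog) (σ τ : State) : Prop where
  nat : ∀ a, p.writesNat a = false → τ.nat a = σ.nat a
  val : ∀ a, p.writesVal a = false → τ.val a = σ.val a

theorem Agree.refl (p : Prog) (σ : State) : Agree p σ σ := ⟨fun _ _ => rfl, fun _ _ => rfl⟩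

theorem Agree.trans {p : Prog} {σ τ υ : State} (h : Agree p σ τ) (h' : Agree p τ υ) :
    Agree p σ υ :=
  ⟨fun a ha => (h'.nat a ha).trans (h.nat a ha), fun a ha => (h'.val a ha).trans (h.val a ha)⟩

theorem Agree.mono {p q : Prog} {σ τ : State} (h : Agree p σ τ)
    (hn : ∀ a, q.writesNat a = false → p.writesNat a = false)
    (hv : ∀ a, q.writesVal a = false → p.writesVal a = false) : Agree q σ τ :=
  ⟨fun a ha => h.nat a (hn a ha), fun a ha => h.val a (hv a ha)⟩

theorem Agree.seq_left {p q : Prog} {σ τ : State} (h : Agree p σ τ) : Agree (p ;; q) σ τ :=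
  h.mono (fun _ h => (Bool.or_eq_false_iff.1 h).1) (fun _ h => (Bool.or_eq_false_iff.1 h).1)

theorem Agree.seq_right {p q : Prog} {σ τ : State} (h : Agree q σ τ) : Agree (p ;; q) σ τ :=
  h.mono (fun _ h => (Bool.or_eq_false_iff.1 h).2) (fun _ h => (Bool.or_eq_false_iff.1 h).2)

theorem Agree.updateNat {p : Prog} {σ τ : State} {a i n : ℕ} (h : Agree p σ τ)
    (ha : p.writesNat a = true) : Agree p σ (τ.updateNat a i n) := by
  refine h.trans ⟨fun b hb => State.updateNat_nat_of_ne _ _ _ ?_, fun _ _ => rfl⟩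
  rintro rfl
  simp [ha] at hb

/-- This is the frame rule. Since `writesNat` and `writesVal` are computed from the program text,
the side conditions are closed by `rfl`, and invariants need to mention only what a program changes.
-/
theorem Exec.agree {p : Prog} {σ τ : State} {t : ℕ} (h : Exec p σ τ t) : Agree p σ τ := by
  induction h with
  | skip σ => exact .refl _ _
  | setNat σ a i e =>
    refine ⟨fun b hb => ?_, fun b _ => rfl⟩
    simp only [Prog.writesNat, beq_eq_false_iff_ne] at hb
    exact State.updateNat_nat_of_ne _ _ _ hb
  | setVal σ a i e =>
    refine ⟨fun b _ => rfl, fun b hb => ?_⟩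
    simp only [Prog.writesVal, beq_eq_false_iff_ne] at hb
    exact State.updateVal_val_of_ne _ _ _ hb
  | seq _ _ h₁ h₂ =>
    refine (h₁.mono ?_ ?_).trans (h₂.mono ?_ ?_) <;> simp +contextual [Prog.writesNat, Prog.writesVal]
  | condTrue _ _ h => refine h.mono ?_ ?_ <;> simp +contextual [Prog.writesNat, Prog.writesVal]
  | condFalse _ _ h => refine h.mono ?_ ?_ <;> simp +contextual [Prog.writesNat, Prog.writesVal]
  | loopDone _ => exact .refl _ _
  | loopStep _ _ _ h₁ h₂ =>
    exact Agree.trans (p := .loop _ _) (h₁.mono (fun _ h => h) (fun _ h => h)) h₂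

/-- `p` started in `σ` halts within `T` steps in a state satisfying `Q`. -/
def WP (p : Prog) (σ : State) (T : ℕ) (Q : State → Prop) : Prop :=
  ∃ (σ' : State) (t : ℕ), Exec p σ σ' t ∧ t ≤ T ∧ Q σ'

theorem WP.mono {p : Prog} {σ : State} {T T' : ℕ} {Q Q' : State → Prop} (h : WP p σ T Q)
    (hT : T ≤ T') (hQ : ∀ τ, Agree p σ τ → Q τ → Q' τ) : WP p σ T' Q' := by
  obtain ⟨τ, t, h₁, h₂, h₃⟩ := h
  exact ⟨τ, t, h₁, h₂.trans hT, hQ τ h₁.agree h₃⟩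

theorem WP.seq {p q : Prog} {σ : State} {T₁ T₂ : ℕ} {Q R : State → Prop} (h₁ : WP p σ T₁ R)
    (h₂ : ∀ τ, Agree p σ τ → R τ → WP q τ T₂ Q) : WP (p ;; q) σ (T₁ + T₂) Q := by
  obtain ⟨τ, t, e₁, l₁, r⟩ := h₁
  obtain ⟨υ, t', e₂, l₂, r'⟩ := h₂ τ e₁.agree r
  exact ⟨υ, _, .seq e₁ e₂, add_le_add l₁ l₂, r'⟩

theorem WP.cond {b : Test} {p q : Prog} {σ : State} {T : ℕ} {Q : State → Prop}
    (h₁ : b.Holds σ → WP p σ T Q) (h₂ : ¬ b.Holds σ → WP q σ T Q) :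
    WP (.cond b p q) σ (b.cost + T + 1) Q := by
  by_cases h : b.Holds σ
  · obtain ⟨τ, t, e, l, r⟩ := h₁ h
    exact ⟨τ, _, .condTrue h e, by omega, r⟩
  · obtain ⟨τ, t, e, l, r⟩ := h₂ h
    exact ⟨τ, _, .condFalse h e, by omega, r⟩

/-- The potential `Φ` pays for the body, the test and the step of each round, so its decrease gives
both termination and an amortised time bound. The extra `b.cost + 1` is the final failing test. -/
theorem WP.loop {b : Test} {p : Prog} {σ₀ : State} (I : State → Prop) (Φ : State → ℕ)
    (h : ∀ σ, I σ → Agree (.loop b p) σ₀ σ → b.Holds σ →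
      ∃ T, WP p σ T (fun τ => I τ ∧ T + Φ τ + b.cost + 1 ≤ Φ σ))
    (h₀ : I σ₀) :
    WP (.loop b p) σ₀ (Φ σ₀ + b.cost + 1)
      (fun τ => I τ ∧ ¬ b.Holds τ ∧ Φ τ ≤ Φ σ₀) := by
  suffices H : ∀ n σ, I σ → Agree (.loop b p) σ₀ σ → Φ σ = n →
      ∃ σ' t, Exec (.loop b p) σ σ' t ∧ t + Φ σ' ≤ Φ σ + b.cost + 1 ∧ I σ' ∧ ¬ b.Holds σ' ∧
        Φ σ' ≤ Φ σ by
    obtain ⟨τ, t, e, l, r⟩ := H _ σ₀ h₀ (.refl _ _) rfl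
    exact ⟨τ, t, e, by omega, r⟩
  intro n
  induction n using Nat.strong_induction_on with
  | _ n ih =>
    intro σ hI hA hn
    by_cases hb : b.Holds σ
    · obtain ⟨T, τ, t, e, l, r, r'⟩ := h σ hI hA hb
      obtain ⟨υ, t', e', l', r'', r3, r4⟩ := ih (Φ τ) (by omega) τ r
        (hA.trans (e.agree.mono (fun _ h => h) (fun _ h => h))) rfl
      exact ⟨υ, _, .loopStep hb e e', by omega, r'', r3, by omega⟩
    · exact ⟨σ, _, .loopDone hb, by omega, hI, hb, le_rfl⟩

theorem WP.assign {σ : State} {a : ℕ} {e : NExpr} {Q : State → Prop}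
    (h : Q (σ.updateNat a 0 (e.eval σ))) : WP (.assign a e) σ (e.cost + 2) Q :=
  ⟨_, _, .setNat σ a (.lit 0) e, by simp [NExpr.cost]; omega, h⟩

/-- Rule for counting loops whose `j`-th iteration takes time `T j`. -/
theorem WP.forTo {x : ℕ} {n : NExpr} {p : Prog} {σ : State} (I : ℕ → State → Prop) (m : ℕ)
    (T : ℕ → ℕ) (hx : p.writesNat x = false) (h₀ : I 0 (σ.updateNat x 0 0))
    (hn : ∀ j τ, I j τ → Agree (.forTo x n p) σ τ → n.eval τ = m)
    (hb : ∀ j τ, j < m → I j τ → τ.nat x 0 = j → Agree (.forTo x n p) σ τ →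
      WP p τ (T j) (fun υ => I (j + 1) (υ.updateNat x 0 (j + 1)))) :
    WP (.forTo x n p) σ (∑ j ∈ Finset.range m, T j + (n.cost + 20) * (m + 1))
      (fun τ => I m τ ∧ τ.nat x 0 = m) := by
  have key := WP.loop (b := .lt (.var x) n) (p := p ;; .assign x (.add (.var x) (.lit 1)))
    (σ₀ := σ.updateNat x 0 0)
    -- The index of the invariant is read off the loop counter; the potential is the time of the
    -- remaining iterations plus a fixed overhead for each.
    (fun τ => τ.nat x 0 ≤ m ∧ I (τ.nat x 0) τ)
    (fun τ => ∑ j ∈ Finset.Ico (τ.nat x 0) m, T j + (n.cost + 15) * (m - τ.nat x 0))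
    (fun τ hI hA hlt => by
      obtain ⟨hle, hI⟩ := hI
      have hA' : Agree (.forTo x n p) σ τ := by
        refine Agree.trans (τ := σ.updateNat x 0 0) ⟨fun a ha => ?_, fun _ _ => rfl⟩
          (hA.mono ?_ ?_)
        · apply State.updateNat_nat_of_ne
          rintro rfl
          simp [Prog.forTo, Prog.writesNat] at ha
        · intro a ha
          simp [Prog.forTo, Prog.writesNat] at ha ⊢
          tauto
        · intro a ha
          simp [Prog.forTo, Prog.writesVal] at ha ⊢
          tauto
      have hm := hn _ _ hI hA'
      simp only [Test.holds_lt, NExpr.eval, hm] at hlt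
      refine ⟨T (τ.nat x 0) + 6, WP.seq (hb _ _ hlt hI rfl hA') ?_⟩
      intro υ hυ hI'
      refine (WP.assign (Q := fun υ => (υ.nat x 0 ≤ m ∧ I (υ.nat x 0) υ) ∧ T (τ.nat x 0) + 6 +
        (∑ j ∈ Finset.Ico (υ.nat x 0) m, T j + (n.cost + 15) * (m - υ.nat x 0)) +
          (Test.lt (.var x) n).cost + 1 ≤
          ∑ j ∈ Finset.Ico (τ.nat x 0) m, T j + (n.cost + 15) * (m - τ.nat x 0)) ?_).mono
        (by simp [NExpr.cost]) (fun _ _ h => h)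
      have hc : υ.nat x 0 = τ.nat x 0 := by rw [hυ.nat x hx]
      simp only [NExpr.eval, hc, State.updateNat_nat, and_self, if_true]
      refine ⟨⟨hlt, hI'⟩, ?_⟩
      rw [Finset.sum_eq_sum_Ico_succ_bot hlt]
      obtain ⟨d, hd⟩ : ∃ d, m - τ.nat x 0 = d + 1 := ⟨m - τ.nat x 0 - 1, by omega⟩
      have hd' : m - (τ.nat x 0 + 1) = d := by omega
      rw [hd, hd']
      simp only [Test.lt, Test.cost, NExpr.cost]
      ring_nf
      omega)
    (by simpa using h₀)
  refine (WP.seq (WP.assign (e := .lit 0) (Q := fun τ => τ = σ.updateNat x 0 0) rfl)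
    (T₂ := ∑ j ∈ Finset.range m, T j + (n.cost + 15) * m + n.cost + 6) ?_).mono ?_
    (Q := fun τ => I m τ ∧ τ.nat x 0 = m) (fun _ _ h => h)
  · rintro τ hA rfl
    refine key.mono ?_ ?_
    · simp only [Test.lt, Test.cost, NExpr.cost, Finset.range_eq_Ico, State.updateNat_nat, and_self,
        if_true, Nat.sub_zero]
      omega
    · rintro υ hυ ⟨⟨h₁, h₂⟩, h₃, _⟩
      have hA' : Agree (.forTo x n p) σ υ := by
        refine Agree.trans (hA.mono ?_ ?_) (hυ.mono ?_ ?_) <;>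
          (intro a ha; simp [Prog.forTo, Prog.writesNat, Prog.writesVal] at ha ⊢; try tauto)
      have hm := hn _ _ h₂ hA'
      simp only [Test.holds_lt, NExpr.eval, hm] at h₃
      have : υ.nat x 0 = m := by omega
      rw [this] at h₂
      exact ⟨h₂, this⟩
  · simp only [NExpr.cost]
    ring_nf
    omega

/-- Counting loops whose iterations take time at most `B`. -/
theorem WP.forTo_const {x : ℕ} {n : NExpr} {p : Prog} {σ : State} (I : ℕ → State → Prop)
    (m B : ℕ) (hx : p.writesNat x = false) (h₀ : I 0 (σ.updateNat x 0 0))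
    (hn : ∀ j τ, I j τ → Agree (.forTo x n p) σ τ → n.eval τ = m)
    (hb : ∀ j τ, j < m → I j τ → τ.nat x 0 = j → Agree (.forTo x n p) σ τ →
      WP p τ B (fun υ => I (j + 1) (υ.updateNat x 0 (j + 1)))) :
    WP (.forTo x n p) σ ((B + n.cost + 20) * (m + 1)) (fun τ => I m τ ∧ τ.nat x 0 = m) := by
  refine (WP.forTo I m (fun _ => B) hx h₀ hn hb).mono ?_ (fun _ _ h => h)
  simp only [Finset.sum_const, Finset.card_range, smul_eq_mul]
  ring_nf
  omega

/-- Programs without loops. -/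
def Prog.loopFree : Prog → Bool
  | .loop _ _ => false
  | .seq p q => p.loopFree && q.loopFree
  | .cond _ p q => p.loopFree && q.loopFree
  | _ => true

/-- A bound on the time of a program without loops. -/
def Prog.cost : Prog → ℕ
  | .skip => 1
  | .setNat _ i e => i.cost + e.cost + 1
  | .setVal _ i e => i.cost + e.cost + 1
  | .seq p q => p.cost + q.cost
  | .cond b p q => b.cost + (p.cost + q.cost) + 1
  | .loop _ _ => 0

open scoped Classical in
/-- The state in which a program without loops halts. -/
noncomputable def Prog.run : Prog → State → State
  | .skip, σ => σ
  | .setNat a i e, σ => σ.updateNat a (i.eval σ) (e.eval σ)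
  | .setVal a i e, σ => σ.updateVal a (i.eval σ) (e.eval σ)
  | .seq p q, σ => q.run (p.run σ)
  | .cond b p q, σ => if b.Holds σ then p.run σ else q.run σ
  | .loop _ _, σ => σ

/-- Straight-line code is deterministic, so its correctness reduces to evaluating `Prog.run`, which
`simp` can do, and its time to the closed number `Prog.cost`. -/
theorem WP.of_loopFree {p : Prog} (hp : p.loopFree = true) {σ : State} {Q : State → Prop}
    (hQ : Q (p.run σ)) : WP p σ p.cost Q := by
  suffices H : ∀ p : Prog, p.loopFree = true → ∀ σ, WP p σ p.cost (fun τ => τ = p.run σ) from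
    (H p hp σ).mono le_rfl (fun τ _ h => h ▸ hQ)
  clear hp hQ
  intro p
  induction p with
  | skip => exact fun _ σ => ⟨_, _, .skip σ, le_rfl, rfl⟩
  | setNat a i e => exact fun _ σ => ⟨_, _, .setNat σ a i e, le_rfl, rfl⟩
  | setVal a i e => exact fun _ σ => ⟨_, _, .setVal σ a i e, le_rfl, rfl⟩
  | seq p q hp hq =>
    intro h σ
    simp only [Prog.loopFree, Bool.and_eq_true] at h
    exact (hp h.1 σ).seq fun τ _ e => e ▸ hq h.2 τ
  | cond b p q hp hq =>
    intro h σ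
    simp only [Prog.loopFree, Bool.and_eq_true] at h
    refine (WP.cond (T := p.cost + q.cost) (fun hb => ?_) (fun hb => ?_)).mono le_rfl
      (fun _ _ h => h)
    · exact (hp h.1 σ).mono (by omega) (fun τ _ e => by simp [Prog.run, hb, e])
    · exact (hq h.2 σ).mono (by omega) (fun τ _ e => by simp [Prog.run, hb, e])
  | loop b p _ => intro h; simp [Prog.loopFree] at h

end RAM

/-! ### Grammars as tables of numbers

`I` is an initial memory; rules, labels, nodes, edges and values are referred to by their numbers. -/

namespace RAM

namespace State

variable (I : State)

/-- The number of rules. -/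
def numRules : ℕ := I.nat 0 0

/-- The start symbol. -/
def start : ℕ := I.nat 0 1

/-- The left-hand side of a rule. -/
def lhs (r : ℕ) : ℕ := I.nat 5 r

/-- The number of nodes of the right-hand side of a rule. -/
def numV (r : ℕ) : ℕ := I.nat 6 r

/-- The number of edges of the right-hand side of a rule. -/
def numE (r : ℕ) : ℕ := I.nat 7 r

/-- The number of values of a node. -/
def dom (r v : ℕ) : ℕ := I.nat 1 (I.nat 8 (cell r v))

/-- The label of an edge. -/
def lab (r e : ℕ) : ℕ := I.nat 9 (cell r e)

/-- The length of the type of a label. -/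
def len (l : ℕ) : ℕ := I.nat 2 l

/-- Whether a label is a nonterminal. -/
def IsNt (l : ℕ) : Prop := I.nat 4 l ≠ 0

/-- An endpoint of an edge. -/
def att (r e j : ℕ) : ℕ := I.nat 10 (cell (cell r e) j)

/-- An external node. -/
def ext (r j : ℕ) : ℕ := I.nat 11 (cell r j)

/-- The position of the tuple `j ↦ d (a j)` of `n` values in the table of all tuples. -/
def _root_.RAM.tup (s a d : ℕ → ℕ) (n : ℕ) : ℕ :=
  ∑ j ∈ Finset.range n, d (a j) * ∏ i ∈ Finset.range j, s (a i)

/-- The position of the values that `d` assigns to the endpoints of `e`. -/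
def edgeKey (r : ℕ) (d : ℕ → ℕ) (e : ℕ) : ℕ :=
  cell (I.lab r e) (tup (I.dom r) (I.att r e) d (I.len (I.lab r e)))

/-- The position of the values that `d` assigns to the external nodes. -/
def extKey (r : ℕ) (d : ℕ → ℕ) : ℕ :=
  cell (I.lhs r) (tup (I.dom r) (I.ext r) d (I.len (I.lhs r)))

/-- The number of assignments of the nodes of a rule. -/
def numAsg (r : ℕ) : ℕ := ∏ v ∈ Finset.range (I.numV r), I.dom r v

/-- The digit `v` of `i` in the mixed radix system with bases `s`. -/
def _root_.RAM.digit (s : ℕ → ℕ) (i v : ℕ) : ℕ := i / (∏ w ∈ Finset.range v, s w) % s v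

/-- The `i`-th assignment of the nodes of a rule. -/
def asg (r i : ℕ) : ℕ → ℕ := digit (I.dom r) i

open scoped Classical in
/-- The factor of an edge under the assignment `d` if `x` holds the values for nonterminals. -/
noncomputable def edgeVal (x : ℕ → ℝ≥0∞) (r : ℕ) (d : ℕ → ℕ) (e : ℕ) : ℝ≥0∞ :=
  if I.IsNt (I.lab r e) then x (I.edgeKey r d e) else I.val 0 (I.edgeKey r d e)

/-- The contribution of an assignment of a rule. -/
noncomputable def ruleVal (x : ℕ → ℝ≥0∞) (r : ℕ) (d : ℕ → ℕ) : ℝ≥0∞ :=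
  ∏ e ∈ Finset.range (I.numE r), I.edgeVal x r d e

/-- The right-hand sides of the equations for the sum–products of nonterminals. -/
noncomputable def stepK (x : ℕ → ℝ≥0∞) (k : ℕ) : ℝ≥0∞ :=
  ∑ r ∈ Finset.range I.numRules, ∑ i ∈ Finset.range (I.numAsg r),
    if I.extKey r (I.asg r i) = k then I.ruleVal x r (I.asg r i) else 0

theorem edgeVal_mono {x y : ℕ → ℝ≥0∞} (h : x ≤ y) (r : ℕ) (d : ℕ → ℕ) (e : ℕ) :
    I.edgeVal x r d e ≤ I.edgeVal y r d e := by
  unfold edgeVal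
  split_ifs
  exacts [h _, le_rfl]

theorem ruleVal_mono {x y : ℕ → ℝ≥0∞} (h : x ≤ y) (r : ℕ) (d : ℕ → ℕ) :
    I.ruleVal x r d ≤ I.ruleVal y r d :=
  Finset.prod_le_prod' fun _ _ => I.edgeVal_mono h _ _ _

theorem stepK_mono : Monotone I.stepK := by
  intro x y h k
  refine Finset.sum_le_sum fun r _ => Finset.sum_le_sum fun i _ => ?_
  split_ifs
  exacts [I.ruleVal_mono h _ _, le_rfl]

/-- The least solution of the equations for the sum–products of nonterminals. -/
noncomputable def lfpK : ℕ → ℝ≥0∞ := OrderHom.lfp ⟨I.stepK, I.stepK_mono⟩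

theorem stepK_lfpK : I.stepK I.lfpK = I.lfpK := OrderHom.map_lfp ⟨I.stepK, I.stepK_mono⟩

theorem lfpK_le {x : ℕ → ℝ≥0∞} (h : I.stepK x ≤ x) : I.lfpK ≤ x :=
  OrderHom.lfp_le ⟨I.stepK, I.stepK_mono⟩ h

/-- The length of a description of a rule. -/
def size (r : ℕ) : ℕ :=
  I.numV r + I.numE r + ∑ e ∈ Finset.range (I.numE r), I.len (I.lab r e) + I.len (I.lhs r)

/-- Endpoints of edges and external nodes are nodes. -/
structure WellFormed : Prop where
  att_lt : ∀ r < I.numRules, ∀ e < I.numE r, ∀ j < I.len (I.lab r e), I.att r e j < I.numV r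
  ext_lt : ∀ r < I.numRules, ∀ j < I.len (I.lhs r), I.ext r j < I.numV r

/-- The tables that describe the grammar are those of `I`. -/
structure Inp (σ : State) : Prop where
  nat : ∀ a < 12, σ.nat a = I.nat a
  val : σ.val 0 = I.val 0

theorem Inp.agree {I σ τ : State} {p : Prog} (h : I.Inp σ) (hA : Agree p σ τ)
    (hn : (List.range 12).all (fun a => !p.writesNat a) = true) (hv : p.writesVal 0 = false) :
    I.Inp τ :=
  ⟨fun a ha => (hA.nat a (by simpa using List.all_eq_true.1 hn a (List.mem_range.2 ha))).trans
    (h.nat a ha), (hA.val 0 hv).trans h.val⟩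

end State

theorem tup_congr {s a d a' d' : ℕ → ℕ} {n : ℕ} (h : ∀ j < n, d (a j) = d' (a j))
    (ha : ∀ j < n, a j = a' j) : tup s a d n = tup s a' d' n := by
  refine Finset.sum_congr rfl fun j hj => ?_
  rw [Finset.mem_range] at hj
  rw [h j hj, ha j hj]
  congr 1
  refine Finset.prod_congr rfl fun i hi => ?_
  rw [Finset.mem_range] at hi
  rw [ha i (by omega)]

/-! Array numbers used by the programs. Natural numbers: `20` rule, `21` node, `22` number of
assignments, `23` assignment, `24` values of the nodes, `25` edge, `26` position in a type, `27`
position of a tuple, `28` product of domain sizes, `29` key, `30` successor of the key of the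
selected edge, `31` level, `32` ranks of labels, `33` which keys are listed, `34` list of keys, `35`
its length. Elements of `[0, ∞]`: `2` values for nonterminals, `3` matrix, `4` product. -/

/-- The label of the current edge. -/
def eLab : NExpr := .get 9 (.cell (.var 20) (.var 25))

/-- The left-hand side of the current rule. -/
def eLhs : NExpr := .get 5 (.var 20)

/-- The number of values of a node of the current rule. -/
def eDom (v : NExpr) : NExpr := .get 1 (.get 8 (.cell (.var 20) v))

/-- Computes the position of the tuple of values of `n` nodes of the current rule. -/
def tupleProg (node n : NExpr) : Prog :=
  .assign 27 (.lit 0) ;; .assign 28 (.lit 1) ;;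
  .forTo 26 n
    (.assign 27 (.add (.var 27) (.mul (.get 24 node) (.var 28))) ;;
      .assign 28 (.mul (.var 28) (eDom node)))

/-- The expression `node` reads the loop position `26` and is evaluated while `27` and `28` change.
It is therefore required to have the intended value in every state that agrees with `σ` outside of
the arrays written here. -/
theorem wp_tuple (node n : NExpr) : ∃ K, ∀ (I σ : State) (a : ℕ → ℕ) (m : ℕ), I.Inp σ →
    (∀ τ, Agree (tupleProg node n) σ τ → n.eval τ = m) →
    (∀ τ, Agree (tupleProg node n) σ τ → node.eval τ = a (τ.nat 26 0)) →
    WP (tupleProg node n) σ (K * (m + 1))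
      (fun τ => τ.nat 27 0 = tup (I.dom (σ.nat 20 0)) a (σ.nat 24) m) := by
  set body : Prog := (.assign 27 (.add (.var 27) (.mul (.get 24 node) (.var 28))) ;;
      .assign 28 (.mul (.var 28) (eDom node)))
  refine ⟨20 + (body.cost + n.cost + 20), fun I σ a m hI hn hnode => ?_⟩
  refine ((WP.assign (Q := fun τ => τ.nat 27 0 = 0) ?_).seq fun τ hτ h27 =>
    (WP.assign (Q := fun τ => τ.nat 27 0 = 0 ∧ τ.nat 28 0 = 1) ?_).seq fun υ hυ h28 =>
    WP.forTo_const (fun j τ => τ.nat 27 0 = tup (I.dom (σ.nat 20 0)) a (σ.nat 24) j ∧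
      τ.nat 28 0 = ∏ i ∈ Finset.range j, I.dom (σ.nat 20 0) (a i)) m body.cost rfl ?_ ?_ ?_).mono
      ?_ ?_
  · simp
  · simp [h27]
  · simp [tup, h28]
  · exact fun j τ' _ hA => hn _ (hτ.seq_left.trans (hυ.seq_left.trans hA.seq_right).seq_right)
  · intro j τ' hj h hj' hA
    have hA' : Agree (tupleProg node n) σ τ' :=
      hτ.seq_left.trans (hυ.seq_left.trans hA.seq_right).seq_right
    have e := hnode _ hA'
    have e' := fun x => hnode (τ'.updateNat 27 0 x) (hA'.updateNat rfl)
    simp only [hj', State.updateNat_nat, Nat.reduceEqDiff, false_and, if_false] at e e'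
    refine WP.of_loopFree rfl ?_
    have h24 : τ'.nat 24 = σ.nat 24 := hA'.nat 24 rfl
    have h20 : τ'.nat 20 = σ.nat 20 := hA'.nat 20 rfl
    have hi := hI.agree hA' rfl rfl
    have h1 := hi.nat 1 (by norm_num)
    have h8 := hi.nat 8 (by norm_num)
    simp [Prog.run, e, h.1, h.2, h24, h20, eDom, e', h1, h8, Finset.prod_range_succ, tup,
      Finset.sum_range_succ, State.dom]
  · simp only [NExpr.cost]
    ring_nf
    omega
  · intro τ _ h
    exact h.1.1


/-! ### Mixed radix numbers -/

theorem tup_id_lt {s d : ℕ → ℕ} {n : ℕ} (h : ∀ v < n, d v < s v) :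
    tup s id d n < ∏ v ∈ Finset.range n, s v := by
  induction n with
  | zero => simp [tup]
  | succ n ih =>
    have h1 := ih fun v hv => h v (by omega)
    have h2 := h n (by omega)
    simp only [tup, Finset.sum_range_succ, Finset.prod_range_succ, id] at h1 ⊢
    set P := ∏ v ∈ Finset.range n, s v
    calc _ < P + d n * P := by omega
      _ = P * (d n + 1) := by ring
      _ ≤ _ := Nat.mul_le_mul_left _ h2

theorem tup_id_digit (s : ℕ → ℕ) (i n : ℕ) :
    tup s id (digit s i) n = i % ∏ v ∈ Finset.range n, s v := by
  induction n with
  | zero => simp [tup, Nat.mod_one]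
  | succ n ih =>
    simp only [tup, id] at ih
    rw [Finset.prod_range_succ, Nat.mod_mul, ← ih]
    simp [tup, Finset.sum_range_succ, digit, mul_comm]

theorem digit_lt {s : ℕ → ℕ} {i n : ℕ} (h : i < ∏ v ∈ Finset.range n, s v) {v : ℕ} (hv : v < n) :
    digit s i v < s v := by
  refine Nat.mod_lt _ (Nat.pos_of_ne_zero fun h0 => ?_)
  rw [Finset.prod_eq_zero (Finset.mem_range.2 hv) h0] at h
  omega

/-- A later summand is a multiple of the product of the first `v + 1` bases and does not affect
digit `v`. Together with `tup_id_digit` this makes assignments and numbers below the product of the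
bases correspond bijectively. -/
theorem digit_tup_id {s d : ℕ → ℕ} {n : ℕ} (h : ∀ v < n, d v < s v) {v : ℕ} (hv : v < n) :
    digit s (tup s id d n) v = d v := by
  induction n with
  | zero => omega
  | succ n ih =>
    have h' : ∀ v < n, d v < s v := fun v hv => h v (by omega)
    have e : tup s id d (n + 1) = tup s id d n + d n * ∏ w ∈ Finset.range n, s w := by
      simp [tup, Finset.sum_range_succ]
    rcases Nat.lt_succ_iff_lt_or_eq.1 hv with hv | rfl
    · have : ∏ w ∈ Finset.range n, s w = (∏ w ∈ Finset.range v, s w) * s v *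
          ∏ w ∈ Finset.Ico (v + 1) n, s w := by
        rw [← Finset.prod_range_succ, Finset.prod_range_mul_prod_Ico _ (by omega)]
      have hP : 0 < ∏ w ∈ Finset.range v, s w :=
        Finset.prod_pos fun w hw => (Nat.zero_le _).trans_lt (h' w (by simp at hw; omega))
      rw [← ih h' hv, e, this]
      unfold digit
      rw [show ∀ x a b c D : ℕ, x + D * (a * b * c) = x + a * (b * (D * c)) by intros; ring,
        Nat.add_mul_div_left _ _ hP, Nat.add_mul_mod_self_left]
    · have hP : 0 < ∏ w ∈ Finset.range v, s w :=
        Finset.prod_pos fun w hw => (Nat.zero_le _).trans_lt (h' w (by simp at hw; omega))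
      rw [e]
      unfold digit
      rw [Nat.add_mul_div_right _ _ hP, Nat.div_eq_of_lt (tup_id_lt h'), zero_add,
        Nat.mod_eq_of_lt (h v hv)]

/-! ### Processing a rule -/

namespace State

variable (I : State) (x : ℕ → ℝ≥0∞) (rk : ℕ → ℕ) (c r : ℕ) (d : ℕ → ℕ)

/-- Nonterminal edges with a label of rank `c`. -/
def Sel (e : ℕ) : Prop := I.IsNt (I.lab r e) ∧ rk (I.lab r e) = c

open scoped Classical in
/-- The successor of the key of the last selected edge, `0` if there is none. -/
noncomputable def selKey : ℕ → ℕ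
  | 0 => 0
  | n + 1 => if I.Sel rk c r n then I.edgeKey r d n + 1 else selKey n

open scoped Classical in
/-- The contribution of an assignment of a rule without the selected edges. -/
noncomputable def openVal (n : ℕ) : ℝ≥0∞ :=
  ∏ e ∈ Finset.range n, if I.Sel rk c r e then 1 else I.edgeVal x r d e

variable {I x rk c r d}

/-- Beyond the nodes of the current rule, array `24` holds arbitrary remains of other rules. They
are never read, because endpoints are nodes. -/
theorem edgeKey_congr (hI : I.WellFormed) (hr : r < I.numRules) {d' : ℕ → ℕ}
    (h : ∀ v < I.numV r, d v = d' v) {e : ℕ} (he : e < I.numE r) :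
    I.edgeKey r d e = I.edgeKey r d' e := by
  unfold edgeKey
  rw [tup_congr (fun j hj => h _ (hI.att_lt r hr e he j hj)) (fun _ _ => rfl)]

theorem extKey_congr (hI : I.WellFormed) (hr : r < I.numRules) {d' : ℕ → ℕ}
    (h : ∀ v < I.numV r, d v = d' v) : I.extKey r d = I.extKey r d' := by
  unfold extKey
  rw [tup_congr (fun j hj => h _ (hI.ext_lt r hr j hj)) (fun _ _ => rfl)]

theorem selKey_congr (hI : I.WellFormed) (hr : r < I.numRules) {d' : ℕ → ℕ}
    (h : ∀ v < I.numV r, d v = d' v) {n : ℕ} (hn : n ≤ I.numE r) :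
    I.selKey rk c r d n = I.selKey rk c r d' n := by
  induction n with
  | zero => rfl
  | succ n ih => simp only [selKey, edgeKey_congr hI hr h hn, ih (by omega)]

/-- While a rule is processed, the values change only at keys of its left-hand side. Edges with that
label are selected by `hr'`, so the product does not read a changed entry. -/
theorem openVal_congr (hI : I.WellFormed) (hr : r < I.numRules) {d' : ℕ → ℕ} {x' : ℕ → ℝ≥0∞}
    (h : ∀ v < I.numV r, d v = d' v)
    (hx : ∀ l t, l ≠ I.lhs r → x (cell l t) = x' (cell l t))
    (hr' : ∀ e < I.numE r, I.IsNt (I.lab r e) → I.lab r e = I.lhs r → rk (I.lab r e) = c) :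
    I.openVal x rk c r d (I.numE r) = I.openVal x' rk c r d' (I.numE r) := by
  refine Finset.prod_congr rfl fun e he => ?_
  rw [Finset.mem_range] at he
  split_ifs with hs
  · rfl
  · unfold edgeVal
    rw [edgeKey_congr hI hr h he]
    split_ifs with ht
    · exact hx _ _ fun hl => hs ⟨ht, hr' e he ht hl⟩
    · rfl

end State

/-- The position of the tuple of values of the endpoints of the current edge. -/
def attProg : Prog := tupleProg (.get 10 (.cell (.cell (.var 20) (.var 25)) (.var 26))) (.get 2 eLab)

/-- The position of the tuple of values of the external nodes. -/
def extProg : Prog := tupleProg (.get 11 (.cell (.var 20) (.var 26))) (.get 2 eLhs)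

/-- Multiplies by the factor of the current edge, or selects this edge. -/
def edgeProg : Prog :=
  attProg ;; .assign 29 (.cell eLab (.var 27)) ;;
  .cond (.eq (.get 4 eLab) (.lit 0)) (.assignVal 4 (.mul (.var 4) (.get 0 (.var 29))))
    (.cond (.eq (.get 32 eLab) (.var 31)) (.assign 30 (.add (.var 29) (.lit 1)))
      (.assignVal 4 (.mul (.var 4) (.get 2 (.var 29)))))

/-- Multiplies the factors of all edges of the current rule that are not selected. -/
def edgesProg : Prog :=
  .assignVal 4 .one ;; .assign 30 (.lit 0) ;; .forTo 25 (.get 7 (.var 20)) edgeProg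

theorem wp_edge : ∃ K, ∀ I σ : State, I.Inp σ →
    WP edgeProg σ (K * (I.len (I.lab (σ.nat 20 0) (σ.nat 25 0)) + 1)) (fun τ =>
      τ.val 4 0 = σ.val 4 0 * (open scoped Classical in
        if I.Sel (σ.nat 32) (σ.nat 31 0) (σ.nat 20 0) (σ.nat 25 0) then 1 else
          I.edgeVal (σ.val 2) (σ.nat 20 0) (σ.nat 24) (σ.nat 25 0)) ∧
      τ.nat 30 0 = open scoped Classical in
        if I.Sel (σ.nat 32) (σ.nat 31 0) (σ.nat 20 0) (σ.nat 25 0) then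
          I.edgeKey (σ.nat 20 0) (σ.nat 24) (σ.nat 25 0) + 1 else σ.nat 30 0) := by
  obtain ⟨K, hK⟩ := wp_tuple (.get 10 (.cell (.cell (.var 20) (.var 25)) (.var 26))) (.get 2 eLab)
  refine ⟨K + 200, fun I σ hI => ?_⟩
  refine (WP.seq (hK I σ (I.att (σ.nat 20 0) (σ.nat 25 0))
    (I.len (I.lab (σ.nat 20 0) (σ.nat 25 0))) hI ?_ ?_) (T₂ := 200) ?_).mono ?_ (fun _ _ h => h)
  · intro τ hτ
    have hi := hI.agree hτ rfl rfl
    simp [eLab, hi.nat, hτ.nat 20 rfl, hτ.nat 25 rfl, State.lab, State.len]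
  · intro τ hτ
    have hi := hI.agree hτ rfl rfl
    simp [hi.nat, hτ.nat 20 rfl, hτ.nat 25 rfl, State.att]
  · intro τ hτ h27
    refine (WP.of_loopFree rfl ?_).mono (show Prog.cost _ ≤ 200 by decide) (fun _ _ h => h)
    have hi := hI.agree hτ rfl rfl
    have h4 := hi.nat 4 (by norm_num)
    have h9 := hi.nat 9 (by norm_num)
    have hv2 := hτ.val 2 rfl
    have hv4 := hτ.val 4 rfl
    have h32 := hτ.nat 32 rfl
    have h31 := hτ.nat 31 rfl
    have h30 := hτ.nat 30 rfl
    have h20 := hτ.nat 20 rfl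
    have h25 := hτ.nat 25 rfl
    simp only [Prog.run, eLab, NExpr.eval, VExpr.eval, Test.holds_eq, NExpr.eval_cell, h27, h20,
      h25, h9, State.updateNat_nat, State.updateNat_val]
    simp only [Nat.reduceEqDiff, false_and, and_self, if_false, if_true, h4, h31, h32, hi.val, hv2,
      hv4]
    by_cases hT : I.nat 4 (I.nat 9 (cell (σ.nat 20 0) (σ.nat 25 0))) = 0
    · simp [hT, State.Sel, State.IsNt, State.lab, State.edgeVal, State.edgeKey, h30]
    · by_cases hS : σ.nat 32 (I.nat 9 (cell (σ.nat 20 0) (σ.nat 25 0))) = σ.nat 31 0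
      · simp [hT, hS, State.Sel, State.IsNt, State.lab, State.edgeKey, hv4]
      · simp [hT, hS, State.Sel, State.IsNt, State.lab, State.edgeVal, State.edgeKey, h30]
  · ring_nf
    omega

theorem wp_edges : ∃ K, ∀ I σ : State, I.Inp σ →
    WP edgesProg σ (K * (I.size (σ.nat 20 0) + 1)) (fun τ =>
      τ.val 4 0 = I.openVal (σ.val 2) (σ.nat 32) (σ.nat 31 0) (σ.nat 20 0) (σ.nat 24)
        (I.numE (σ.nat 20 0)) ∧
      τ.nat 30 0 = I.selKey (σ.nat 32) (σ.nat 31 0) (σ.nat 20 0) (σ.nat 24)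
        (I.numE (σ.nat 20 0))) := by
  obtain ⟨K, hK⟩ := wp_edge
  refine ⟨K + 100, fun I σ hI => ?_⟩
  set r := σ.nat 20 0 with hr
  refine ((WP.of_loopFree (p := .assignVal 4 .one) rfl (Q := fun τ => τ.val 4 0 = 1) ?_).seq
    fun τ hτ h4 => (WP.assign (Q := fun τ => τ.val 4 0 = 1 ∧ τ.nat 30 0 = 0) ?_).seq fun υ hυ h =>
    WP.forTo (fun e τ => τ.val 4 0 = I.openVal (σ.val 2) (σ.nat 32) (σ.nat 31 0) r (σ.nat 24) e ∧
      τ.nat 30 0 = I.selKey (σ.nat 32) (σ.nat 31 0) r (σ.nat 24) e) (I.numE r)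
      (fun e => K * (I.len (I.lab r e) + 1)) rfl ?_ ?_ ?_).mono ?_ ?_
  · simp [Prog.run]
  · simp [h4]
  · simp [h, State.openVal, State.selKey]
  · intro j τ' _ hA
    have hA' : Agree edgesProg σ τ' := hτ.seq_left.trans (hυ.seq_left.trans hA.seq_right).seq_right
    have hi := hI.agree hA' rfl rfl
    simp [hi.nat, hA'.nat 20 rfl, hr, State.numE]
  · intro j τ' hj ⟨h₁, h₂⟩ hj' hA
    have hA' : Agree edgesProg σ τ' := hτ.seq_left.trans (hυ.seq_left.trans hA.seq_right).seq_right
    refine (hK I τ' (hI.agree hA' rfl rfl)).mono ?_ ?_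
    · simp [hj', hA'.nat 20 rfl, hr]
    · rintro υ' _ ⟨h₃, h₄⟩
      rw [hj', hA'.nat 20 rfl, hA'.nat 32 rfl, hA'.nat 31 rfl, hA'.nat 24 rfl] at h₃ h₄
      simp only [State.updateNat_nat, State.updateNat_val, h₃, h₄, h₁, h₂, State.openVal,
        Finset.prod_range_succ, State.selKey, hA'.val 2 rfl, ← hr]
      simp
  · have : ∑ e ∈ Finset.range (I.numE r), K * (I.len (I.lab r e) + 1) =
      K * (∑ e ∈ Finset.range (I.numE r), I.len (I.lab r e) + I.numE r) := by
      simp [← Finset.mul_sum, Finset.sum_add_distrib]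
    rw [this]
    simp only [NExpr.cost, Prog.cost, VExpr.cost, State.size]
    ring_nf
    omega
  · exact fun τ _ h => h.1


/-- The list of keys found so far. -/
def State.keys (σ : State) : List ℕ := (List.range (σ.nat 35 0)).map (σ.nat 34)

/-- The list of keys has no repetitions, and the keys on it are marked. -/
structure State.KeysOK (σ : State) : Prop where
  nodup : σ.keys.Nodup
  mem : ∀ k, σ.nat 33 k ≠ 0 ↔ k ∈ σ.keys

theorem State.keys_congr {σ τ : State} (h : τ.nat 34 = σ.nat 34) (h' : τ.nat 35 = σ.nat 35) :
    τ.keys = σ.keys := by simp [State.keys, h, h']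

theorem State.KeysOK.congr {σ τ : State} (hσ : σ.KeysOK) (h : τ.nat 34 = σ.nat 34)
    (h' : τ.nat 35 = σ.nat 35) (h'' : τ.nat 33 = σ.nat 33) : τ.KeysOK := by
  have := State.keys_congr h h'
  exact ⟨this ▸ hσ.nodup, fun k => by rw [this, h'', hσ.mem]⟩

/-- Adds the key `29` to the list. -/
def listProg : Prog :=
  .cond (.eq (.get 33 (.var 29)) (.lit 0))
    (.setNat 33 (.var 29) (.lit 1) ;; .setNat 34 (.var 35) (.var 29) ;;
      .assign 35 (.add (.var 35) (.lit 1))) .skip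

/-- Adds the contribution of an assignment to the entry of the values or of the matrix. -/
def addProg : Prog :=
  .cond (.eq (.var 30) (.lit 0))
    (.setVal 2 (.var 29) (.add (.get 2 (.var 29)) (.var 4)))
    (.setVal 3 (.cell (.var 29) (.var 30)) (.add (.get 3 (.cell (.var 29) (.var 30))) (.var 4)))

/-- Adds the contribution of an assignment. -/
def outProg : Prog :=
  extProg ;; .assign 29 (.cell eLhs (.var 27)) ;; listProg ;; addProg

/-- The marks in array `33` replace a search through the list, so that listing a key takes constant
time. -/
theorem run_listProg (σ : State) (hσ : σ.KeysOK) :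
    (listProg.run σ).KeysOK ∧ (∃ l, (listProg.run σ).keys = σ.keys ++ l) ∧
      ∀ y, y ∈ (listProg.run σ).keys ↔ y ∈ σ.keys ∨ y = σ.nat 29 0 := by
  by_cases h : σ.nat 33 (σ.nat 29 0) = 0
  · have hk : σ.nat 29 0 ∉ σ.keys := fun h' => (hσ.mem _).2 h' h
    have e : (listProg.run σ).keys = σ.keys ++ [σ.nat 29 0] := by
      simp only [listProg, Prog.run, Test.holds_eq, NExpr.eval, h, if_true, State.keys,
        State.updateNat_nat, and_self, Nat.reduceEqDiff, false_and, if_false, List.range_succ,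
        List.map_append, List.map_cons, List.map_nil]
      congr 1
      refine List.map_congr_left fun i hi => ?_
      rw [List.mem_range] at hi
      simp [hi.ne]
    refine ⟨⟨?_, fun k => ?_⟩, ⟨_, e⟩, fun y => ?_⟩
    · rw [e]
      simp [List.nodup_append, hσ.nodup]
      rintro a ha rfl
      exact hk ha
    · rw [e, List.mem_append, ← hσ.mem]
      simp only [listProg, Prog.run, Test.holds_eq, NExpr.eval, h, if_true, State.updateNat_nat]
      by_cases hk' : k = σ.nat 29 0 <;> simp [hk']
    · rw [e]; simp
  · have e : listProg.run σ = σ := by simp [listProg, Prog.run, h]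
    rw [e]
    refine ⟨hσ, ⟨[], by simp⟩, fun y => ⟨Or.inl, ?_⟩⟩
    rintro (hy | rfl)
    exacts [hy, (hσ.mem _).1 h]

/-- Register `30` is the successor of a key, so that 0 can mean that no edge was selected. In that
case the product is a constant term and goes to the vector; otherwise it is a coefficient and goes
to the matrix, in a column whose index is shifted by one. -/
theorem wp_out : ∃ K, ∀ I σ : State, I.Inp σ → σ.KeysOK →
    WP outProg σ (K * (I.len (I.lhs (σ.nat 20 0)) + 1)) (fun τ =>
      τ.KeysOK ∧ (∃ l, τ.keys = σ.keys ++ l) ∧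
      (∀ y, y ∈ τ.keys ↔ y ∈ σ.keys ∨ y = I.extKey (σ.nat 20 0) (σ.nat 24)) ∧
      (∀ y, τ.val 2 y = σ.val 2 y +
        if I.extKey (σ.nat 20 0) (σ.nat 24) = y ∧ σ.nat 30 0 = 0 then σ.val 4 0 else 0) ∧
      (∀ y, τ.val 3 y = σ.val 3 y +
        if cell (I.extKey (σ.nat 20 0) (σ.nat 24)) (σ.nat 30 0) = y ∧ σ.nat 30 0 ≠ 0
        then σ.val 4 0 else 0)) := by
  obtain ⟨K, hK⟩ := wp_tuple (.get 11 (.cell (.var 20) (.var 26))) (.get 2 eLhs)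
  refine ⟨K + 200, fun I σ hI hk => ?_⟩
  refine (WP.seq (hK I σ (I.ext (σ.nat 20 0)) (I.len (I.lhs (σ.nat 20 0))) hI ?_ ?_) (T₂ := 200)
    ?_).mono ?_ (fun _ _ h => h)
  · intro τ hτ
    have hi := hI.agree hτ rfl rfl
    simp [eLhs, hi.nat, hτ.nat 20 rfl, State.lhs, State.len]
  · intro τ hτ
    have hi := hI.agree hτ rfl rfl
    simp [hi.nat, hτ.nat 20 rfl, State.ext]
  · intro τ hτ h27
    refine (WP.of_loopFree rfl ?_).mono (show Prog.cost _ ≤ 200 by decide) (fun _ _ h => h)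
    have hi := hI.agree hτ rfl rfl
    set τ' := τ.updateNat 29 0 (I.extKey (σ.nat 20 0) (σ.nat 24)) with hτ'
    have e : Prog.run (.assign 29 (.cell eLhs (.var 27)) ;; listProg ;; addProg) τ =
        addProg.run (listProg.run τ') := by
      simp [Prog.run, eLhs, h27, hτ.nat 20 rfl, hi.nat, hτ', State.extKey, State.lhs]
    rw [e]
    have h29 : τ'.nat 29 0 = I.extKey (σ.nat 20 0) (σ.nat 24) := by simp [hτ']
    have hτ34 : τ'.nat 34 = σ.nat 34 := by
      rw [hτ', State.updateNat_nat_of_ne _ _ _ (by norm_num)]; exact hτ.nat 34 rfl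
    have hτ35 : τ'.nat 35 = σ.nat 35 := by
      rw [hτ', State.updateNat_nat_of_ne _ _ _ (by norm_num)]; exact hτ.nat 35 rfl
    have hτ33 : τ'.nat 33 = σ.nat 33 := by
      rw [hτ', State.updateNat_nat_of_ne _ _ _ (by norm_num)]; exact hτ.nat 33 rfl
    have hk' : τ'.KeysOK := hk.congr hτ34 hτ35 hτ33
    obtain ⟨h₁, h₂, h₃⟩ := run_listProg τ' hk'
    rw [State.keys_congr hτ34 hτ35] at h₂ h₃
    obtain ⟨_, _, ex, _, hυ⟩ :=
      WP.of_loopFree (p := listProg) (σ := τ') rfl (Q := fun τ => τ = listProg.run τ') rfl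
    have hA := ex.agree
    rw [hυ] at hA
    set υ := listProg.run τ'
    have hυ29 : υ.nat 29 0 = I.extKey (σ.nat 20 0) (σ.nat 24) := by rw [hA.nat 29 rfl, h29]
    have hυ30 : υ.nat 30 0 = σ.nat 30 0 := by
      rw [hA.nat 30 rfl, hτ', State.updateNat_nat_of_ne _ _ _ (by norm_num), hτ.nat 30 rfl]
    have hυ2 : υ.val 2 = σ.val 2 := by rw [hA.val 2 rfl, hτ', State.updateNat_val, hτ.val 2 rfl]
    have hυ3 : υ.val 3 = σ.val 3 := by rw [hA.val 3 rfl, hτ', State.updateNat_val, hτ.val 3 rfl]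
    have hυ4 : υ.val 4 = σ.val 4 := by rw [hA.val 4 rfl, hτ', State.updateNat_val, hτ.val 4 rfl]
    have hn : (addProg.run υ).nat = υ.nat := by
      simp only [addProg, Prog.run]; split_ifs <;> rfl
    rw [h29] at h₃
    have hkeys : (addProg.run υ).keys = υ.keys := by simp [State.keys, hn]
    refine ⟨⟨by rw [hkeys]; exact h₁.nodup, by rw [hkeys, hn]; exact h₁.mem⟩, by rwa [hkeys],
      by rwa [hkeys], fun y => ?_, fun y => ?_⟩
    · simp only [addProg, Prog.run, Test.holds_eq, NExpr.eval, VExpr.eval, hυ29, hυ30, hυ2, hυ4]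
      by_cases h0 : σ.nat 30 0 = 0
      · by_cases hy : y = I.extKey (σ.nat 20 0) (σ.nat 24)
        · simp [h0, hy]
        · simp [h0, hy, hυ2, Ne.symm hy]
      · simp [h0, hυ2]
    · simp only [addProg, Prog.run, Test.holds_eq, NExpr.eval, VExpr.eval, hυ29, hυ30, hυ3, hυ4,
        NExpr.eval_cell]
      by_cases h0 : σ.nat 30 0 = 0
      · simp [h0, hυ3]
      · by_cases hy : y = cell (I.extKey (σ.nat 20 0) (σ.nat 24)) (σ.nat 30 0)
        · simp [h0, hy]
        · simp [h0, hy, hυ3, Ne.symm hy]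
  · ring_nf
    omega

/-- Passes to the next assignment of the nodes of the current rule. -/
def nextProg : Prog :=
  .assign 21 (.lit 0) ;;
  .loop (.conj (.lt (.var 21) (.get 6 (.var 20)))
      (.nle (eDom (.var 21)) (.add (.get 24 (.var 21)) (.lit 1))))
    (.setNat 24 (.var 21) (.lit 0) ;; .assign 21 (.add (.var 21) (.lit 1))) ;;
  .setNat 24 (.var 21) (.add (.get 24 (.var 21)) (.lit 1))

/-- Both replaced digits are moved to the side where they are added, to avoid truncated subtraction.
-/
theorem tup_id_update {s d : ℕ → ℕ} {n v y : ℕ} (hv : v < n) :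
    tup s id (Function.update d v y) n + d v * ∏ w ∈ Finset.range v, s w =
      tup s id d n + y * ∏ w ∈ Finset.range v, s w := by
  have h : ∀ d : ℕ → ℕ, tup s id d n = (∑ j ∈ (Finset.range n).erase v,
      d j * ∏ i ∈ Finset.range j, s i) + d v * ∏ w ∈ Finset.range v, s w := fun d => by
    simp only [tup, id]
    rw [Finset.sum_erase_add _ _ (Finset.mem_range.2 hv)]
  rw [h, h d, Function.update_self, Finset.sum_congr rfl (fun j hj => by
    rw [Function.update_of_ne (Finset.ne_of_mem_erase hj)])]
  ring

/-- This is the increment of a mixed radix counter. The invariant says that the current number plus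
the place value of position `21` is `i + 1`: resetting a maximal digit to 0 loses exactly what the
place value gains when the carry moves on. -/
theorem wp_next : ∃ K, ∀ (I σ : State) (i : ℕ), I.Inp σ → i < I.numAsg (σ.nat 20 0) →
    (∀ v < I.numV (σ.nat 20 0), σ.nat 24 v = I.asg (σ.nat 20 0) i v) →
    WP nextProg σ (K * (I.numV (σ.nat 20 0) + 1)) (fun τ =>
      i + 1 < I.numAsg (σ.nat 20 0) →
        ∀ v < I.numV (σ.nat 20 0), τ.nat 24 v = I.asg (σ.nat 20 0) (i + 1) v) := by
  refine ⟨200, fun I σ i hI hi hd => ?_⟩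
  set r := σ.nat 20 0 with hr
  set n := I.numV r
  set s := I.dom r
  refine ((WP.assign (Q := fun τ => τ.nat 21 0 = 0) (by simp)).seq fun τ hτ h21 =>
    ((WP.loop (fun υ => υ.nat 21 0 ≤ n ∧ (∀ v < n, υ.nat 24 v < s v) ∧
      tup s id (υ.nat 24) n + ∏ w ∈ Finset.range (υ.nat 21 0), s w = i + 1)
      (fun υ => 100 * (n - υ.nat 21 0)) ?_ ?_).mono (T' := 100 * n + 50) ?_
      (fun _ _ h => h)).seq (T₂ := 10) ?_).mono ?_ (fun _ _ h => h)
  · rintro υ ⟨h₁, h₂, h₃⟩ hA hb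
    have hA' : Agree nextProg σ υ := hτ.seq_left.trans hA.seq_left.seq_right
    have hi := hI.agree hA' rfl rfl
    simp only [Test.Holds, Test.holds_lt, NExpr.eval, eDom, NExpr.eval_cell,
      hi.nat 1 (by norm_num), hi.nat 6 (by norm_num), hi.nat 8 (by norm_num), hA'.nat 20 rfl,
      ← hr] at hb
    obtain ⟨hb₁, hb₂⟩ := hb
    change υ.nat 21 0 < n at hb₁
    change s (υ.nat 21 0) ≤ _ at hb₂
    refine ⟨20, (WP.of_loopFree rfl ?_).mono (show Prog.cost _ ≤ 20 by decide) (fun _ _ h => h)⟩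
    have e24 : (Prog.run (.setNat 24 (.var 21) (.lit 0) ;;
        .assign 21 (.add (.var 21) (.lit 1))) υ).nat 24 =
        Function.update (υ.nat 24) (υ.nat 21 0) 0 := by
      funext v
      simp [Prog.run, Function.update_apply]
    have e21 : (Prog.run (.setNat 24 (.var 21) (.lit 0) ;;
        .assign 21 (.add (.var 21) (.lit 1))) υ).nat 21 0 = υ.nat 21 0 + 1 := by
      simp [Prog.run]
    rw [e24, e21]
    have hlt := h₂ _ hb₁
    have hu := tup_id_update (s := s) (d := υ.nat 24) (y := 0) hb₁
    rw [zero_mul, add_zero] at hu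
    have hs : s (υ.nat 21 0) = υ.nat 24 (υ.nat 21 0) + 1 := by omega
    refine ⟨⟨hb₁, fun v hv => ?_, ?_⟩, ?_⟩
    · rw [Function.update_apply]
      split_ifs with h
      · subst h; omega
      · exact h₂ v hv
    · rw [Finset.prod_range_succ, hs, mul_add, mul_one, mul_comm _ (υ.nat 24 _)]
      omega
    · simp only [Test.cost, Test.lt, NExpr.cost, eDom, NExpr.cell]
      omega
  · have h24 : τ.nat 24 = σ.nat 24 := hτ.nat 24 rfl
    refine ⟨by omega, fun v hv => ?_, ?_⟩
    · rw [h24, hd v hv]; exact digit_lt hi hv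
    · rw [h21, h24, show tup s id (σ.nat 24) n = tup s id (digit s i) n from
        tup_congr (fun j hj => hd j hj) (fun _ _ => rfl), tup_id_digit,
        Nat.mod_eq_of_lt (show i < ∏ v ∈ Finset.range n, s v from hi)]
      simp
  · simp only [Test.cost, Test.lt, NExpr.cost, eDom, NExpr.cell, h21]
    omega
  · rintro υ hA ⟨⟨h₁, h₂, h₃⟩, hb, -⟩
    have hA' : Agree nextProg σ υ := hτ.seq_left.trans hA.seq_left.seq_right
    have hi' := hI.agree hA' rfl rfl
    refine (WP.of_loopFree rfl ?_).mono (show Prog.cost _ ≤ 10 by decide) (fun _ _ h => h)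
    intro hi1 v hv
    have e24 : (Prog.run (.setNat 24 (.var 21) (.add (.get 24 (.var 21)) (.lit 1))) υ).nat 24 =
        Function.update (υ.nat 24) (υ.nat 21 0) (υ.nat 24 (υ.nat 21 0) + 1) := by
      funext v
      simp [Prog.run, Function.update_apply]
    rw [e24]
    -- If the carry left the last position, the place value would be the number of all assignments,
    -- and the invariant would contradict that there is an assignment `i + 1`.
    have h21n : υ.nat 21 0 < n := by
      refine lt_of_le_of_ne h₁ fun h => ?_
      have : ∏ w ∈ Finset.range (υ.nat 21 0), s w = I.numAsg r := by rw [h]; rfl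
      omega
    simp only [Test.Holds, Test.holds_lt, NExpr.eval, eDom, NExpr.eval_cell,
      hi'.nat 1 (by norm_num), hi'.nat 6 (by norm_num), hi'.nat 8 (by norm_num), hA'.nat 20 rfl,
      ← hr, not_and] at hb
    have hb' : ¬ s (υ.nat 21 0) ≤ υ.nat 24 (υ.nat 21 0) + 1 := hb h21n
    have hu := tup_id_update (s := s) (d := υ.nat 24) (y := υ.nat 24 (υ.nat 21 0) + 1) h21n
    have hval : tup s id (Function.update (υ.nat 24) (υ.nat 21 0) (υ.nat 24 (υ.nat 21 0) + 1)) n =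
        i + 1 := by
      rw [← h₃]
      rw [add_mul, one_mul] at hu
      omega
    have := digit_tup_id (s := s) (n := n)
      (d := Function.update (υ.nat 24) (υ.nat 21 0) (υ.nat 24 (υ.nat 21 0) + 1)) (fun w hw => by
        rw [Function.update_apply]
        split_ifs with h
        · subst h; omega
        · exact h₂ w hw) hv
    rw [hval] at this
    exact this.symm
  · simp only [NExpr.cost]
    omega


/-! ### Contributions of one rule to the vector and the matrix -/

namespace State

variable (I : State) (x : ℕ → ℝ≥0∞) (rk : ℕ → ℕ) (c r : ℕ)

/-- The sum of the contributions to the entry `y` of the values by the first `n` assignments. -/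
noncomputable def addVec (n y : ℕ) : ℝ≥0∞ :=
  ∑ i ∈ Finset.range n,
    if I.extKey r (I.asg r i) = y ∧ I.selKey rk c r (I.asg r i) (I.numE r) = 0 then
      I.openVal x rk c r (I.asg r i) (I.numE r) else 0

/-- The sum of the contributions to the entry `y` of the matrix by the first `n` assignments. -/
noncomputable def addMat (n y : ℕ) : ℝ≥0∞ :=
  ∑ i ∈ Finset.range n,
    if cell (I.extKey r (I.asg r i)) (I.selKey rk c r (I.asg r i) (I.numE r)) = y ∧
        I.selKey rk c r (I.asg r i) (I.numE r) ≠ 0 then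
      I.openVal x rk c r (I.asg r i) (I.numE r) else 0

theorem addVec_eq_zero {l t : ℕ} (h : l ≠ I.lhs r) (n : ℕ) :
    I.addVec x rk c r n (cell l t) = 0 := by
  refine Finset.sum_eq_zero fun i _ => if_neg fun h' => h ?_
  exact (cell_inj h'.1).1.symm

end State

/-- Computes the number of assignments of the current rule, and the first assignment. -/
def initProg : Prog :=
  .assign 22 (.lit 1) ;; .forTo 21 (.get 6 (.var 20))
    (.assign 22 (.mul (.var 22) (eDom (.var 21))) ;; .setNat 24 (.var 21) (.lit 0))

theorem wp_init : ∃ K, ∀ I σ : State, I.Inp σ →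
    WP initProg σ (K * (I.numV (σ.nat 20 0) + 1)) (fun τ =>
      τ.nat 22 0 = I.numAsg (σ.nat 20 0) ∧
      ∀ v < I.numV (σ.nat 20 0), τ.nat 24 v = I.asg (σ.nat 20 0) 0 v) := by
  refine ⟨200, fun I σ hI => ?_⟩
  set r := σ.nat 20 0 with hr
  refine ((WP.assign (Q := fun τ => τ.nat 22 0 = 1) (by simp)).seq fun τ hτ h22 =>
    WP.forTo_const (fun v τ => τ.nat 22 0 = ∏ w ∈ Finset.range v, I.dom r w ∧
      ∀ w < v, τ.nat 24 w = 0) (I.numV r) 100 rfl ?_ ?_ ?_).mono ?_ ?_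
  · simp [h22]
  · intro j υ _ hA
    have hA' : Agree initProg σ υ := hτ.seq_left.trans hA.seq_right
    have hi := hI.agree hA' rfl rfl
    simp [hi.nat, hA'.nat 20 rfl, ← hr, State.numV]
  · rintro j υ hj ⟨h₁, h₂⟩ hj' hA
    have hA' : Agree initProg σ υ := hτ.seq_left.trans hA.seq_right
    have hi := hI.agree hA' rfl rfl
    refine (WP.of_loopFree rfl ?_).mono (show Prog.cost _ ≤ 100 by decide) (fun _ _ h => h)
    refine ⟨?_, fun w hw => ?_⟩
    · simp [Prog.run, h₁, hj', eDom, hi.nat, hA'.nat 20 rfl, ← hr, Finset.prod_range_succ,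
        State.dom]
    · simp only [Prog.run, NExpr.eval, State.updateNat_nat]
      simp [hj']
      intro hne
      exact h₂ w (by omega)
  · simp only [NExpr.cost]
    ring_nf
    omega
  · rintro τ _ ⟨⟨h₁, h₂⟩, -⟩
    exact ⟨h₁, fun v hv => by simp [h₂ v hv, State.asg, digit]⟩

/-- Adds the contributions of all assignments of the current rule. -/
def ruleProg : Prog :=
  initProg ;; .forTo 23 (.var 22) (edgesProg ;; outProg ;; nextProg)

/-- The contributions are expressed by the values at the start, although array `2` is updated in
place. This is correct because edges labelled by the left-hand side are required to have the
selected rank, so the entries that change are not read as factors. -/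
theorem wp_rule : ∃ K, ∀ I σ : State, I.Inp σ → I.WellFormed → σ.nat 20 0 < I.numRules →
    σ.KeysOK →
    (∀ e < I.numE (σ.nat 20 0), I.IsNt (I.lab (σ.nat 20 0) e) →
      I.lab (σ.nat 20 0) e = I.lhs (σ.nat 20 0) →
      σ.nat 32 (I.lab (σ.nat 20 0) e) = σ.nat 31 0) →
    WP ruleProg σ (K * (I.size (σ.nat 20 0) + 1) * (I.numAsg (σ.nat 20 0) + 1)) (fun τ =>
      τ.KeysOK ∧ (∃ l, τ.keys = σ.keys ++ l) ∧
      (∀ y, y ∈ τ.keys ↔ y ∈ σ.keys ∨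
        ∃ i < I.numAsg (σ.nat 20 0), y = I.extKey (σ.nat 20 0) (I.asg (σ.nat 20 0) i)) ∧
      (∀ y, τ.val 2 y = σ.val 2 y + I.addVec (σ.val 2) (σ.nat 32) (σ.nat 31 0) (σ.nat 20 0)
        (I.numAsg (σ.nat 20 0)) y) ∧
      (∀ y, τ.val 3 y = σ.val 3 y + I.addMat (σ.val 2) (σ.nat 32) (σ.nat 31 0) (σ.nat 20 0)
        (I.numAsg (σ.nat 20 0)) y)) := by
  obtain ⟨K₁, hK₁⟩ := wp_init
  obtain ⟨K₂, hK₂⟩ := wp_edges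
  obtain ⟨K₃, hK₃⟩ := wp_out
  obtain ⟨K₄, hK₄⟩ := wp_next
  refine ⟨K₁ + K₂ + K₃ + K₄ + 50, fun I σ hI hw hlt hk hs => ?_⟩
  set r := σ.nat 20 0 with hr
  set rk := σ.nat 32 with hrk
  set c := σ.nat 31 0 with hc
  set x := σ.val 2 with hx
  refine ((hK₁ I σ hI).seq fun τ hτ h =>
    WP.forTo_const (fun i τ => τ.KeysOK ∧ (∃ l, τ.keys = σ.keys ++ l) ∧
      (∀ y, y ∈ τ.keys ↔ y ∈ σ.keys ∨ ∃ j < i, y = I.extKey r (I.asg r j)) ∧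
      (∀ y, τ.val 2 y = x y + I.addVec x rk c r i y) ∧
      (∀ y, τ.val 3 y = σ.val 3 y + I.addMat x rk c r i y) ∧
      (i < I.numAsg r → ∀ v < I.numV r, τ.nat 24 v = I.asg r i v)) (I.numAsg r)
      (K₂ * (I.size r + 1) + (K₃ * (I.len (I.lhs r) + 1) + K₄ * (I.numV r + 1)))
      rfl ?_ ?_ ?_).mono ?_ ?_
  · have h33 : (τ.updateNat 23 0 0).nat 33 = σ.nat 33 := by
      rw [State.updateNat_nat_of_ne _ _ _ (by norm_num), hτ.nat 33 rfl]
    have h34 : (τ.updateNat 23 0 0).nat 34 = σ.nat 34 := by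
      rw [State.updateNat_nat_of_ne _ _ _ (by norm_num), hτ.nat 34 rfl]
    have h35 : (τ.updateNat 23 0 0).nat 35 = σ.nat 35 := by
      rw [State.updateNat_nat_of_ne _ _ _ (by norm_num), hτ.nat 35 rfl]
    rw [State.keys_congr h34 h35]
    refine ⟨hk.congr h34 h35 h33, ⟨[], by simp⟩, by simp, ?_, ?_, ?_⟩
    · simp [State.addVec, hx, hτ.val 2 rfl]
    · simp [State.addMat, hτ.val 3 rfl]
    · intro _ v hv
      simp [h.2 v hv, hr]
  · intro j υ _ hA
    simp [hA.nat 22 rfl, h.1, hr]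
  · rintro i υ hi ⟨h₁, ⟨l, h₂⟩, h₃, h₄, h₅, h₆⟩ hi' hA
    have hA' : Agree ruleProg σ υ := hτ.seq_left.trans hA.seq_right
    have hd := h₆ hi
    have e20 : υ.nat 20 0 = r := by rw [hA'.nat 20 rfl]
    refine (WP.seq (hK₂ I υ (hI.agree hA' rfl rfl))
      (T₂ := K₃ * (I.len (I.lhs r) + 1) + K₄ * (I.numV r + 1)) (fun τ₁ a₁ q₁ => ?_)).mono
      (by rw [e20]) (fun _ _ h => h)
    · refine (WP.seq (hK₃ I τ₁ ((hI.agree hA' rfl rfl).agree a₁ rfl rfl)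
        (h₁.congr (a₁.nat 34 rfl) (a₁.nat 35 rfl) (a₁.nat 33 rfl)))
        (T₂ := K₄ * (I.numV r + 1)) (fun τ₂ a₂ q₂ => by
          have e20' : τ₂.nat 20 0 = r := by rw [a₂.nat 20 rfl, a₁.nat 20 rfl, e20]
          have e24 : τ₂.nat 24 = υ.nat 24 := by rw [a₂.nat 24 rfl, a₁.nat 24 rfl]
          refine (hK₄ I τ₂ i (((hI.agree hA' rfl rfl).agree a₁ rfl rfl).agree a₂ rfl rfl)
            (by rwa [e20']) (by rwa [e20', e24])).mono (by rw [e20']) ?_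
          intro τ₃ a₃ q₃
          rw [a₁.nat 20 rfl, e20, a₁.nat 24 rfl, State.extKey_congr hw hlt hd,
            State.keys_congr (a₁.nat 34 rfl) (a₁.nat 35 rfl)] at q₂
          obtain ⟨q₂, ⟨l', q₂'⟩, q₂'', q₅, q₆⟩ := q₂
          rw [e20] at q₁
          rw [q₁.1, q₁.2] at q₅ q₆
          have ho : I.openVal (υ.val 2) (υ.nat 32) (υ.nat 31 0) r (υ.nat 24) (I.numE r) =
              I.openVal x rk c r (I.asg r i) (I.numE r) := by
            rw [hA'.nat 32 rfl, hA'.nat 31 rfl]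
            refine State.openVal_congr hw hlt hd (fun l t hl => ?_) hs
            rw [h₄, State.addVec_eq_zero _ _ _ _ _ hl, add_zero]
          rw [ho, hA'.nat 32 rfl, hA'.nat 31 rfl, State.selKey_congr hw hlt hd le_rfl] at q₅ q₆
          have b34 : (τ₃.updateNat 23 0 (i + 1)).nat 34 = τ₂.nat 34 := by
            rw [State.updateNat_nat_of_ne _ _ _ (by norm_num), a₃.nat 34 rfl]
          have b35 : (τ₃.updateNat 23 0 (i + 1)).nat 35 = τ₂.nat 35 := by
            rw [State.updateNat_nat_of_ne _ _ _ (by norm_num), a₃.nat 35 rfl]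
          have b33 : (τ₃.updateNat 23 0 (i + 1)).nat 33 = τ₂.nat 33 := by
            rw [State.updateNat_nat_of_ne _ _ _ (by norm_num), a₃.nat 33 rfl]
          rw [State.keys_congr b34 b35]
          refine ⟨q₂.congr b34 b35 b33, ⟨l ++ l', by rw [q₂', h₂, List.append_assoc]⟩,
            fun y => ?_, fun y => ?_, fun y => ?_, fun hi1 v hv => ?_⟩
          · rw [q₂'', h₃]
            constructor
            · rintro ((h | ⟨j, hj, h⟩) | h)
              exacts [.inl h, .inr ⟨j, by omega, h⟩, .inr ⟨i, by omega, h⟩]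
            · rintro (h | ⟨j, hj, h⟩)
              · exact .inl (.inl h)
              · rcases Nat.lt_succ_iff_lt_or_eq.1 hj with hj | rfl
                exacts [.inl (.inr ⟨j, hj, h⟩), .inr h]
          · rw [State.updateNat_val, a₃.val 2 rfl, q₅, a₁.val 2 rfl, h₄, State.addVec,
              State.addVec, Finset.sum_range_succ, add_assoc]
          · rw [State.updateNat_val, a₃.val 3 rfl, q₆, a₁.val 3 rfl, h₅, State.addMat,
              State.addMat, Finset.sum_range_succ, add_assoc]
          · rw [e20'] at q₃
            rw [State.updateNat_nat_of_ne _ _ _ (by norm_num)]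
            exact q₃ hi1 v hv)).mono (by rw [a₁.nat 20 rfl, e20]) (fun _ _ h => h)
  · have h₁ : I.numV r ≤ I.size r := by unfold State.size; omega
    have h₂ : I.len (I.lhs r) ≤ I.size r := by unfold State.size; omega
    simp only [NExpr.cost]
    calc _ ≤ K₁ * (I.size r + 1) * (I.numAsg r + 1) + (K₂ * (I.size r + 1) + (K₃ * (I.size r + 1) +
          K₄ * (I.size r + 1)) + 22 * (I.size r + 1)) * (I.numAsg r + 1) := by
          refine add_le_add ((Nat.mul_le_mul_left _ (Nat.succ_le_succ h₁)).trans
            (Nat.le_mul_of_pos_right _ (by omega))) (Nat.mul_le_mul_right _ ?_)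
          have := Nat.mul_le_mul_left K₃ (Nat.succ_le_succ h₂)
          have := Nat.mul_le_mul_left K₄ (Nat.succ_le_succ h₁)
          simp only [Nat.succ_eq_add_one] at *
          omega
      _ ≤ _ := by ring_nf; omega
  · rintro τ _ ⟨⟨h₁, h₂, h₃, h₄, h₅, -⟩, -⟩
    exact ⟨h₁, h₂, h₃, h₄, h₅⟩


/-! ### Propagation

Arrays of natural numbers: `40`, `41` number and list of the occurrences of a label, `42` number of
nonterminal edges of a rule, `43` how many of them have a label that did not fire, `44` number of
rules still to be seen before a label fires, `45`, `46`, `47` queue of rules, its head and its tail,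
`48` position in a list of occurrences, `49` rule, `50` label. -/

namespace State

/-- The rules in which a label occurs, with multiplicities. -/
def occs (σ : State) (l : ℕ) : List ℕ :=
  (List.range (σ.nat 40 l)).map (fun i => σ.nat 41 (cell l i))

/-- The queue. -/
def queue (σ : State) : List ℕ := (List.range (σ.nat 47 0)).map (σ.nat 45)

variable (I : State)

open scoped Classical in
/-- How often the label `l` occurs as a nonterminal among the first `n` edges of a rule. -/
noncomputable def mult (l r n : ℕ) : ℕ :=
  ((Finset.range n).filter fun e => I.IsNt (I.lab r e) ∧ I.lab r e = l).card

open scoped Classical in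
/-- The number of nonterminal edges with a label outside of `A` among the first `n` edges. -/
noncomputable def numOpen (A : Set ℕ) (r n : ℕ) : ℕ :=
  ((Finset.range n).filter fun e => I.IsNt (I.lab r e) ∧ I.lab r e ∉ A).card

/-- The labels that have fired when the rules in `L` have been seen, if `p l ≥ 1` rules with
left-hand side `l` are needed. -/
def fired (p : ℕ → ℕ) (L : List ℕ) : Set ℕ :=
  {l | 1 ≤ p l ∧ p l ≤ (L.map I.lhs).count l}

/-- The nonterminals in a rule fire before the rule. -/
inductive Sound (p : ℕ → ℕ) : List ℕ → Prop
  | nil : Sound p []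
  | snoc {q : List ℕ} {r : ℕ} : Sound p q →
      (∀ e < I.numE r, I.IsNt (I.lab r e) → I.lab r e ∈ I.fired p q) → Sound p (q ++ [r])

/-- The lists of occurrences are correct. -/
structure OccsOK (σ : State) : Prop where
  count : ∀ l r, (σ.occs l).count r = if r < I.numRules then I.mult l r (I.numE r) else 0
  base : ∀ r < I.numRules, σ.nat 42 r = I.numOpen ∅ r (I.numE r)

variable {I}

theorem fired_mono {p : ℕ → ℕ} {L L' : List ℕ} (h : L.Sublist L') :
    I.fired p L ⊆ I.fired p L' := fun _ hl => ⟨hl.1, hl.2.trans ((h.map _).count_le _)⟩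

theorem numOpen_eq_zero {A : Set ℕ} {r n : ℕ} :
    I.numOpen A r n = 0 ↔ ∀ e < n, I.IsNt (I.lab r e) → I.lab r e ∈ A := by
  simp [numOpen, Finset.card_eq_zero, Finset.filter_eq_empty_iff]

/-- When `l` fires, the counter of a rule has to drop by the multiplicity of `l` in it. The additive
form avoids truncated subtraction. -/
theorem numOpen_insert {A : Set ℕ} {l r n : ℕ} (hl : l ∉ A) :
    I.numOpen (insert l A) r n + I.mult l r n = I.numOpen A r n := by
  classical
  unfold numOpen mult
  rw [← Finset.card_union_of_disjoint]
  · congr 1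
    ext e
    simp only [Finset.mem_union, Finset.mem_filter, Set.mem_insert_iff]
    constructor
    · rintro (⟨h, h', h''⟩ | ⟨h, h', h''⟩)
      · exact ⟨h, h', fun h => h'' (.inr h)⟩
      · exact ⟨h, h', h'' ▸ hl⟩
    · rintro ⟨h, h', h''⟩
      by_cases e : I.lab r e = l
      · exact .inr ⟨h, h', e⟩
      · exact .inl ⟨h, h', by simp [e, h'']⟩
  · rw [Finset.disjoint_left]
    intro e
    simp only [Finset.mem_filter, Set.mem_insert_iff]
    tauto

end State

/-- Collects the occurrences of nonterminals. -/
def buildProg : Prog :=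
  .forTo 20 (.get 0 (.lit 0)) (.forTo 25 (.get 7 (.var 20))
    (.cond (.eq (.get 4 eLab) (.lit 0)) .skip
      (.setNat 41 (.cell eLab (.get 40 eLab)) (.var 20) ;;
        .setNat 40 eLab (.add (.get 40 eLab) (.lit 1)) ;;
        .setNat 42 (.var 20) (.add (.get 42 (.var 20)) (.lit 1)))))

/-- The order within a list of occurrences is irrelevant, so only multiplicities are specified. That
they vanish outside the rules guarantees later that every entry of a list is the number of a rule.
-/
theorem wp_build : ∃ K, ∀ I σ : State, I.Inp σ → (∀ l, σ.nat 40 l = 0) → (∀ r, σ.nat 42 r = 0) →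
    WP buildProg σ (K * (I.numRules + ∑ r ∈ Finset.range I.numRules, I.numE r + 1)) I.OccsOK := by
  refine ⟨600, fun I σ hI h40 h42 => ?_⟩
  refine (WP.forTo (fun n τ => (∀ l r, (τ.occs l).count r =
      if r < n then I.mult l r (I.numE r) else 0) ∧
      (∀ r, τ.nat 42 r = if r < n then I.numOpen ∅ r (I.numE r) else 0)) I.numRules
      (fun r => 350 * (I.numE r + 1)) rfl ?_ ?_ ?_).mono ?_ ?_
  · refine ⟨fun l r => ?_, fun r => ?_⟩
    · simp [State.occs, h40]
    · simp [h42]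
  · intro j τ _ hA
    have hi := hI.agree hA rfl rfl
    simp [hi.nat, State.numRules]
  · rintro n τ hn ⟨h₁, h₂⟩ hτ hA
    have hi := hI.agree hA rfl rfl
    refine (WP.forTo_const (fun m υ => (∀ l r, (υ.occs l).count r =
      if r < n then I.mult l r (I.numE r) else if r = n then I.mult l r m else 0) ∧
      (∀ r, υ.nat 42 r = if r < n then I.numOpen ∅ r (I.numE r) else
        if r = n then I.numOpen ∅ r m else 0)) (I.numE n) 300 rfl ?_ ?_ ?_).mono ?_ ?_
    · refine ⟨fun l r => ?_, fun r => ?_⟩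
      · have := h₁ l r
        simp only [State.occs, State.updateNat_nat, Nat.reduceEqDiff, false_and, if_false] at this ⊢
        rw [this]
        simp [State.mult]
      · simp [h₂, State.numOpen]
    · intro m υ _ hA'
      have hi' := hi.agree hA' rfl rfl
      simp [hi'.nat, hA'.nat 20 rfl, hτ, State.numE]
    · rintro m υ hm ⟨h₃, h₄⟩ hυ hA'
      have hi' := hi.agree hA' rfl rfl
      have h20 : υ.nat 20 0 = n := by rw [hA'.nat 20 rfl, hτ]
      refine (WP.of_loopFree rfl ?_).mono (show Prog.cost _ ≤ 300 by decide) (fun _ _ h => h)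
      have e4 := hi'.nat 4 (by norm_num)
      have e9 := hi'.nat 9 (by norm_num)
      by_cases hT : I.nat 4 (I.nat 9 (cell n m)) = 0
      · have e : (Prog.run (.cond (.eq (.get 4 eLab) (.lit 0)) .skip
            (.setNat 41 (.cell eLab (.get 40 eLab)) (.var 20) ;;
            .setNat 40 eLab (.add (.get 40 eLab) (.lit 1)) ;;
            .setNat 42 (.var 20) (.add (.get 42 (.var 20)) (.lit 1)))) υ) = υ := by
          simp [Prog.run, eLab, h20, hυ, e4, e9, hT]
        have hT' : ¬ I.IsNt (I.lab n m) := by simpa [State.IsNt, State.lab] using hT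
        rw [e]
        refine ⟨fun l r => ?_, fun r => ?_⟩
        · have := h₃ l r
          simp only [State.occs, State.updateNat_nat, Nat.reduceEqDiff, false_and, if_false] at this ⊢
          rw [this]
          by_cases hr : r = n
          · subst hr
            simp [State.mult, Finset.range_add_one, Finset.filter_insert, hT']
          · simp [hr]
        · simp only [State.updateNat_nat, Nat.reduceEqDiff, false_and, if_false, h₄]
          by_cases hr : r = n
          · subst hr
            simp [State.numOpen, Finset.range_add_one, Finset.filter_insert, hT']
          · simp [hr]
      · have hT' : I.IsNt (I.lab n m) := by simpa [State.IsNt, State.lab] using hT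
        set υ' := (Prog.run (.cond (.eq (.get 4 eLab) (.lit 0)) .skip
            (.setNat 41 (.cell eLab (.get 40 eLab)) (.var 20) ;;
            .setNat 40 eLab (.add (.get 40 eLab) (.lit 1)) ;;
            .setNat 42 (.var 20) (.add (.get 42 (.var 20)) (.lit 1)))) υ) with hυ'
        have e40 : ∀ l, υ'.nat 40 l = if l = I.lab n m then υ.nat 40 l + 1 else υ.nat 40 l := by
          intro l
          by_cases hl : l = I.nat 9 (cell n m) <;>
          simp [hυ', Prog.run, eLab, h20, hυ, e4, e9, hT, State.lab, hl]
        have e41 : ∀ l i, υ'.nat 41 (cell l i) = if l = I.lab n m ∧ i = υ.nat 40 l then n else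
            υ.nat 41 (cell l i) := by
          intro l i
          have : (cell l i = cell (I.nat 9 (cell n m)) (υ.nat 40 (I.nat 9 (cell n m)))) ↔
              l = I.lab n m ∧ i = υ.nat 40 l := by
            constructor
            · intro h
              obtain ⟨rfl, rfl⟩ := cell_inj h
              exact ⟨rfl, rfl⟩
            · rintro ⟨rfl, rfl⟩; rfl
          simp [hυ', Prog.run, eLab, h20, hυ, e4, e9, hT, ← this]
        have e42 : ∀ r, υ'.nat 42 r = if r = n then υ.nat 42 r + 1 else υ.nat 42 r := by
          intro r
          by_cases hl : r = n <;>
          simp [hυ', Prog.run, eLab, h20, hυ, e4, e9, hT, hl]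
        refine ⟨fun l r => ?_, fun r => ?_⟩
        · have hocc : υ'.occs l = υ.occs l ++ if l = I.lab n m then [n] else [] := by
            simp only [State.occs, e40, e41]
            by_cases hl : l = I.lab n m
            · rw [if_pos hl, if_pos hl, List.range_succ, List.map_append]
              congr 1
              · refine List.map_congr_left fun i hi => ?_
                rw [List.mem_range] at hi
                rw [if_neg (by omega)]
              · simp [hl]
            · simp [hl]
          have hocc' : (υ'.updateNat 25 0 (m + 1)).occs l = υ'.occs l := by
            simp [State.occs]
          rw [hocc', hocc, List.count_append, h₃]
          by_cases hr : r = n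
          · subst hr
            by_cases hl : l = I.lab r m
            · simp [State.mult, Finset.range_add_one, Finset.filter_insert, hT', hl]
            · simp [State.mult, Finset.range_add_one, Finset.filter_insert, hl, Ne.symm hl]
          · by_cases hl : l = I.lab n m <;> simp [hr, hl, Ne.symm hr]
        · rw [State.updateNat_nat_of_ne _ _ _ (by norm_num), e42, h₄]
          by_cases hr : r = n
          · subst hr
            simp [State.numOpen, Finset.range_add_one, Finset.filter_insert, hT']
          · simp [hr]
    · simp only [NExpr.cost]
      ring_nf
      omega
    · rintro υ _ ⟨⟨h₃, h₄⟩, -⟩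
      refine ⟨fun l r => ?_, fun r => ?_⟩
      · have h := h₃ l r
        simp only [State.occs, State.updateNat_nat, Nat.reduceEqDiff, false_and, if_false] at h ⊢
        rw [h]
        by_cases hr : r = n
        · subst hr; simp
        · have : r < n + 1 ↔ r < n := by omega
          simp [hr, this]
      · rw [State.updateNat_nat_of_ne _ _ _ (by norm_num), h₄]
        by_cases hr : r = n
        · subst hr; simp
        · have : r < n + 1 ↔ r < n := by omega
          simp [hr, this]
  · rw [← Finset.mul_sum, Finset.sum_add_distrib]
    simp [NExpr.cost]
    ring_nf
    omega
  · rintro τ _ ⟨⟨h₁, h₂⟩, -⟩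
    exact ⟨h₁, fun r hr => by rw [h₂, if_pos hr]⟩


/-- Appends the rule `r` to the queue. -/
def pushProg (r : NExpr) : Prog := .setNat 45 (.var 47) r ;; .assign 47 (.add (.var 47) (.lit 1))

/-- The queue of the rules without nonterminals. -/
def initQueueProg : Prog :=
  .assign 47 (.lit 0) ;; .forTo 20 (.get 0 (.lit 0)) (.setNat 43 (.var 20) (.get 42 (.var 20)) ;;
    .cond (.eq (.get 42 (.var 20)) (.lit 0)) (pushProg (.var 20)) .skip)

/-- Counts an occurrence of a label that fires. -/
def occProg : Prog :=
  .assign 49 (.get 41 (.cell (.var 50) (.var 48))) ;;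
  .setNat 43 (.var 49) (.sub (.get 43 (.var 49)) (.lit 1)) ;;
  .cond (.eq (.get 43 (.var 49)) (.lit 0)) (pushProg (.var 49)) .skip

/-- Takes a rule from the queue. -/
def popProg : Prog :=
  (.assign 50 (.get 5 (.get 45 (.var 46))) ;; .assign 46 (.add (.var 46) (.lit 1))) ;;
  .cond (.eq (.get 44 (.var 50)) (.lit 1)) (.forTo 48 (.get 40 (.var 50)) occProg) .skip ;;
  .setNat 44 (.var 50) (.sub (.get 44 (.var 50)) (.lit 1))

/-- Puts rules into an order in which the nonterminals in a rule fire before the rule. -/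
def propProg : Prog :=
  initQueueProg ;; .assign 46 (.lit 0) ;; .loop (.lt (.var 46) (.var 47)) popProg

namespace State

/-- The invariant of the queue when the labels in `A` have fired. -/
structure QueueOK (I : State) (p : ℕ → ℕ) (c : ℕ → ℕ) (q : List ℕ) : Prop where
  nodup : q.Nodup
  mem : ∀ r, r ∈ q ↔ r < I.numRules ∧ c r = 0
  sound : I.Sound p q

theorem run_pushProg (σ : State) (r : NExpr) :
    ((pushProg r).run σ).queue = σ.queue ++ [r.eval σ] := by
  simp only [pushProg, Prog.run, NExpr.eval, queue, State.updateNat_nat, and_self, if_true,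
    Nat.reduceEqDiff, false_and, if_false, List.range_succ, List.map_append, List.map_cons,
    List.map_nil]
  congr 1
  · refine List.map_congr_left fun i hi => ?_
    rw [List.mem_range] at hi
    simp [hi.ne]

theorem QueueOK.length_le {I : State} {p c : ℕ → ℕ} {q : List ℕ} (h : I.QueueOK p c q) :
    q.length ≤ I.numRules := by
  rw [← List.toFinset_card_of_nodup h.nodup, ← Finset.card_range I.numRules]
  refine Finset.card_le_card fun r hr => ?_
  rw [List.mem_toFinset, h.mem] at hr
  exact Finset.mem_range.2 hr.1

end State

theorem wp_initQueue : ∃ K, ∀ (I σ : State) (p : ℕ → ℕ), I.Inp σ → I.OccsOK σ →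
    WP initQueueProg σ (K * (I.numRules + 1)) (fun τ =>
      (∀ r < I.numRules, τ.nat 43 r = I.numOpen ∅ r (I.numE r)) ∧
      I.QueueOK p (τ.nat 43) τ.queue) := by
  refine ⟨300, fun I σ p hI ho => ?_⟩
  refine ((WP.assign (Q := fun τ => τ.nat 47 0 = 0) (by simp)).seq fun τ hτ h47 =>
    WP.forTo_const (fun n τ => (∀ r < n, τ.nat 43 r = I.numOpen ∅ r (I.numE r)) ∧
      τ.queue.Nodup ∧ (∀ r, r ∈ τ.queue ↔ r < n ∧ τ.nat 43 r = 0) ∧ I.Sound p τ.queue)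
      I.numRules 100 rfl ?_ ?_ ?_).mono ?_ ?_
  · have : (τ.updateNat 20 0 0).queue = [] := by simp [State.queue, h47]
    rw [this]
    exact ⟨by simp, by simp, by simp, .nil⟩
  · intro j υ _ hA
    have hi := hI.agree (hτ.seq_left.trans hA.seq_right : Agree initQueueProg σ υ) rfl rfl
    simp [hi.nat, State.numRules]
  · rintro n υ hn ⟨h₁, h₂, h₃, h₄⟩ hυ hA
    have hA' : Agree initQueueProg σ υ := hτ.seq_left.trans hA.seq_right
    refine (WP.of_loopFree rfl ?_).mono (show Prog.cost _ ≤ 100 by decide) (fun _ _ h => h)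
    have e42 : υ.nat 42 n = I.numOpen ∅ n (I.numE n) := by rw [hA'.nat 42 rfl, ho.base n hn]
    have hnq : n ∉ υ.queue := fun h => by simpa using ((h₃ n).1 h).1
    by_cases h0 : I.numOpen ∅ n (I.numE n) = 0
    · set υ' := υ.updateNat 43 n 0
      have e : Prog.run (.setNat 43 (.var 20) (.get 42 (.var 20)) ;;
          .cond (.eq (.get 42 (.var 20)) (.lit 0)) (pushProg (.var 20)) .skip) υ =
          (pushProg (.var 20)).run υ' := by
        simp [Prog.run, hυ, e42, h0, υ']
      have e20 : NExpr.eval υ' (.var 20) = n := by simp [υ', hυ]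
      have eq := State.run_pushProg υ' (.var 20)
      have eq' : ((((pushProg (.var 20)).run υ')).updateNat 20 0 (n + 1)).queue =
          υ.queue ++ [n] := by
        rw [e20] at eq
        have : υ'.queue = υ.queue := by simp [State.queue, υ']
        rw [← this, ← eq]
        simp [State.queue]
      have e43 : ∀ r, ((((pushProg (.var 20)).run υ')).updateNat 20 0 (n + 1)).nat 43 r =
          if r = n then 0 else υ.nat 43 r := by
        intro r
        simp [pushProg, Prog.run, υ']
      rw [e, eq']
      refine ⟨fun r hr => ?_, ?_, fun r => ?_, .snoc h₄ ?_⟩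
      · rw [e43]
        split_ifs with h
        · rw [h, h0]
        · exact h₁ r (by omega)
      · rw [List.nodup_append]
        refine ⟨h₂, by simp, ?_⟩
        rintro a ha b hb rfl
        simp at hb
        exact hnq (hb ▸ ha)
      · rw [e43, List.mem_append, h₃]
        by_cases hr : r = n
        · simp [hr]
        · have : r < n + 1 ↔ r < n := by omega
          simp [hr, this]
      · rw [State.numOpen_eq_zero] at h0
        exact fun e he ht => (h0 e he ht).elim
    · have e : Prog.run (.setNat 43 (.var 20) (.get 42 (.var 20)) ;;
          .cond (.eq (.get 42 (.var 20)) (.lit 0)) (pushProg (.var 20)) .skip) υ =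
          υ.updateNat 43 n (I.numOpen ∅ n (I.numE n)) := by
        simp [Prog.run, hυ, e42, h0]
      have eq' : (((υ.updateNat 43 n (I.numOpen ∅ n (I.numE n)))).updateNat 20 0 (n + 1)).queue =
          υ.queue := by simp [State.queue]
      rw [e, eq']
      refine ⟨fun r hr => ?_, h₂, fun r => ?_, h₄⟩
      · by_cases h : r = n
        · simp [h]
        · simpa [h] using h₁ r (by omega)
      · rw [h₃]
        by_cases hr : r = n
        · simp [hr, h0]
        · have : r < n + 1 ↔ r < n := by omega
          simp [hr, this]
  · simp only [NExpr.cost]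
    ring_nf
    omega
  · rintro τ _ ⟨⟨h₁, h₂, h₃, h₄⟩, -⟩
    exact ⟨h₁, h₂, h₃, h₄⟩

/-- The effect of the occurrences of a label that fires. -/
theorem wp_occs (I σ : State) (p : ℕ → ℕ) (L : List ℕ) (l : ℕ) (hl : l ∉ I.fired p L)
    (ho : I.OccsOK σ) (h50 : σ.nat 50 0 = l)
    (hc : ∀ r < I.numRules, σ.nat 43 r = I.numOpen (I.fired p L) r (I.numE r))
    (hq : I.QueueOK p (σ.nat 43) σ.queue) {s : ℕ}
    (hf : insert l (I.fired p L) ⊆ I.fired p (σ.queue.take s)) :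
    WP (.forTo 48 (.get 40 (.var 50)) occProg) σ (130 * (σ.nat 40 l + 1)) (fun τ =>
      (∀ r < I.numRules, τ.nat 43 r = I.numOpen (insert l (I.fired p L)) r (I.numE r)) ∧
      I.QueueOK p (τ.nat 43) τ.queue ∧ (∃ q, τ.queue = σ.queue ++ q) ∧
      ∑ r ∈ Finset.range I.numRules, τ.nat 43 r + σ.nat 40 l =
        ∑ r ∈ Finset.range I.numRules, σ.nat 43 r) := by
  refine (WP.forTo_const (fun n τ => (∀ r < I.numRules, τ.nat 43 r + ((σ.occs l).take n).count r =
      I.numOpen (I.fired p L) r (I.numE r)) ∧ I.QueueOK p (τ.nat 43) τ.queue ∧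
      (∃ q, τ.queue = σ.queue ++ q) ∧
      ∑ r ∈ Finset.range I.numRules, τ.nat 43 r + n = ∑ r ∈ Finset.range I.numRules, σ.nat 43 r)
    (σ.nat 40 l) 100 rfl ?_ ?_ ?_).mono ?_ ?_
  · have : (σ.updateNat 48 0 0).queue = σ.queue := by simp [State.queue]
    rw [this]
    refine ⟨fun r hr => ?_, ?_, ⟨[], by simp⟩, by simp⟩
    · simp [hc r hr]
    · rw [State.updateNat_nat_of_ne _ _ _ (by norm_num)]; exact hq
  · intro j τ _ hA
    simp [hA.nat 40 rfl, hA.nat 50 rfl, h50]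
  · rintro n τ hn ⟨h₁, h₂, ⟨q, h₃⟩, h₄⟩ hτ hA
    refine (WP.of_loopFree rfl ?_).mono (show Prog.cost _ ≤ 100 by decide) (fun _ _ h => h)
    have hlen : (σ.occs l).length = σ.nat 40 l := by simp [State.occs]
    set x := σ.nat 41 (cell l n) with hx
    have htake : (σ.occs l).take (n + 1) = (σ.occs l).take n ++ [x] := by
      rw [List.take_add_one, List.getElem?_eq_getElem (by omega)]
      simp [State.occs, hx]
    have hle : ∀ r, ((σ.occs l).take (n + 1)).count r ≤
        if r < I.numRules then I.mult l r (I.numE r) else 0 := fun r => by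
      rw [← ho.count]; exact (List.take_sublist _ _).count_le _
    have hxr : x < I.numRules := by
      by_contra h
      have := hle x
      rw [if_neg h, htake] at this
      simp at this
    -- At least one occurrence of `l` in `x` has not been counted yet, so subtracting 1 does not
    -- truncate.
    have hpos : τ.nat 43 x ≠ 0 := by
      have h := h₁ x hxr
      have h' := hle x
      rw [htake, if_pos hxr] at h'
      simp at h'
      have := State.numOpen_insert (I := I) (r := x) (n := I.numE x) hl
      omega
    have hxq : x ∉ τ.queue := fun h => hpos ((h₂.mem x).1 h).2
    have e49 : (Prog.run (.assign 49 (.get 41 (.cell (.var 50) (.var 48)))) τ) =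
        τ.updateNat 49 0 x := by
      simp [Prog.run, hA.nat 41 rfl, hA.nat 50 rfl, h50, hτ, hx]
    set υ := (τ.updateNat 49 0 x).updateNat 43 x (τ.nat 43 x - 1) with hυ
    have e : occProg.run τ = (Prog.cond (.eq (.get 43 (.var 49)) (.lit 0)) (pushProg (.var 49))
        .skip).run υ := by
      rw [occProg, Prog.run, e49, Prog.run]
      simp [Prog.run, hυ]
    have hυ43 : ∀ r, υ.nat 43 r = if r = x then τ.nat 43 x - 1 else τ.nat 43 r := by
      intro r; simp [hυ]
    have hsum : ∑ r ∈ Finset.range I.numRules, υ.nat 43 r + (n + 1) =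
        ∑ r ∈ Finset.range I.numRules, σ.nat 43 r := by
      rw [← h₄]
      have e₁ : ∑ r ∈ (Finset.range I.numRules).erase x, υ.nat 43 r + υ.nat 43 x =
        ∑ r ∈ Finset.range I.numRules, υ.nat 43 r :=
          Finset.sum_erase_add _ _ (Finset.mem_range.2 hxr)
      have e₂ : ∑ r ∈ (Finset.range I.numRules).erase x, τ.nat 43 r + τ.nat 43 x =
        ∑ r ∈ Finset.range I.numRules, τ.nat 43 r :=
          Finset.sum_erase_add _ _ (Finset.mem_range.2 hxr)
      have e₃ : ∑ r ∈ (Finset.range I.numRules).erase x, υ.nat 43 r =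
          ∑ r ∈ (Finset.range I.numRules).erase x, τ.nat 43 r :=
        Finset.sum_congr rfl fun r hr => by rw [hυ43, if_neg (Finset.ne_of_mem_erase hr)]
      have e₄ : υ.nat 43 x = τ.nat 43 x - 1 := by rw [hυ43, if_pos rfl]
      omega
    have hcnt : ∀ r < I.numRules, υ.nat 43 r + ((σ.occs l).take (n + 1)).count r =
        I.numOpen (I.fired p L) r (I.numE r) := by
      intro r hr
      rw [← h₁ r hr, hυ43, htake, List.count_append]
      by_cases h : r = x
      · rw [h, if_pos rfl]
        simp
        omega
      · simp [h, Ne.symm h]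
    have hυq : υ.queue = τ.queue := by simp [State.queue, hυ]
    have hυ49 : NExpr.eval υ (.var 49) = x := by simp [hυ]
    rw [e]
    by_cases h0 : τ.nat 43 x = 1
    · have e' : (Prog.cond (.eq (.get 43 (.var 49)) (.lit 0)) (pushProg (.var 49)) .skip).run υ =
          (pushProg (.var 49)).run υ := by
        have : υ.nat 43 (υ.nat 49 0) = 0 := by
          rw [show υ.nat 49 0 = x from hυ49, hυ43, if_pos rfl, h0]
        rw [Prog.run, if_pos (by simpa using this)]
      have eq := State.run_pushProg υ (.var 49)
      rw [hυ49, hυq] at eq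
      have eq' : (((pushProg (.var 49)).run υ).updateNat 48 0 (n + 1)).queue = τ.queue ++ [x] := by
        rw [← eq]; simp [State.queue]
      have e43 : (((pushProg (.var 49)).run υ).updateNat 48 0 (n + 1)).nat 43 = υ.nat 43 := by
        funext r
        simp [pushProg, Prog.run]
      rw [e', eq', e43]
      refine ⟨hcnt, ⟨?_, fun r => ?_, .snoc h₂.sound fun e he ht => ?_⟩, ⟨q ++ [x], by simp [h₃]⟩,
        hsum⟩
      · rw [List.nodup_append]
        refine ⟨h₂.nodup, by simp, ?_⟩
        rintro a ha b hb rfl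
        simp at hb
        exact hxq (hb ▸ ha)
      · rw [List.mem_append, h₂.mem, hυ43]
        by_cases hr : r = x
        · simp [hr, hxr, h0]
        · simp [hr]
      · have h := hcnt x hxr
        have h' := hle x
        rw [hυ43, if_pos rfl, h0] at h
        rw [if_pos hxr] at h'
        have h'' := State.numOpen_insert (I := I) (r := x) (n := I.numE x) hl
        -- The counter is 0 and at most all occurrences of `l` in `x` have been subtracted, so
        -- nothing is left open once `l` is counted as fired. The firing is witnessed by a prefix of
        -- the queue, hence by the present queue.
        have h0 : I.numOpen (insert l (I.fired p L)) x (I.numE x) = 0 := by omega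
        have hm := hf (State.numOpen_eq_zero.1 h0 e he ht)
        refine State.fired_mono ?_ hm
        rw [h₃]
        exact (List.take_sublist _ _).trans (List.sublist_append_left _ _)
    · have e' : (Prog.cond (.eq (.get 43 (.var 49)) (.lit 0)) (pushProg (.var 49)) .skip).run υ =
          υ := by
        have : υ.nat 43 (υ.nat 49 0) ≠ 0 := by
          rw [show υ.nat 49 0 = x from hυ49, hυ43, if_pos rfl]; omega
        rw [Prog.run, if_neg (by simpa using this)]
        rfl
      have eq' : (υ.updateNat 48 0 (n + 1)).queue = τ.queue := by
        rw [← hυq]; simp [State.queue]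
      rw [e', eq', State.updateNat_nat_of_ne _ _ _ (by norm_num)]
      refine ⟨hcnt, ⟨h₂.nodup, fun r => ?_, h₂.sound⟩, ⟨q, h₃⟩, hsum⟩
      rw [h₂.mem, hυ43]
      by_cases hr : r = x
      · rw [hr, if_pos rfl]
        omega
      · simp [hr]
  · simp only [NExpr.cost]
    ring_nf
    omega
  · rintro τ _ ⟨⟨h₁, h₂, h₃, h₄⟩, -⟩
    refine ⟨fun r hr => ?_, h₂, h₃, h₄⟩
    have h := h₁ r hr
    rw [List.take_of_length_le (by simp [State.occs]), ho.count, if_pos hr] at h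
    have := State.numOpen_insert (I := I) (r := r) (n := I.numE r) hl
    omega


/-! ### The main loop of the propagation -/

namespace State

/-- The count grows by at most one per rule, so a label fires exactly when its threshold is reached.
The program sees this as a pending number equal to 1 before the decrement. -/
theorem fired_snoc_of_eq {I : State} {p : ℕ → ℕ} {L : List ℕ} {r : ℕ}
    (h : p (I.lhs r) = (L.map I.lhs).count (I.lhs r) + 1) :
    I.lhs r ∉ I.fired p L ∧ I.fired p (L ++ [r]) = insert (I.lhs r) (I.fired p L) := by
  refine ⟨fun h' => by have := h'.2; omega, Set.ext fun l => ?_⟩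
  by_cases hl : l = I.lhs r
  · subst hl
    simp [fired, h]
  · simp [fired, hl, Ne.symm hl, List.count_cons]

theorem fired_snoc_of_ne {I : State} {p : ℕ → ℕ} {L : List ℕ} {r : ℕ}
    (h : p (I.lhs r) ≠ (L.map I.lhs).count (I.lhs r) + 1) :
    I.fired p (L ++ [r]) = I.fired p L := by
  refine Set.ext fun l => ?_
  by_cases hl : l = I.lhs r
  · subst hl
    simp [fired]
    omega
  · simp [fired, Ne.symm hl, List.count_cons]

/-- The invariant of the main loop of the propagation. -/
structure PropInv (I : State) (p : ℕ → ℕ) (τ : State) : Prop where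
  cnt : ∀ r < I.numRules,
    τ.nat 43 r = I.numOpen (I.fired p (τ.queue.take (τ.nat 46 0))) r (I.numE r)
  queue : I.QueueOK p (τ.nat 43) τ.queue
  pend : ∀ l, τ.nat 44 l = p l - ((τ.queue.take (τ.nat 46 0)).map I.lhs).count l

theorem numOpen_le {I : State} {A : Set ℕ} {r n : ℕ} : I.numOpen A r n ≤ n := by
  classical
  unfold numOpen
  exact (Finset.card_filter_le _ _).trans (by simp)

theorem length_queue (τ : State) : τ.queue.length = τ.nat 47 0 := by simp [State.queue]

end State

/-- The potential gives 250 to each rule that has not been popped and 130 to each unit of the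
counters. The occurrences of a firing label are paid for by the counters, whose sum drops by exactly
their number. The summand `30 + 1` is left over for the loop test. -/
theorem wp_pop (I σ : State) (p : ℕ → ℕ) (hI : I.Inp σ) (ho : I.OccsOK σ)
    (h : I.PropInv p σ) (hlt : σ.nat 46 0 < σ.nat 47 0) :
    ∃ T, WP popProg σ T (fun τ => I.PropInv p τ ∧
      T + (250 * (I.numRules - τ.nat 46 0) + 130 * ∑ r ∈ Finset.range I.numRules, τ.nat 43 r) +
        30 + 1 ≤
      250 * (I.numRules - σ.nat 46 0) + 130 * ∑ r ∈ Finset.range I.numRules, σ.nat 43 r) := by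
  set n := σ.nat 46 0 with hn
  set r := σ.nat 45 n with hr
  set l := I.lhs r with hl
  set L := σ.queue.take n with hL
  have hnR : n < I.numRules := hlt.trans_le (by rw [← State.length_queue]; exact h.queue.length_le)
  have htake : σ.queue.take (n + 1) = L ++ [r] := by
    rw [List.take_add_one, List.getElem?_eq_getElem (by rwa [State.length_queue])]
    simp [State.queue, hr, hL]
  have hpend : ∀ y, σ.nat 44 y = p y - (L.map I.lhs).count y := h.pend
  set σ₁ := (σ.updateNat 50 0 l).updateNat 46 0 (n + 1) with hσ₁
  have hA₁ : Agree (.assign 50 (.get 5 (.get 45 (.var 46))) ;;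
      .assign 46 (.add (.var 46) (.lit 1))) σ σ₁ :=
    ((Agree.refl _ _).updateNat rfl).updateNat rfl
  have e₁ : (Prog.assign 50 (.get 5 (.get 45 (.var 46))) ;;
      .assign 46 (.add (.var 46) (.lit 1))).run σ = σ₁ := by
    simp [Prog.run, hσ₁, hI.nat, ← hn, ← hr, hl, State.lhs]
  have hq₁ : σ₁.queue = σ.queue := by simp [State.queue, hσ₁]
  have h43₁ : σ₁.nat 43 = σ.nat 43 := hA₁.nat 43 rfl
  have h44₁ : σ₁.nat 44 = σ.nat 44 := hA₁.nat 44 rfl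
  have h46₁ : σ₁.nat 46 0 = n + 1 := by simp [hσ₁]
  have h50₁ : σ₁.nat 50 0 = l := by simp [hσ₁]
  have ho₁ : I.OccsOK σ₁ := by
    refine ⟨fun l r => ?_, fun r hr => ?_⟩
    · rw [← ho.count, State.occs, State.occs, hA₁.nat 40 rfl, hA₁.nat 41 rfl]
    · rw [hA₁.nat 42 rfl, ho.base r hr]
  suffices H : ∃ T, WP (.cond (.eq (.get 44 (.var 50)) (.lit 1))
      (.forTo 48 (.get 40 (.var 50)) occProg) .skip) σ₁ T (fun τ =>
      (∀ r' < I.numRules, τ.nat 43 r' = I.numOpen (I.fired p (L ++ [r])) r' (I.numE r')) ∧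
      I.QueueOK p (τ.nat 43) τ.queue ∧ (∃ q, τ.queue = σ.queue ++ q) ∧
      T + 130 * ∑ r ∈ Finset.range I.numRules, τ.nat 43 r ≤
        130 * ∑ r ∈ Finset.range I.numRules, σ.nat 43 r + 170) by
    obtain ⟨T, hT⟩ := H
    refine ⟨20 + (T + 10), ((WP.of_loopFree rfl (Q := fun τ => τ = σ₁) e₁).mono
      (show Prog.cost _ ≤ 20 by decide) (fun _ _ h => h)).seq (T₂ := T + 10) ?_⟩
    rintro τ - rfl
    refine hT.seq fun τ hA hτ => ?_
    obtain ⟨h₁, h₂, ⟨q, h₃⟩, h₄⟩ := hτ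
    refine (WP.of_loopFree rfl ?_).mono (show Prog.cost _ ≤ 10 by decide) (fun _ _ h => h)
    set υ := Prog.run (.setNat 44 (.var 50) (.sub (.get 44 (.var 50)) (.lit 1))) τ with hυ
    have e44 : ∀ y, υ.nat 44 y = if y = l then σ.nat 44 l - 1 else σ.nat 44 y := by
      intro y
      simp [hυ, Prog.run, hA.nat 44 rfl, hA.nat 50 rfl, h50₁, h44₁]
    have e43 : υ.nat 43 = τ.nat 43 := State.updateNat_nat_of_ne _ _ _ (by norm_num)
    have e46 : υ.nat 46 0 = n + 1 := by
      rw [hυ, Prog.run, State.updateNat_nat_of_ne _ _ _ (by norm_num), hA.nat 46 rfl, h46₁]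
    have eq : υ.queue = σ.queue ++ q := by
      rw [← h₃]; simp [State.queue, hυ, Prog.run]
    have etake : υ.queue.take (n + 1) = L ++ [r] := by
      rw [eq, List.take_append_of_le_length (by rw [State.length_queue]; omega), htake]
    refine ⟨⟨?_, ?_, fun y => ?_⟩, ?_⟩
    · rw [e46, etake, e43]; exact h₁
    · rw [e43, eq, ← h₃]; exact h₂
    · rw [e46, etake, e44, hpend, hpend]
      rw [List.map_append, List.count_append, List.map_singleton, ← hl]
      by_cases hy : y = l
      · rw [if_pos hy, hy, List.count_singleton_self]
        omega
      · rw [if_neg hy, List.count_singleton, if_neg (by simpa using Ne.symm hy), add_zero]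
    · rw [e46, e43]
      obtain ⟨d, hd⟩ : ∃ d, I.numRules - n = d + 1 := ⟨I.numRules - n - 1, by omega⟩
      rw [hd, show I.numRules - (n + 1) = d by omega]
      omega
  by_cases hp : σ.nat 44 l = 1
  · have hp' : p l = (L.map I.lhs).count l + 1 := by have := hpend l; omega
    obtain ⟨hn, hf⟩ := State.fired_snoc_of_eq hp'
    refine ⟨_, WP.cond (fun _ => (wp_occs I σ₁ p L l hn ho₁ h50₁ (by rw [h43₁]; exact h.cnt)
      (by rw [h43₁, hq₁]; exact h.queue) (s := n + 1) (by rw [hq₁, htake, hf])).mono le_rfl ?_)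
      (fun hb => ?_)⟩
    · rintro τ _ ⟨h₁, h₂, h₃, h₄⟩
      rw [hq₁] at h₃
      rw [h43₁] at h₄
      rw [hf]
      refine ⟨h₁, h₂, h₃, ?_⟩
      rw [← h₄]
      simp only [Test.cost, Test.eq, NExpr.cost]
      omega
    · simp [h50₁, h44₁, hp] at hb
  · have hp' : p l ≠ (L.map I.lhs).count l + 1 := by have := hpend l; omega
    have hf := State.fired_snoc_of_ne hp'
    refine ⟨_, WP.cond (T := 1) (fun hb => ?_) (fun _ => ⟨_, _, .skip _, le_rfl, ?_⟩)⟩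
    · simp [h50₁, h44₁, hp] at hb
    · beta_reduce
      rw [hf, h43₁, hq₁]
      refine ⟨h.cnt, h.queue, ⟨[], by simp⟩, ?_⟩
      simp only [Test.cost, Test.eq, NExpr.cost]
      omega

/-- When the head of the queue reaches its tail, the counters refer to all rules in the queue, and a
rule is in the queue if and only if its counter is 0; this gives completeness. The counters start at
no more than the numbers of edges, so the time is linear. -/
theorem wp_prop : ∃ K, ∀ I σ : State, I.Inp σ → I.OccsOK σ →
    WP propProg σ (K * (I.numRules + ∑ r ∈ Finset.range I.numRules, I.numE r + 1)) (fun τ =>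
      τ.queue.Nodup ∧ (∀ r ∈ τ.queue, r < I.numRules) ∧ I.Sound (σ.nat 44) τ.queue ∧
      (∀ r < I.numRules, (∀ e < I.numE r, I.IsNt (I.lab r e) →
        I.lab r e ∈ I.fired (σ.nat 44) τ.queue) → r ∈ τ.queue)) := by
  obtain ⟨K, hK⟩ := wp_initQueue
  refine ⟨K + 300, fun I σ hI ho => ?_⟩
  set p := σ.nat 44 with hp
  refine (WP.seq (hK I σ p hI ho) (T₂ := 3 + (250 * I.numRules + 130 *
    ∑ r ∈ Finset.range I.numRules, I.numE r + 40)) fun τ hτ h => (WP.assign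
      (Q := fun τ => I.PropInv p τ ∧ τ.nat 46 0 = 0 ∧
        ∀ r < I.numRules, τ.nat 43 r = I.numOpen ∅ r (I.numE r)) ?_).seq
      fun υ hυ hinv => (WP.loop (I.PropInv p) (fun τ => 250 * (I.numRules - τ.nat 46 0) +
        130 * ∑ r ∈ Finset.range I.numRules, τ.nat 43 r) ?_ hinv.1).mono ?_ ?_).mono ?_
      (fun _ _ h => h)
  · have e : (τ.updateNat 46 0 0).queue = τ.queue := by simp [State.queue]
    have hA : Agree initQueueProg σ τ := hτ
    have e44 : τ.nat 44 = σ.nat 44 := hτ.nat 44 rfl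
    refine ⟨⟨fun r hr => ?_, ?_, fun l => ?_⟩, by simp, fun r hr => ?_⟩
    · simp only [NExpr.eval, State.updateNat_nat, Nat.reduceEqDiff, false_and, if_false, and_self,
        if_true, List.take_zero]
      rw [h.1 r hr]
      congr 1
      ext l
      simp [State.fired]
      omega
    · simp only [NExpr.eval, e]
      rw [State.updateNat_nat_of_ne _ _ _ (by norm_num)]
      exact h.2
    · simp [e44, hp]
    · simp [h.1 r hr]
  · intro ω hinv hA hlt
    have hA' : Agree propProg σ ω := hτ.seq_left.trans (hυ.seq_left.trans hA.seq_right).seq_right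
    have ho' : I.OccsOK ω := by
      refine ⟨fun l r => ?_, fun r hr => ?_⟩
      · rw [← ho.count, State.occs, State.occs, hA'.nat 40 rfl, hA'.nat 41 rfl]
      · rw [hA'.nat 42 rfl, ho.base r hr]
    obtain ⟨T, hT⟩ := wp_pop I ω p (hI.agree hA' rfl rfl) ho' hinv (by simpa using hlt)
    refine ⟨T, hT.mono le_rfl fun τ _ h => ⟨h.1, ?_⟩⟩
    have := h.2
    simp only [Test.lt, Test.cost, NExpr.cost]
    omega
  · have h₁ : ∑ r ∈ Finset.range I.numRules, υ.nat 43 r ≤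
        ∑ r ∈ Finset.range I.numRules, I.numE r := by
      refine Finset.sum_le_sum fun r hr => ?_
      rw [hinv.2.2 r (Finset.mem_range.1 hr)]
      exact State.numOpen_le
    rw [hinv.2.1]
    simp only [Test.lt, Test.cost, NExpr.cost]
    omega
  · rintro ω _ ⟨h, hb, -⟩
    simp only [Test.holds_lt, NExpr.eval, not_lt] at hb
    refine ⟨h.queue.nodup, fun r hr => ((h.queue.mem r).1 hr).1, h.queue.sound,
      fun r hr hf => (h.queue.mem r).2 ⟨hr, ?_⟩⟩
    rw [h.cnt r hr, List.take_of_length_le (by rw [State.length_queue]; exact hb)]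
    exact State.numOpen_eq_zero.2 hf
  · ring_nf
    omega


/-! ### Correctness of the two propagations -/

namespace State

variable {I : State} {p p' : ℕ → ℕ} {q q' : List ℕ} {ρ : ℕ → ℕ}

/-- Ranks of labels that decrease from the left-hand side of a rule to the nonterminals of its
right-hand side. Labels of rank `0` are those without derivations. -/
def Acyclic (I : State) (ρ : ℕ → ℕ) : Prop :=
  ∀ r < I.numRules, (∃ e < I.numE r, I.IsNt (I.lab r e) ∧ ρ (I.lab r e) = 0) ∨
    (1 ≤ ρ (I.lhs r) ∧ ∀ e < I.numE r, I.IsNt (I.lab r e) → ρ (I.lab r e) < ρ (I.lhs r))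

/-- The properties of the list of rules produced by the propagation. -/
structure PropOK (I : State) (p : ℕ → ℕ) (q : List ℕ) : Prop where
  nodup : q.Nodup
  lt : ∀ r ∈ q, r < I.numRules
  sound : I.Sound p q
  complete : ∀ r < I.numRules, (∀ e < I.numE r, I.IsNt (I.lab r e) →
    I.lab r e ∈ I.fired p q) → r ∈ q

theorem exists_of_fired {l : ℕ} (h : l ∈ I.fired p q) : ∃ r ∈ q, I.lhs r = l := by
  have : l ∈ q.map I.lhs := List.count_pos_iff.1 (by have := h.1; have := h.2; omega)
  simpa using this

theorem Sound.mem_fired (h : I.Sound p q) {r e : ℕ} (hr : r ∈ q) (he : e < I.numE r)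
    (ht : I.IsNt (I.lab r e)) : I.lab r e ∈ I.fired p q := by
  induction h with
  | nil => simp at hr
  | @snoc q r' hq hr' ih =>
    refine fired_mono (List.sublist_append_left q [r']) ?_
    rw [List.mem_append, List.mem_singleton] at hr
    rcases hr with hr | rfl
    exacts [ih hr, hr' e he ht]

theorem Sound.take (h : I.Sound p q) : ∀ {i : ℕ} (hi : i < q.length),
    ∀ e < I.numE q[i], I.IsNt (I.lab q[i] e) → I.lab q[i] e ∈ I.fired p (q.take i) := by
  induction h with
  | nil => intro i hi; simp at hi
  | @snoc q r hq hr ih =>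
    intro i hi e he ht
    rw [List.length_append, List.length_singleton] at hi
    rcases Nat.lt_succ_iff_lt_or_eq.1 hi with hi' | rfl
    · rw [List.getElem_append_left hi'] at he ht ⊢
      rw [List.take_append_of_le_length hi'.le]
      exact ih hi' e he ht
    · simp only [List.getElem_append_right le_rfl, Nat.sub_self, List.getElem_cons_zero] at he ht ⊢
      rw [List.take_append_of_le_length le_rfl, List.take_length]
      exact hr e he ht

/-- The first alternative of `Acyclic` is impossible in the queue: a fired label is the left-hand
side of an earlier rule in the queue, and this has positive rank by induction. -/
theorem Sound.rank_pos (hρ : I.Acyclic ρ) (hlt : ∀ r ∈ q, r < I.numRules) (h : I.Sound p q) :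
    ∀ r ∈ q, 1 ≤ ρ (I.lhs r) ∧ ∀ e < I.numE r, I.IsNt (I.lab r e) →
      ρ (I.lab r e) < ρ (I.lhs r) := by
  induction h with
  | nil => simp
  | @snoc q r' hq hr' ih =>
    intro r hr
    rw [List.mem_append, List.mem_singleton] at hr
    rcases hr with hr | rfl
    · exact ih (fun r hr => hlt r (by simp [hr])) r hr
    · refine (hρ r (hlt r (by simp))).resolve_left ?_
      rintro ⟨e, he, ht, h0⟩
      obtain ⟨r', h', e'⟩ := exists_of_fired (hr' e he ht)
      have := (ih (fun r hr => hlt r (by simp [hr])) r' h').1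
      rw [e', h0] at this
      omega

/-- A list without repetitions that is contained in another list and is not shorter is a permutation
of it; here both are restricted to one left-hand side. -/
theorem perm_filter {q₁ q₂ : List ℕ} {f : ℕ → ℕ} {l : ℕ} (h₁ : q₁.Nodup)
    (hsub : ∀ r ∈ q₁, f r = l → r ∈ q₂) (hcount : (q₂.map f).count l ≤ (q₁.map f).count l) :
    (q₁.filter (f · = l)).Perm (q₂.filter (f · = l)) := by
  have e : ∀ q : List ℕ, (q.map f).count l = (q.filter (f · = l)).length := fun q => by
    rw [List.count, List.countP_map, List.countP_eq_length_filter]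
    congr 1
  rw [e, e] at hcount
  refine List.Subperm.perm_of_length_le (List.subperm_of_subset (h₁.filter _) fun r hr => ?_) hcount
  rw [List.mem_filter] at hr ⊢
  exact ⟨hsub r hr.1 (by simpa using hr.2), hr.2⟩

theorem count_map_le {q₁ q₂ : List ℕ} {f : ℕ → ℕ} {l : ℕ} (h₁ : q₁.Nodup)
    (hsub : ∀ r ∈ q₁, f r = l → r ∈ q₂) : (q₁.map f).count l ≤ (q₂.map f).count l := by
  have e : ∀ q : List ℕ, (q.map f).count l = (q.filter (f · = l)).length := fun q => by
    rw [List.count, List.countP_map, List.countP_eq_length_filter]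
    congr 1
  rw [e, e]
  refine (List.subperm_of_subset (h₁.filter _) fun r hr => ?_).length_le
  rw [List.mem_filter] at hr ⊢
  exact ⟨hsub r hr.1 (by simpa using hr.2), hr.2⟩

/-- The second propagation finds the same rules as the first. -/
theorem PropOK.mem_iff (hρ : I.Acyclic ρ) (h : I.PropOK p q) (h' : I.PropOK p' q')
    (hp : ∀ r < I.numRules, p (I.lhs r) = 1)
    (hp' : ∀ r < I.numRules, p' (I.lhs r) = (q.map I.lhs).count (I.lhs r)) (r : ℕ) :
    r ∈ q' ↔ r ∈ q := by
  constructor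
  -- A label fires in the second run only if its threshold is positive, and this threshold counts
  -- the rules for it found by the first run.
  · refine fun hr => h.complete r (h'.lt r hr) fun e he ht => ?_
    have hf := h'.sound.mem_fired hr he ht
    obtain ⟨r', hr', e'⟩ := exists_of_fired hf
    rw [← e'] at hf ⊢
    have h₁ := hp' r' (h'.lt r' hr')
    have h₂ := hp r' (h'.lt r' hr')
    exact ⟨h₂.ge, by rw [h₂, ← h₁]; exact hf.1⟩
  -- By induction on the rank of the left-hand side, all rules that the first run found for the
  -- nonterminals of `r` are found again, so the thresholds of these nonterminals are reached.
  · suffices H : ∀ n r, r ∈ q → ρ (I.lhs r) = n → r ∈ q' from fun hr => H _ r hr rfl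
    intro n
    induction n using Nat.strong_induction_on with
    | _ n ih =>
      rintro r hr rfl
      refine h'.complete r (h.lt r hr) fun e he ht => ?_
      have hlt := (h.sound.rank_pos hρ h.lt r hr).2 e he ht
      have hf := h.sound.mem_fired hr he ht
      obtain ⟨r', hr', e'⟩ := exists_of_fired hf
      have h₁ := hp' r' (h.lt r' hr')
      have h₂ := hp r' (h.lt r' hr')
      rw [e'] at h₁ h₂
      refine ⟨by rw [h₁, ← h₂]; exact hf.2, ?_⟩
      rw [h₁]
      refine count_map_le h.nodup fun r'' hr'' e'' => ih _ (by rwa [e'']) r'' hr'' rfl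

/-- The part of a rule in the equation for the entry `k`. -/
noncomputable def ruleK (I : State) (x : ℕ → ℝ≥0∞) (r k : ℕ) : ℝ≥0∞ :=
  ∑ i ∈ Finset.range (I.numAsg r), if I.extKey r (I.asg r i) = k then I.ruleVal x r (I.asg r i) else 0

theorem ruleK_eq_zero (x : ℕ → ℝ≥0∞) {r l t : ℕ} (h : I.lhs r ≠ l) :
    I.ruleK x r (cell l t) = 0 :=
  Finset.sum_eq_zero fun _ _ => if_neg fun h' => h (cell_inj h').1

/-- The vector that is ∞ at fired labels and 0 elsewhere is a pre-fixed point: a rule outside of the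
list contains a nonterminal that has not fired, so its products have a factor 0. -/
theorem lfpK_eq_zero_of_notMem_fired (h : I.PropOK p q) (hp : ∀ r < I.numRules, p (I.lhs r) = 1)
    {l : ℕ} (hl : l ∉ I.fired p q) (t : ℕ) : I.lfpK (cell l t) = 0 := by
  classical
  have : I.lfpK ≤ fun k => if ∃ l t, k = cell l t ∧ l ∈ I.fired p q then ⊤ else 0 := by
    refine I.lfpK_le fun k => ?_
    by_cases hk : ∃ l t, k = cell l t ∧ l ∈ I.fired p q
    · simp only [if_pos hk]; exact le_top
    · simp only [if_neg hk, nonpos_iff_eq_zero]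
      refine Finset.sum_eq_zero fun r hr => Finset.sum_eq_zero fun i _ => ?_
      rw [Finset.mem_range] at hr
      split_ifs with he
      · have hr' : r ∉ q := fun hrq => by
          refine hk ⟨_, _, he.symm, by rw [hp r hr], ?_⟩
          rw [hp r hr]
          exact List.count_pos_iff.2 (List.mem_map_of_mem hrq)
        have := mt (h.complete r hr) hr'
        push Not at this
        obtain ⟨e, he, ht, hn⟩ := this
        refine Finset.prod_eq_zero (Finset.mem_range.2 he) ?_
        unfold edgeVal
        rw [if_pos ht]
        refine if_neg ?_
        rintro ⟨l', t', h₁, h₂⟩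
        exact hn ((cell_inj h₁).1 ▸ h₂)
      · rfl
  have h' := this (cell l t)
  simp only at h'
  rw [if_neg] at h'
  · exact nonpos_iff_eq_zero.1 h'
  · rintro ⟨l', t', h₁, h₂⟩
    exact hl ((cell_inj h₁).1 ▸ h₂)

/-- Rules outside of the list contribute 0, because one of their nonterminals has only the value 0.
-/
theorem lfpK_eq_sum (h : I.PropOK p q) (hp : ∀ r < I.numRules, p (I.lhs r) = 1) (k : ℕ) :
    I.lfpK k = (q.map fun r => I.ruleK I.lfpK r k).sum := by
  rw [← congrFun I.stepK_lfpK k, ← List.sum_toFinset _ h.nodup]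
  symm
  refine Finset.sum_subset (fun r hr => Finset.mem_range.2 (h.lt r (by simpa using hr))) ?_
  intro r hr hrq
  rw [Finset.mem_range] at hr
  have := mt (h.complete r hr) (by simpa using hrq)
  push Not at this
  obtain ⟨e, he, ht, hn⟩ := this
  refine Finset.sum_eq_zero fun i _ => ?_
  rw [ruleVal, Finset.prod_eq_zero (Finset.mem_range.2 he), ite_self]
  unfold edgeVal
  rw [if_pos ht]
  exact lfpK_eq_zero_of_notMem_fired h hp hn _

theorem sum_ruleK_filter (x : ℕ → ℝ≥0∞) (q : List ℕ) (l t : ℕ) :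
    (q.map fun r => I.ruleK x r (cell l t)).sum =
      ((q.filter (I.lhs · = l)).map fun r => I.ruleK x r (cell l t)).sum := by
  induction q with
  | nil => rfl
  | cons r q ih =>
    by_cases h : I.lhs r = l
    · simp [h, ih]
    · simp [h, ih, ruleK_eq_zero x h]

/-- When a label has fired in the second propagation, its values are complete. -/
theorem sum_take_eq_lfpK (hρ : I.Acyclic ρ) (h : I.PropOK p q) (h' : I.PropOK p' q')
    (hp : ∀ r < I.numRules, p (I.lhs r) = 1)
    (hp' : ∀ r < I.numRules, p' (I.lhs r) = (q.map I.lhs).count (I.lhs r)) {i l : ℕ}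
    (hl : l ∈ I.fired p' (q'.take i)) (t : ℕ) :
    ((q'.take i).map fun r => I.ruleK I.lfpK r (cell l t)).sum = I.lfpK (cell l t) := by
  have hsub := List.take_sublist i q'
  rw [lfpK_eq_sum h hp, sum_ruleK_filter, sum_ruleK_filter (q := q)]
  refine List.Perm.sum_eq (List.Perm.map _ (perm_filter (h'.nodup.sublist hsub)
    (fun r hr _ => (h.mem_iff hρ h' hp hp' r).1 (hsub.subset hr)) ?_))
  obtain ⟨r, hr, e⟩ := exists_of_fired hl
  have := hp' r (h'.lt r (hsub.subset hr))
  rw [e] at this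
  rw [← this]
  exact hl.2

end State


/-! ### Nonrecursive grammars: the program and its time -/

/-- All memory apart from the input is zero. -/
structure State.Fresh (I : State) : Prop where
  nat : ∀ a, 12 ≤ a → ∀ i, I.nat a i = 0
  val : ∀ a, 1 ≤ a → ∀ i, I.val a i = 0

theorem State.Inp.refl (I : State) : I.Inp I := ⟨fun _ _ => rfl, rfl⟩

/-- Sets the numbers of rules that have to be seen before the left-hand sides of rules fire. -/
def setPendProg (n : ℕ) : Prog :=
  .forTo 20 (.get 0 (.lit 0)) (.setNat 44 (.get 5 (.var 20)) (.lit n))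

theorem wp_setPend (n : ℕ) (I σ : State) (hI : I.Inp σ) :
    WP (setPendProg n) σ (100 * (I.numRules + 1)) (fun τ =>
      ∀ r < I.numRules, τ.nat 44 (I.lhs r) = n) := by
  refine (WP.forTo_const (fun m τ => ∀ r < m, τ.nat 44 (I.lhs r) = n) I.numRules 50 rfl (by simp)
    ?_ ?_).mono ?_ (fun _ _ h => h.1)
  · intro j υ _ hA
    have hi := hI.agree hA rfl rfl
    simp [hi.nat, State.numRules]
  · intro j υ hj h hυ hA
    have hi := hI.agree hA rfl rfl
    refine (WP.of_loopFree rfl ?_).mono (by simp [Prog.cost, NExpr.cost]) (fun _ _ h => h)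
    intro r hr
    simp only [Prog.run, NExpr.eval, hυ, hi.nat 5 (by norm_num), State.updateNat_nat,
      Nat.reduceEqDiff, false_and, if_false, true_and, State.lhs]
    split_ifs with he
    · rfl
    · refine h r (lt_of_le_of_ne (by omega) ?_)
      rintro rfl
      exact he rfl
  · simp only [NExpr.cost]
    ring_nf
    omega

/-- Counts the rules in the queue for every left-hand side. -/
def countPendProg : Prog :=
  .forTo 48 (.var 47) (.setNat 44 (.get 5 (.get 45 (.var 48)))
    (.add (.get 44 (.get 5 (.get 45 (.var 48)))) (.lit 1)))

theorem wp_countPend (I σ : State) (hI : I.Inp σ) :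
    WP countPendProg σ (100 * (σ.nat 47 0 + 1)) (fun τ =>
      ∀ l, τ.nat 44 l = σ.nat 44 l + (σ.queue.map I.lhs).count l) := by
  refine (WP.forTo_const (fun m τ => ∀ l, τ.nat 44 l = σ.nat 44 l +
    ((σ.queue.take m).map I.lhs).count l) (σ.nat 47 0) 50 rfl (by simp)
    ?_ ?_).mono ?_ ?_
  · intro j υ _ hA
    simp [hA.nat 47 rfl]
  · intro j υ hj h hυ hA
    have hi := hI.agree hA rfl rfl
    refine (WP.of_loopFree rfl ?_).mono (show Prog.cost _ ≤ 50 by decide) (fun _ _ h => h)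
    intro l
    have htake : σ.queue.take (j + 1) = σ.queue.take j ++ [σ.nat 45 j] := by
      rw [List.take_add_one, List.getElem?_eq_getElem (by rwa [State.length_queue])]
      simp [State.queue]
    simp only [Prog.run, NExpr.eval, hυ, hi.nat 5 (by norm_num), State.updateNat_nat,
      Nat.reduceEqDiff, false_and, if_false, true_and, hA.nat 45 rfl, htake, List.map_append,
      List.count_append, List.map_singleton, List.count_singleton, State.lhs, h]
    by_cases he : l = I.nat 5 (σ.nat 45 j)
    · subst he
      simp [add_assoc]
    · simp [he, Ne.symm he]
  · simp only [NExpr.cost]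
    ring_nf
    omega
  · rintro τ _ ⟨h, -⟩ l
    rw [h, List.take_of_length_le (by rw [State.length_queue])]

/-- Finds the rules that occur in derivations, in an order in which all rules for the nonterminals
in a rule come before this rule. -/
def orderProg : Prog :=
  buildProg ;; setPendProg 1 ;; propProg ;; setPendProg 0 ;; countPendProg ;; propProg

theorem State.OccsOK.agree {I σ τ : State} {p : Prog} (h : I.OccsOK σ) (hA : Agree p σ τ)
    (h40 : p.writesNat 40 = false) (h41 : p.writesNat 41 = false) (h42 : p.writesNat 42 = false) :
    I.OccsOK τ := by
  refine ⟨fun l r => ?_, fun r hr => ?_⟩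
  · rw [← h.count, State.occs, State.occs, hA.nat 40 h40, hA.nat 41 h41]
  · rw [hA.nat 42 h42, h.base r hr]

theorem State.PropOK.length_le {I : State} {p : ℕ → ℕ} {q : List ℕ} (h : I.PropOK p q) :
    q.length ≤ I.numRules := by
  rw [← List.toFinset_card_of_nodup h.nodup, ← Finset.card_range I.numRules]
  exact Finset.card_le_card fun r hr => Finset.mem_range.2 (h.lt r (by simpa using hr))

/-- The thresholds are prescribed only at left-hand sides of rules, as no other label can fire. They
have to be reset before the counting, since the first propagation decrements array `44`. -/
theorem wp_order : ∃ K, ∀ I σ : State, I.Inp σ → (∀ l, σ.nat 40 l = 0) → (∀ r, σ.nat 42 r = 0) →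
    WP orderProg σ (K * (I.numRules + ∑ r ∈ Finset.range I.numRules, I.numE r + 1)) (fun τ =>
      ∃ p q p', I.PropOK p q ∧ I.PropOK p' τ.queue ∧ (∀ r < I.numRules, p (I.lhs r) = 1) ∧
        (∀ r < I.numRules, p' (I.lhs r) = (q.map I.lhs).count (I.lhs r))) := by
  obtain ⟨K₁, h₁⟩ := wp_build
  obtain ⟨K₂, h₂⟩ := wp_prop
  refine ⟨K₁ + 2 * K₂ + 300, fun I σ hI h40 h42 => ?_⟩
  set N := I.numRules + ∑ r ∈ Finset.range I.numRules, I.numE r + 1 with hN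
  refine (WP.seq (h₁ I σ hI h40 h42) (T₂ := 100 * (I.numRules + 1) + (K₂ * N +
    (100 * (I.numRules + 1) + (100 * (I.numRules + 1) + K₂ * N)))) fun τ₁ a₁ ho => ?_).mono ?_
    (fun _ _ h => h)
  · have i₁ := hI.agree a₁ rfl rfl
    refine (wp_setPend 1 I τ₁ i₁).seq fun τ₂ a₂ hp => ?_
    have i₂ := i₁.agree a₂ rfl rfl
    have o₂ := ho.agree a₂ rfl rfl rfl
    refine (h₂ I τ₂ i₂ o₂).seq fun τ₃ a₃ hq => ?_
    have hq : I.PropOK (τ₂.nat 44) τ₃.queue := ⟨hq.1, hq.2.1, hq.2.2.1, hq.2.2.2⟩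
    have i₃ := i₂.agree a₃ rfl rfl
    have o₃ := o₂.agree a₃ rfl rfl rfl
    refine (wp_setPend 0 I τ₃ i₃).seq fun τ₄ a₄ hp' => ?_
    have i₄ := i₃.agree a₄ rfl rfl
    have o₄ := o₃.agree a₄ rfl rfl rfl
    have q₄ : τ₄.queue = τ₃.queue := by simp [State.queue, a₄.nat 45 rfl, a₄.nat 47 rfl]
    refine ((wp_countPend I τ₄ i₄).mono (T' := 100 * (I.numRules + 1)) ?_ (fun _ _ h => h)).seq
      fun τ₅ a₅ hc => ?_
    · rw [← State.length_queue, q₄]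
      have := hq.length_le
      omega
    have i₅ := i₄.agree a₅ rfl rfl
    have o₅ := o₄.agree a₅ rfl rfl rfl
    refine (h₂ I τ₅ i₅ o₅).mono le_rfl fun τ₆ a₆ hq' => ?_
    refine ⟨_, _, _, hq, ⟨hq'.1, hq'.2.1, hq'.2.2.1, hq'.2.2.2⟩, hp, fun r hr => ?_⟩
    rw [hc, hp' r hr, q₄, zero_add]
  · have : I.numRules + 1 ≤ N := by omega
    nlinarith

/-- Computes the sum–products of nonrecursive grammars. -/
def nonrecProg : Prog :=
  orderProg ;; .assign 31 (.lit 1) ;;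
  .forTo 48 (.var 47) (.assign 20 (.get 45 (.var 48)) ;; ruleProg) ;;
  .setVal 1 (.lit 0) (.get 2 (.cell (.get 0 (.lit 1)) (.lit 0)))

theorem State.openVal_eq_ruleVal {I : State} {x y : ℕ → ℝ≥0∞} {rk : ℕ → ℕ} {c r : ℕ} {d : ℕ → ℕ}
    (hs : ∀ e < I.numE r, ¬ I.Sel rk c r e)
    (hxy : ∀ e < I.numE r, I.IsNt (I.lab r e) → ∀ t, x (cell (I.lab r e) t) = y (cell (I.lab r e) t)) :
    I.openVal x rk c r d (I.numE r) = I.ruleVal y r d := by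
  refine Finset.prod_congr rfl fun e he => ?_
  rw [Finset.mem_range] at he
  rw [if_neg (hs e he)]
  unfold edgeVal
  split_ifs with ht
  · exact hxy e he ht _
  · rfl

theorem State.selKey_eq_zero {I : State} {rk : ℕ → ℕ} {c r : ℕ} {d : ℕ → ℕ} {n : ℕ}
    (hs : ∀ e < n, ¬ I.Sel rk c r e) : I.selKey rk c r d n = 0 := by
  induction n with
  | zero => rfl
  | succ n ih =>
    rw [State.selKey, if_neg (hs n (by omega)), ih fun e he => hs e (by omega)]

theorem wp_nonrec : ∃ C, ∀ (I : State) (ρ : ℕ → ℕ) (M s : ℕ), I.Fresh → I.WellFormed →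
    I.Acyclic ρ → 0 < M → 0 < I.numRules → (∀ r < I.numRules, I.numAsg r ≤ M) →
    (∀ r < I.numRules, I.size r ≤ s) →
    WP nonrecProg I (C * (s + 1) * (I.numRules * M)) (fun τ =>
      τ.val 1 0 = I.lfpK (cell I.start 0)) := by
  obtain ⟨K₁, h₁⟩ := wp_order
  obtain ⟨K₂, h₂⟩ := wp_rule
  refine ⟨3 * K₁ + (4 * K₂ + 200) + 50, fun I ρ M s hF hw hρ hM hR hN hs => ?_⟩
  set R := I.numRules with hRdef
  refine (WP.seq (h₁ I I (.refl I) (hF.nat 40 (by norm_num)) (hF.nat 42 (by norm_num)))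
    (T₂ := 3 + (((10 + K₂ * (s + 1) * (M + 1)) + 30) * (R + 1) + 20)) fun τ₁ a₁ ho => ?_).mono ?_
    (fun _ _ h => h)
  · obtain ⟨p, q, p', hq, hq', hp, hp'⟩ := ho
    -- All entries of array `32` are still 0, so the rank 1 selects no edge, and `ruleProg` just
    -- adds the products to the values.
    refine (WP.assign (Q := fun τ => τ = τ₁.updateNat 31 0 1) rfl).seq ?_
    rintro τ₂ a₂ rfl
    set τ₂ := τ₁.updateNat 31 0 1
    have qτ : τ₂.queue = τ₁.queue := by simp [State.queue, a₂.nat 45 rfl, a₂.nat 47 rfl]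
    rw [← qτ] at hq'
    have h31 : τ₂.nat 31 0 = 1 := by simp [τ₂]
    refine ((WP.forTo_const (fun n τ => τ.KeysOK ∧ ∀ l t, τ.val 2 (cell l t) =
      ((τ₂.queue.take n).map fun r => I.ruleK I.lfpK r (cell l t)).sum) (τ₂.nat 47 0)
      (10 + K₂ * (s + 1) * (M + 1)) rfl ?_ ?_ ?_).mono ?_ (fun _ _ h => h)).seq fun τ₃ a₃ h₃ => ?_
    · have e : (τ₂.updateNat 48 0 0).keys = [] := by
        simp [State.keys, a₂.nat 35 rfl, a₁.nat 35 rfl, hF.nat]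
      refine ⟨⟨by simp [e], fun k => ?_⟩, fun l t => ?_⟩
      · simp [e, a₂.nat 33 rfl, a₁.nat 33 rfl, hF.nat]
      · simp [a₂.val 2 rfl, a₁.val 2 rfl, hF.val]
    · intro j υ _ hA
      simp [hA.nat 47 rfl]
    · rintro n υ hn ⟨hk, hv⟩ hυ hA
      rw [← State.length_queue] at hn
      set r := τ₂.nat 45 n with hr
      have hrq : τ₂.queue[n] = r := by simp [State.queue, hr]
      have hrmem : r ∈ τ₂.queue := hrq ▸ List.getElem_mem hn
      have hrR : r < R := hq'.lt r hrmem
      have hrq' : r ∈ q := (hq.mem_iff hρ hq' hp hp' r).1 hrmem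
      have hrank := (hq.sound.rank_pos hρ hq.lt r hrq').2
      have i : I.Inp υ :=
        (((State.Inp.refl I).agree a₁ rfl rfl).agree a₂ rfl rfl).agree hA rfl rfl
      have h32 : ∀ l, υ.nat 32 l = 0 := fun l => by
        rw [hA.nat 32 rfl, a₂.nat 32 rfl, a₁.nat 32 rfl, hF.nat 32 (by norm_num)]
      have h31' : υ.nat 31 0 = 1 := by rw [hA.nat 31 rfl, h31]
      have htake : τ₂.queue.take (n + 1) = τ₂.queue.take n ++ [r] := by
        rw [List.take_add_one, List.getElem?_eq_getElem hn, hrq]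
        rfl
      refine ((WP.assign (Q := fun τ => τ = υ.updateNat 20 0 r) ?_).mono
        (show _ ≤ 10 by simp [NExpr.cost]) (fun _ _ h => h)).seq fun ω aω hω => ?_
      · simp [hυ, hA.nat 45 rfl, hr]
      have i' : I.Inp ω := i.agree aω rfl rfl
      have e20 : ω.nat 20 0 = r := by simp [hω]
      have e32 : ω.nat 32 = υ.nat 32 := aω.nat 32 rfl
      have e31 : ω.nat 31 0 = 1 := by rw [aω.nat 31 rfl, h31']
      have e2 : ω.val 2 = υ.val 2 := aω.val 2 rfl
      refine (h₂ I ω i' hw (by rwa [e20])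
        (hk.congr (aω.nat 34 rfl) (aω.nat 35 rfl) (aω.nat 33 rfl)) ?_).mono ?_ ?_
      -- No edge of a productive rule carries its left-hand side, because the rank decreases; the
      -- condition on such edges holds vacuously.
      · rw [e20]
        intro e he ht hl
        have := hrank e he ht
        rw [hl] at this
        omega
      · rw [e20]
        exact Nat.mul_le_mul (Nat.mul_le_mul_left _ (Nat.succ_le_succ (hs r hrR)))
          (Nat.succ_le_succ (hN r hrR))
      · rintro τ aτ ⟨k₁, -, -, k₄, -⟩
        refine ⟨k₁.congr (State.updateNat_nat_of_ne _ _ _ (by norm_num))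
          (State.updateNat_nat_of_ne _ _ _ (by norm_num))
          (State.updateNat_nat_of_ne _ _ _ (by norm_num)), fun l t => ?_⟩
        rw [State.updateNat_val, k₄, e2, hv, htake, List.map_append, List.sum_append,
          List.map_singleton, List.sum_singleton, e20, e31]
        congr 1
        unfold State.addVec State.ruleK
        have hsel : ∀ e < I.numE r, ¬ I.Sel (ω.nat 32) 1 r e := by
          rintro e he ⟨-, h⟩
          rw [e32, h32] at h
          omega
        refine Finset.sum_congr rfl fun i _ => ?_
        rw [State.selKey_eq_zero hsel, State.openVal_eq_ruleVal hsel (y := I.lfpK)]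
        · simp
        · intro e he ht t
          rw [hv]
          -- The labels in rule number `n` of the queue have fired before it, so the values
          -- accumulated for them are already final.
          refine State.sum_take_eq_lfpK hρ hq hq' hp hp' ?_ t
          have := hq'.sound.take hn e
          rw [hrq] at this
          exact this he ht
    · have : τ₂.nat 47 0 ≤ R := by rw [← State.length_queue]; exact hq'.length_le
      simp only [NExpr.cost]
      exact Nat.mul_le_mul (by omega) (by omega)
    · refine (WP.of_loopFree rfl ?_).mono (show Prog.cost _ ≤ 20 by decide) (fun _ _ h => h)
      have i : I.Inp τ₃ :=
        (((State.Inp.refl I).agree a₁ rfl rfl).agree a₂ rfl rfl).agree a₃ rfl rfl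
      simp only [Prog.run, VExpr.eval, NExpr.eval, NExpr.eval_cell, State.updateVal_val, and_self,
        if_true, i.nat 0 (by norm_num)]
      rw [h₃.1.2, List.take_of_length_le (by rw [State.length_queue]), State.lfpK_eq_sum hq hp]
      -- Both propagations find the same rules, and only the order differs.
      refine List.Perm.sum_eq (List.Perm.map _ ?_)
      exact (List.perm_ext_iff_of_nodup hq'.nodup hq.nodup).2 (hq.mem_iff hρ hq' hp hp')
  · have hE : ∑ r ∈ Finset.range R, I.numE r ≤ R * s := by
      calc _ ≤ ∑ _r ∈ Finset.range R, s := Finset.sum_le_sum fun r hr => by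
            have := hs r (Finset.mem_range.1 hr)
            unfold State.size at this
            omega
        _ = _ := by simp
    have hP : R ≤ R * M := Nat.le_mul_of_pos_right _ hM
    set P := R * M with hPdef
    have hP1 : 1 ≤ P := Nat.mul_pos hR hM
    have hM1 : (M + 1) * (R + 1) ≤ 4 * P := by nlinarith
    have hR1 : R + 1 ≤ 2 * P := by omega
    have hPs : P ≤ (s + 1) * P := Nat.le_mul_of_pos_left _ (by omega)
    have hRs : R * s ≤ (s + 1) * P := by nlinarith
    have t₁ : R + ∑ r ∈ Finset.range R, I.numE r + 1 ≤ 3 * ((s + 1) * P) := by nlinarith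
    have t₂ : K₂ * (s + 1) * (M + 1) * (R + 1) ≤ 4 * K₂ * ((s + 1) * P) := by
      calc _ = K₂ * (s + 1) * ((M + 1) * (R + 1)) := by ring
        _ ≤ K₂ * (s + 1) * (4 * P) := Nat.mul_le_mul_left _ hM1
        _ = _ := by ring
    have t₃ := Nat.mul_le_mul_left K₁ t₁
    calc _ = K₁ * (R + ∑ r ∈ Finset.range R, I.numE r + 1) + (K₂ * (s + 1) * (M + 1) * (R + 1) +
          40 * (R + 1) + 23) := by ring
      _ ≤ K₁ * (3 * ((s + 1) * P)) + (4 * K₂ * ((s + 1) * P) + 200 * ((s + 1) * P) + 50 * ((s + 1) * P)) := by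
          omega
      _ = _ := by ring


/-! ### Ranks of labels of linear grammars

Arrays of natural numbers: `52` number of edges of rank `0` of a rule, `54` number of edges of the
rank of the left-hand side (edges of higher rank counting twice). -/

namespace State

variable (I : State) (ρ : ℕ → ℕ)

/-- The rank of the left-hand side of a rule without nonterminals of rank `0` is positive, it is not
exceeded by the ranks of nonterminals of the right-hand side, and it is attained at most once. -/
def RankOK (r : ℕ) : Prop :=
  (∃ e < I.numE r, I.IsNt (I.lab r e) ∧ ρ (I.lab r e) = 0) ∨
    (1 ≤ ρ (I.lhs r) ∧ (∀ e < I.numE r, I.IsNt (I.lab r e) → ρ (I.lab r e) ≤ ρ (I.lhs r)) ∧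
      ∀ e < I.numE r, ∀ e' < I.numE r, I.IsNt (I.lab r e) → I.IsNt (I.lab r e') →
        ρ (I.lab r e) = ρ (I.lhs r) → ρ (I.lab r e') = ρ (I.lhs r) → e = e')

open scoped Classical in
/-- The number of nonterminals of rank `0` among the first `n` edges. -/
noncomputable def zeros (r n : ℕ) : ℕ :=
  ∑ e ∈ Finset.range n, if I.IsNt (I.lab r e) ∧ ρ (I.lab r e) = 0 then 1 else 0

open scoped Classical in
/-- The number of nonterminals of rank `c` or, counting twice, of higher rank. -/
noncomputable def hits (c r n : ℕ) : ℕ :=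
  ∑ e ∈ Finset.range n, if I.IsNt (I.lab r e) then
    if c < ρ (I.lab r e) then 2 else if ρ (I.lab r e) = c then 1 else 0 else 0

variable {I ρ}

/-- The weight 2, given to edges of higher rank and to a left-hand side of rank 0, makes each of
these violations alone exceed 1. A total of at most 1 then leaves room for just one edge of equal
rank. -/
theorem rankOK_iff {r : ℕ} : I.RankOK ρ r ↔ I.zeros ρ r (I.numE r) ≠ 0 ∨
    (if ρ (I.lhs r) = 0 then 2 else 0) + I.hits ρ (ρ (I.lhs r)) r (I.numE r) ≤ 1 := by
  classical
  refine or_congr ?_ ⟨?_, ?_⟩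
  · simp [zeros]
  · rintro ⟨h₁, h₂, h₃⟩
    rw [if_neg (by omega), zero_add]
    have : I.hits ρ (ρ (I.lhs r)) r (I.numE r) = ((Finset.range (I.numE r)).filter fun e =>
        I.IsNt (I.lab r e) ∧ ρ (I.lab r e) = ρ (I.lhs r)).card := by
      rw [Finset.card_filter, hits]
      refine Finset.sum_congr rfl fun e he => ?_
      by_cases ht : I.IsNt (I.lab r e)
      · have := h₂ e (Finset.mem_range.1 he) ht
        rw [if_pos ht, if_neg (by omega)]
        simp [ht]
      · simp [ht]
    rw [this, Finset.card_le_one]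
    intro a ha b hb
    simp only [Finset.mem_filter, Finset.mem_range] at ha hb
    exact h₃ a ha.1 b hb.1 ha.2.1 hb.2.1 ha.2.2 hb.2.2
  · intro h
    have h0 : 1 ≤ ρ (I.lhs r) := by
      by_contra h0
      rw [if_pos (by omega)] at h
      omega
    have h' : I.hits ρ (ρ (I.lhs r)) r (I.numE r) ≤ 1 := by omega
    refine ⟨h0, fun e he ht => ?_, fun e he e' he' ht ht' h₁ h₂ => ?_⟩
    · by_contra hlt
      have := (Finset.single_le_sum (f := fun e => if I.IsNt (I.lab r e) then
        if ρ (I.lhs r) < ρ (I.lab r e) then 2 else if ρ (I.lab r e) = ρ (I.lhs r) then 1 else 0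
        else 0) (fun _ _ => Nat.zero_le _) (Finset.mem_range.2 he)).trans h'
      simp only [if_pos ht] at this
      rw [if_pos (by omega)] at this
      omega
    · by_contra hne
      have hsub : ({e, e'} : Finset ℕ) ⊆ Finset.range (I.numE r) := by
        intro x hx
        simp only [Finset.mem_insert, Finset.mem_singleton] at hx
        rcases hx with rfl | rfl <;> simpa
      have := (Finset.sum_le_sum_of_subset (f := fun e => if I.IsNt (I.lab r e) then
        if ρ (I.lhs r) < ρ (I.lab r e) then 2 else if ρ (I.lab r e) = ρ (I.lhs r) then 1 else 0
        else 0) hsub).trans h'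
      rw [Finset.sum_pair hne] at this
      simp [ht, ht', h₁, h₂] at this

/-- If the ranks `rk ≤ ρ` are too low at `r`, they may be increased. -/
theorem lt_of_not_rankOK {rk : ℕ → ℕ} (hle : ∀ l, rk l ≤ ρ l) {r : ℕ} (h : I.RankOK ρ r)
    (h' : ¬ I.RankOK rk r) : rk (I.lhs r) < ρ (I.lhs r) := by
  refine lt_of_le_of_ne (hle _) fun heq => h' ?_
  rcases h with ⟨e, he, ht, h0⟩ | ⟨h₁, h₂, h₃⟩
  · exact .inl ⟨e, he, ht, by have := hle (I.lab r e); omega⟩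
  · refine .inr ⟨by omega, fun e he ht => ?_, fun e he e' he' ht ht' e₁ e₂ => ?_⟩
    · rw [heq]; exact (hle _).trans (h₂ e he ht)
    · refine h₃ e he e' he' ht ht' (le_antisymm (h₂ e he ht) ?_) (le_antisymm (h₂ e' he' ht') ?_)
      · rw [← heq, ← e₁]; exact hle _
      · rw [← heq, ← e₂]; exact hle _

end State

/-- Checks the ranks of the nonterminals of a rule. -/
def checkProg : Prog :=
  (.assign 52 (.lit 0) ;; .cond (.eq (.get 32 eLhs) (.lit 0)) (.assign 54 (.lit 2))
    (.assign 54 (.lit 0))) ;;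
  .forTo 25 (.get 7 (.var 20)) (.cond (.eq (.get 4 eLab) (.lit 0)) .skip
    (.cond (.eq (.get 32 eLab) (.lit 0)) (.assign 52 (.add (.var 52) (.lit 1))) .skip ;;
      .cond (.lt (.get 32 eLhs) (.get 32 eLab)) (.assign 54 (.add (.var 54) (.lit 2)))
        (.cond (.eq (.get 32 eLab) (.get 32 eLhs)) (.assign 54 (.add (.var 54) (.lit 1))) .skip)))

theorem wp_check (I σ : State) (hI : I.Inp σ) :
    WP checkProg σ (500 * (I.numE (σ.nat 20 0) + 1)) (fun τ =>
      (I.RankOK (σ.nat 32) (σ.nat 20 0) ↔ τ.nat 52 0 ≠ 0 ∨ τ.nat 54 0 ≤ 1)) := by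
  set r := σ.nat 20 0 with hr
  set rk := σ.nat 32 with hrk
  refine (((WP.of_loopFree rfl (Q := fun τ => τ.nat 52 0 = 0 ∧
    τ.nat 54 0 = if rk (I.lhs r) = 0 then 2 else 0) ?_).mono (show Prog.cost _ ≤ 50 by decide)
    (fun _ _ h => h)).seq fun τ hτ h =>
    WP.forTo_const (fun n τ => τ.nat 52 0 = I.zeros rk r n ∧
      τ.nat 54 0 = (if rk (I.lhs r) = 0 then 2 else 0) + I.hits rk (rk (I.lhs r)) r n)
      (I.numE r) 400 rfl ?_ ?_ ?_).mono ?_ ?_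
  · by_cases h0 : rk (I.lhs r) = 0
    · have : σ.nat 32 (I.nat 5 (σ.nat 20 0)) = 0 := h0
      simp [Prog.run, eLhs, hI.nat, h0, this]
    · have : σ.nat 32 (I.nat 5 (σ.nat 20 0)) ≠ 0 := h0
      simp [Prog.run, eLhs, hI.nat, h0, this]
  · simp [State.zeros, State.hits, h]
  · intro n υ _ hA
    have hA' : Agree checkProg σ υ := hτ.seq_left.trans hA.seq_right
    have hi := hI.agree hA' rfl rfl
    simp [hi.nat, hA'.nat 20 rfl, ← hr, State.numE]
  · rintro n υ hn ⟨h₁, h₂⟩ hυ hA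
    have hA' : Agree checkProg σ υ := hτ.seq_left.trans hA.seq_right
    have hi := hI.agree hA' rfl rfl
    refine (WP.of_loopFree rfl ?_).mono (show Prog.cost _ ≤ 400 by decide) (fun _ _ h => h)
    have e4 := hi.nat 4 (by norm_num)
    have e5 := hi.nat 5 (by norm_num)
    have e9 := hi.nat 9 (by norm_num)
    have e20 : υ.nat 20 0 = r := by rw [hA'.nat 20 rfl]
    have e32 : υ.nat 32 = rk := hA'.nat 32 rfl
    simp only [State.zeros, State.hits, Finset.sum_range_succ] at h₁ h₂ ⊢
    rw [← h₁, ← add_assoc, ← h₂]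
    by_cases hT : I.nat 4 (I.nat 9 (cell r n)) = 0
    · simp [Prog.run, eLab, e20, hυ, e4, e9, hT, State.IsNt, State.lab]
    · obtain ⟨k, hk⟩ : ∃ k, rk (I.nat 9 (cell r n)) = k := ⟨_, rfl⟩
      obtain ⟨c, hc⟩ : ∃ c, rk (I.nat 5 r) = c := ⟨_, rfl⟩
      rcases eq_or_ne k 0 with rfl | h0
      · rcases eq_or_ne c 0 with rfl | heq
        · simp [Prog.run, eLab, eLhs, e20, hυ, e4, e5, e9, e32, hT, State.IsNt, State.lab,
            State.lhs, hk, hc]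
        · simp [Prog.run, eLab, eLhs, e20, hυ, e4, e5, e9, e32, hT, State.IsNt, State.lab,
            State.lhs, hk, hc, heq.symm]
      · rcases lt_or_ge c k with hlt | hlt
        · simp [Prog.run, eLab, eLhs, e20, hυ, e4, e5, e9, e32, hT, State.IsNt, State.lab,
            State.lhs, hk, hc, h0, hlt]
        · rcases eq_or_ne k c with rfl | heq
          · simp [Prog.run, eLab, eLhs, e20, hυ, e4, e5, e9, e32, hT, State.IsNt, State.lab,
              State.lhs, hk, hc, h0]
          · simp [Prog.run, eLab, eLhs, e20, hυ, e4, e5, e9, e32, hT, State.IsNt, State.lab,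
              State.lhs, hk, hc, h0, hlt.not_gt, heq]
  · simp only [NExpr.cost]
    ring_nf
    omega
  · rintro τ _ ⟨⟨h₁, h₂⟩, -⟩
    rw [State.rankOK_iff, h₁, h₂]

/-- Increases the ranks of labels until the conditions for all rules are satisfied. -/
def rankProg : Prog :=
  .assign 20 (.lit 0) ;; .loop (.lt (.var 20) (.get 0 (.lit 0))) (checkProg ;;
    .cond (.conj (.eq (.var 52) (.lit 0)) (.nle (.lit 2) (.var 54)))
      (.setNat 32 eLhs (.add (.get 32 eLhs) (.lit 1)) ;; .assign 20 (.lit 0))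
      (.assign 20 (.add (.var 20) (.lit 1))))

/-- An increase restarts the scan of the rules, which takes at most `n + 1` units of the potential.
The ranks stay below `ρ` by `State.lt_of_not_rankOK`, so the sum of the ranks of the left-hand sides
is at most `n * n`, which bounds the number of increases. Each unit pays for one check of a rule. -/
theorem wp_rank (I σ : State) (ρ : ℕ → ℕ) (s : ℕ) (hI : I.Inp σ)
    (hρ : ∀ r < I.numRules, I.RankOK ρ r) (hle : ∀ l, ρ l ≤ I.numRules)
    (hs : ∀ r < I.numRules, I.size r ≤ s) (h0 : ∀ l, σ.nat 32 l = 0) :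
    WP rankProg σ (2000 * (s + 1) * (I.numRules + 1) ^ 3) (fun τ =>
      (∀ r < I.numRules, I.RankOK (τ.nat 32) r) ∧ ∀ l, τ.nat 32 l ≤ I.numRules) := by
  set n := I.numRules with hn
  refine ((WP.assign (Q := fun τ => τ = σ.updateNat 20 0 0) rfl).seq
    (T₂ := 1000 * (s + 1) * ((n + 1) * (n * n) + n) + 20) ?_).mono ?_ (fun _ _ h => h)
  · rintro τ hτ rfl
    set τ := σ.updateNat 20 0 0 with hτd
    refine (WP.loop (fun τ => τ.nat 20 0 ≤ n ∧ (∀ l, τ.nat 32 l ≤ ρ l) ∧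
      ∀ r < τ.nat 20 0, I.RankOK (τ.nat 32) r)
      (fun τ => 1000 * (s + 1) * ((n + 1) * (n * n - ∑ r ∈ Finset.range n, τ.nat 32 (I.lhs r)) +
        (n - τ.nat 20 0))) ?_ ?_).mono ?_ ?_
    · rintro υ ⟨h₁, h₂, h₃⟩ hA hlt
      have hA' : Agree rankProg σ υ := hτ.seq_left.trans hA.seq_right
      have hi := hI.agree hA' rfl rfl
      simp only [Test.holds_lt, NExpr.eval, hi.nat 0 (by norm_num)] at hlt
      change υ.nat 20 0 < n at hlt
      set r := υ.nat 20 0 with hr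
      have hE : I.numE r + 1 ≤ s + 1 := by
        have := hs r hlt
        unfold State.size at this
        omega
      refine ⟨500 * (s + 1) + 100, ((wp_check I υ hi).mono
        (Nat.mul_le_mul_left _ hE) (fun _ _ h => h)).seq fun ω aω hω => ?_⟩
      rw [← hr] at hω
      have e20 : ω.nat 20 0 = r := by rw [aω.nat 20 rfl]
      have e32 : ω.nat 32 = υ.nat 32 := aω.nat 32 rfl
      have hi' := hi.agree aω rfl rfl
      refine (WP.of_loopFree rfl ?_).mono (show Prog.cost _ ≤ 100 by decide) (fun _ _ h => h)
      have htest : (Test.conj (.eq (.var 52) (.lit 0)) (.nle (.lit 2) (.var 54))).Holds ω ↔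
          ¬ I.RankOK (υ.nat 32) r := by
        rw [hω]
        simp only [Test.Holds, Test.holds_eq, NExpr.eval]
        omega
      have hcost : (Test.lt (.var 20) (.get 0 (.lit 0))).cost = 7 := rfl
      have hSle : ∑ r ∈ Finset.range n, υ.nat 32 (I.lhs r) ≤ n * n := by
        calc _ ≤ ∑ _r ∈ Finset.range n, n :=
              Finset.sum_le_sum fun _ _ => (h₂ _).trans (hle _)
          _ = _ := by simp
      by_cases hok : I.RankOK (υ.nat 32) r
      · have e : (Prog.cond (.conj (.eq (.var 52) (.lit 0)) (.nle (.lit 2) (.var 54)))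
          (.setNat 32 eLhs (.add (.get 32 eLhs) (.lit 1)) ;; .assign 20 (.lit 0))
          (.assign 20 (.add (.var 20) (.lit 1)))).run ω = ω.updateNat 20 0 (r + 1) := by
          rw [Prog.run, if_neg (by rw [htest]; simpa using hok)]
          simp [Prog.run, e20]
        have e32' : (ω.updateNat 20 0 (r + 1)).nat 32 = υ.nat 32 := by
          rw [State.updateNat_nat_of_ne _ _ _ (by norm_num), e32]
        have e20' : (ω.updateNat 20 0 (r + 1)).nat 20 0 = r + 1 := by simp
        rw [e, e32', e20', hcost]
        refine ⟨⟨hlt, h₂, fun r' hr' => ?_⟩, ?_⟩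
        · rcases Nat.lt_succ_iff_lt_or_eq.1 hr' with h | rfl
          exacts [h₃ r' h, hok]
        · obtain ⟨d, hd⟩ : ∃ d, n - r = d + 1 := ⟨n - r - 1, by omega⟩
          rw [hd, show n - (r + 1) = d by omega]
          ring_nf
          omega
      · have hlt' := State.lt_of_not_rankOK h₂ (hρ r hlt) hok
        set ω' := (ω.updateNat 32 (I.lhs r) (υ.nat 32 (I.lhs r) + 1)).updateNat 20 0 0 with hω'
        have e : (Prog.cond (.conj (.eq (.var 52) (.lit 0)) (.nle (.lit 2) (.var 54)))
          (.setNat 32 eLhs (.add (.get 32 eLhs) (.lit 1)) ;; .assign 20 (.lit 0))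
          (.assign 20 (.add (.var 20) (.lit 1)))).run ω = ω' := by
          rw [Prog.run, if_pos (by rw [htest]; exact hok)]
          simp [Prog.run, e20, eLhs, e32, hi'.nat, State.lhs, hω']
        have e32' : ∀ l, ω'.nat 32 l = if l = I.lhs r then υ.nat 32 (I.lhs r) + 1 else
            υ.nat 32 l := fun l => by simp [hω', e32]
        have e20' : ω'.nat 20 0 = 0 := by simp [hω']
        have hle' : ∀ l, ω'.nat 32 l ≤ ρ l := fun l => by
          rw [e32']
          split_ifs with h
          · rw [h]; exact hlt'
          · exact h₂ l
        have hS : ∑ r ∈ Finset.range n, υ.nat 32 (I.lhs r) + 1 ≤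
            ∑ r ∈ Finset.range n, ω'.nat 32 (I.lhs r) := by
          refine Nat.succ_le_of_lt (Finset.sum_lt_sum (fun r' _ => ?_)
            ⟨r, Finset.mem_range.2 hlt, by simp [e32']⟩)
          rw [e32']
          split_ifs with h
          · rw [h]; omega
          · exact le_rfl
        have hS' : ∑ r ∈ Finset.range n, ω'.nat 32 (I.lhs r) ≤ n * n := by
          calc _ ≤ ∑ _r ∈ Finset.range n, n :=
                Finset.sum_le_sum fun _ _ => (hle' _).trans (hle _)
            _ = _ := by simp
        rw [e, e20', hcost]
        refine ⟨⟨Nat.zero_le _, hle', fun r' hr' => by omega⟩, ?_⟩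
        have hX : (n + 1) * (n * n - ∑ r ∈ Finset.range n, ω'.nat 32 (I.lhs r)) + (n - 0) + 1 ≤
            (n + 1) * (n * n - ∑ r ∈ Finset.range n, υ.nat 32 (I.lhs r)) + (n - r) := by
          calc _ = (n + 1) * (n * n - ∑ r ∈ Finset.range n, ω'.nat 32 (I.lhs r) + 1) := by
                rw [Nat.sub_zero]; ring
            _ ≤ (n + 1) * (n * n - ∑ r ∈ Finset.range n, υ.nat 32 (I.lhs r)) :=
                Nat.mul_le_mul_left _ (by omega)
            _ ≤ _ := Nat.le_add_right _ _
        have := Nat.mul_le_mul_left (1000 * (s + 1)) hX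
        rw [mul_add _ _ 1] at this
        omega
    · have e32 : τ.nat 32 = σ.nat 32 := State.updateNat_nat_of_ne _ _ _ (by norm_num)
      have e20 : τ.nat 20 0 = 0 := by simp [hτd]
      rw [e32, e20]
      exact ⟨Nat.zero_le _, fun l => by simp [h0], fun r hr => by omega⟩
    · have hcost : (Test.lt (.var 20) (.get 0 (.lit 0))).cost = 7 := rfl
      have : 1000 * (s + 1) * ((n + 1) * (n * n - ∑ r ∈ Finset.range n, τ.nat 32 (I.lhs r)) +
        (n - τ.nat 20 0)) ≤ 1000 * (s + 1) * ((n + 1) * (n * n) + n) := by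
        gcongr <;> omega
      rw [hcost]
      omega
    · rintro υ hA ⟨⟨h₁, h₂, h₃⟩, hb, -⟩
      have hA' : Agree rankProg σ υ := hτ.seq_left.trans hA.seq_right
      have hi := hI.agree hA' rfl rfl
      simp only [Test.holds_lt, NExpr.eval, hi.nat 0 (by norm_num), not_lt] at hb
      change n ≤ _ at hb
      exact ⟨fun r hr => h₃ r (by omega), fun l => (h₂ l).trans (hle l)⟩
  · simp only [NExpr.cost]
    have h₁ : (n + 1) * (n * n) + n ≤ (n + 1) ^ 3 := by ring_nf; omega
    have h₂ := Nat.mul_le_mul_left (1000 * (s + 1)) h₁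
    have h₃ : 1 ≤ (s + 1) * (n + 1) ^ 3 := Nat.mul_pos (by omega) (by positivity)
    nlinarith


/-! ### Linear systems with coefficients in `[0, ∞]` -/

/-- `1 + a + a ^ 2 + ⋯`. -/
noncomputable def star (a : ℝ≥0∞) : ℝ≥0∞ := (1 - a)⁻¹

/-- For `a ≥ 1` the truncated difference `1 - a` is 0 and its inverse is ∞, as befits a divergent
geometric series, so the identity needs no restriction on `a`. -/
theorem one_add_mul_star (a : ℝ≥0∞) : 1 + a * star a = star a := by
  unfold star
  rcases lt_or_ge a 1 with h | h
  · have h0 : 1 - a ≠ 0 := (tsub_pos_of_lt h).ne'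
    have h1 : 1 - a ≠ ∞ := (tsub_le_self.trans_lt ENNReal.one_lt_top).ne
    calc 1 + a * (1 - a)⁻¹ = ((1 - a) + a) * (1 - a)⁻¹ := by
          rw [add_mul, ENNReal.mul_inv_cancel h0 h1]
      _ = _ := by rw [tsub_add_cancel_of_le h.le, one_mul]
  · rw [tsub_eq_zero_of_le h, ENNReal.inv_zero,
      ENNReal.mul_top (zero_lt_one.trans_le h).ne', add_top]

/-- For `a < 1` this is division by `1 - a`. For `a ≥ 1` and finite `x` the hypothesis forces `c =
0`, and then the product is 0 even if the star is ∞. -/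
theorem star_mul_le {a c x : ℝ≥0∞} (h : a * x + c ≤ x) : star a * c ≤ x := by
  unfold star
  rcases eq_or_ne x ∞ with rfl | hx
  · exact le_top
  rcases lt_or_ge a 1 with h' | h'
  · have h0 : 1 - a ≠ 0 := (tsub_pos_of_lt h').ne'
    have h1 : 1 - a ≠ ∞ := (tsub_le_self.trans_lt ENNReal.one_lt_top).ne
    rw [mul_comm, ← div_eq_mul_inv]
    refine ENNReal.div_le_of_le_mul ?_
    have hax : a * x ≠ ∞ := ENNReal.mul_ne_top (h'.trans ENNReal.one_lt_top).ne hx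
    rw [ENNReal.mul_sub (fun _ _ => hx), mul_one, mul_comm x]
    exact ENNReal.le_sub_of_add_le_left hax h
  · have hc : c = 0 := by
      have h2 : x + c ≤ x := le_trans (by gcongr; simpa using mul_le_mul_left h' x) h
      by_contra hc
      exact absurd h2 (not_le.2 (ENNReal.lt_add_right hx hc))
    simp [hc]

/-- The matrix and the vector after the elimination of the first `p` variables. -/
noncomputable def elim (A : ℕ → ℕ → ℝ≥0∞) (b : ℕ → ℝ≥0∞) :
    ℕ → (ℕ → ℕ → ℝ≥0∞) × (ℕ → ℝ≥0∞)
  | 0 => (A, b)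
  | p + 1 => (fun i j => (elim A b p).1 i j + (elim A b p).1 i p *
        (star ((elim A b p).1 p p) * (elim A b p).1 p j),
      fun i => (elim A b p).2 i + (elim A b p).1 i p *
        (star ((elim A b p).1 p p) * (elim A b p).2 p))

/-- The right-hand sides after the elimination of the first `p` of `n` variables. -/
noncomputable def elimStep (A : ℕ → ℕ → ℝ≥0∞) (b : ℕ → ℝ≥0∞) (n p : ℕ) (x : ℕ → ℝ≥0∞)
    (i : ℕ) : ℝ≥0∞ :=
  ∑ j ∈ Finset.Ico p n, (elim A b p).1 i j * x j + (elim A b p).2 i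

variable {A : ℕ → ℕ → ℝ≥0∞} {b x : ℕ → ℝ≥0∞} {n p : ℕ}

theorem elimStep_of_lt (hp : p < n) (i : ℕ) : elimStep A b n p x i =
    (elim A b p).1 i p * x p +
      (∑ j ∈ Finset.Ico (p + 1) n, (elim A b p).1 i j * x j + (elim A b p).2 i) := by
  rw [elimStep, Finset.sum_eq_sum_Ico_succ_bot hp, add_assoc]

theorem elimStep_succ (i : ℕ) : elimStep A b n (p + 1) x i =
    (∑ j ∈ Finset.Ico (p + 1) n, (elim A b p).1 i j * x j + (elim A b p).2 i) +
      (elim A b p).1 i p * (star ((elim A b p).1 p p) *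
        (∑ j ∈ Finset.Ico (p + 1) n, (elim A b p).1 p j * x j + (elim A b p).2 p)) := by
  simp only [elimStep, elim, add_mul, Finset.sum_add_distrib, mul_add, Finset.mul_sum, mul_assoc]
  abel

/-- Pre-solutions survive an elimination step: by `star_mul_le`, the expression substituted for the
eliminated variable is at most the value of that variable. -/
theorem elimStep_succ_le (hp : p < n) (h : ∀ i < n, elimStep A b n p x i ≤ x i) :
    ∀ i < n, elimStep A b n (p + 1) x i ≤ x i := by
  intro i hi
  have h₁ := h p hp
  rw [elimStep_of_lt hp] at h₁
  refine le_trans ?_ (h i hi)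
  rw [elimStep_succ, elimStep_of_lt hp, add_comm]
  gcongr
  exact star_mul_le h₁

/-- Solutions can be carried back through an elimination step: by `one_add_mul_star`, row `p` of the
reduced system says that the eliminated variable equals the expression that was substituted for it.
-/
theorem elimStep_eq_of_succ (hp : p < n) (h : ∀ i < n, elimStep A b n (p + 1) x i = x i) :
    ∀ i < n, elimStep A b n p x i = x i := by
  intro i hi
  have h₁ := h p hp
  rw [elimStep_succ, ← mul_assoc, ← one_add_mul, one_add_mul_star] at h₁
  rw [← h i hi, elimStep_succ, elimStep_of_lt hp, h₁, add_comm]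

/-- The vector after the elimination of all variables is a solution. -/
theorem elimStep_elim (A : ℕ → ℕ → ℝ≥0∞) (b : ℕ → ℝ≥0∞) (n : ℕ) : ∀ i < n,
    ∑ j ∈ Finset.range n, A i j * (elim A b n).2 j + b i = (elim A b n).2 i := by
  -- After all eliminations no variable is left on the right-hand sides, so the vector solves the
  -- last system trivially; the eliminations are then undone one at a time.
  suffices H : ∀ q ≤ n, ∀ i < n, elimStep A b n (n - q) (elim A b n).2 i = (elim A b n).2 i by
    intro i hi
    have := H n le_rfl i hi
    rwa [Nat.sub_self, elimStep, ← Finset.range_eq_Ico] at this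
  intro q hq
  induction q with
  | zero => simp [elimStep]
  | succ q ih =>
    refine elimStep_eq_of_succ (by omega) ?_
    rw [show n - (q + 1) + 1 = n - q by omega]
    exact ih (by omega)

/-- The vector after the elimination of all variables is the least solution. -/
theorem elim_le (h : ∀ i < n, ∑ j ∈ Finset.range n, A i j * x j + b i ≤ x i) :
    ∀ i < n, (elim A b n).2 i ≤ x i := by
  suffices H : ∀ q ≤ n, ∀ i < n, elimStep A b n q x i ≤ x i by
    intro i hi
    simpa [elimStep] using H n le_rfl i hi
  intro q hq
  induction q with
  | zero => simpa [elimStep, elim, ← Finset.range_eq_Ico] using h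
  | succ q ih => exact elimStep_succ_le (by omega) (ih (by omega))

/-- Pivots and updated rows have indices below `n`, so nothing is needed about other rows; the
matrix in memory is known only in rows that belong to keys. -/
theorem elim_congr {A' : ℕ → ℕ → ℝ≥0∞} {b' : ℕ → ℝ≥0∞} (hA : ∀ i < n, ∀ j, A i j = A' i j)
    (hb : ∀ i < n, b i = b' i) : ∀ i < n, (elim A b n).2 i = (elim A' b' n).2 i := by
  suffices H : ∀ q ≤ n, ∀ i < n, (∀ j, (elim A b q).1 i j = (elim A' b' q).1 i j) ∧
      (elim A b q).2 i = (elim A' b' q).2 i from fun i hi => (H n le_rfl i hi).2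
  intro q hq
  induction q with
  | zero => exact fun i hi => ⟨hA i hi, hb i hi⟩
  | succ q ih =>
    intro i hi
    have h₁ := ih (by omega) i hi
    have h₂ := ih (by omega) q (by omega)
    simp only [elim, h₁.1, h₁.2, h₂.1, h₂.2, implies_true, and_self]

/-! Arrays of natural numbers: `36` position of the first key of the current level, `55` pivot,
`56` row, `57` column. Elements of `[0, ∞]`: `5` star of the pivot, `6` entry of the vector, `7` row
of the pivot, `8` entry in the column of the pivot. -/

/-- A key of the current level. -/
def eKey (e : NExpr) : NExpr := .get 34 (.add (.var 36) e)

/-- The entry of the matrix at two keys of the current level. -/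
def eEntry (i j : NExpr) : NExpr := .cell (eKey i) (.add (eKey j) (.lit 1))

/-- The number of keys of the current level. -/
def eNum : NExpr := .sub (.var 35) (.var 36)

/-- Updates one row. -/
def rowProg : Prog :=
  (.assignVal 8 (.get 3 (eEntry (.var 56) (.var 55))) ;;
    .setVal 2 (eKey (.var 56)) (.add (.get 2 (eKey (.var 56))) (.mul (.var 8) (.var 6)))) ;;
  .forTo 57 eNum (.setVal 3 (eEntry (.var 56) (.var 57))
    (.add (.get 3 (eEntry (.var 56) (.var 57))) (.mul (.var 8) (.get 7 (.var 57)))))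

/-- Eliminates one variable. -/
def pivotProg : Prog :=
  (.assignVal 5 (.inv (.sub .one (.get 3 (eEntry (.var 55) (.var 55))))) ;;
    .assignVal 6 (.mul (.var 5) (.get 2 (eKey (.var 55))))) ;;
  .forTo 57 eNum (.setVal 7 (.var 57) (.mul (.var 5) (.get 3 (eEntry (.var 55) (.var 57))))) ;;
  .forTo 56 eNum rowProg

/-- Solves the linear system of the current level. -/
def elimProg : Prog := .forTo 55 eNum pivotProg

namespace State

/-- The `i`-th key of the current level. -/
def key (σ : State) (i : ℕ) : ℕ := σ.nat 34 (σ.nat 36 0 + i)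

/-- The number of keys of the current level. -/
def numKeys (σ : State) : ℕ := σ.nat 35 0 - σ.nat 36 0

/-- The matrix of the current level. -/
noncomputable def mat (σ : State) (κ : ℕ → ℕ) (i j : ℕ) : ℝ≥0∞ := σ.val 3 (cell (κ i) (κ j + 1))

/-- The keys of `τ` are `κ 0, …, κ (n - 1)`. -/
structure IsKeys (τ : State) (κ : ℕ → ℕ) (n : ℕ) : Prop where
  key : τ.key = κ
  num : τ.numKeys = n

theorem IsKeys.agree {σ τ : State} {κ : ℕ → ℕ} {n : ℕ} (h : σ.IsKeys κ n) {p : Prog}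
    (hA : Agree p σ τ) (h34 : p.writesNat 34 = false) (h35 : p.writesNat 35 = false)
    (h36 : p.writesNat 36 = false) : τ.IsKeys κ n := by
  obtain ⟨h₁, h₂⟩ := h
  refine ⟨?_, ?_⟩
  · rw [← h₁]; funext i; simp only [State.key, hA.nat 34 h34, hA.nat 36 h36]
  · rw [← h₂]; simp only [State.numKeys, hA.nat 35 h35, hA.nat 36 h36]

theorem IsKeys.eval_eKey {τ : State} {κ : ℕ → ℕ} {n : ℕ} (h : τ.IsKeys κ n) (e : NExpr) :
    (eKey e).eval τ = κ (e.eval τ) := by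
  rw [← h.key]; rfl

theorem IsKeys.eval_eEntry {τ : State} {κ : ℕ → ℕ} {n : ℕ} (h : τ.IsKeys κ n) (e e' : NExpr) :
    (eEntry e e').eval τ = cell (κ (e.eval τ)) (κ (e'.eval τ) + 1) := by
  simp only [eEntry, NExpr.eval_cell, h.eval_eKey, NExpr.eval]

theorem IsKeys.eval_eNum {τ : State} {κ : ℕ → ℕ} {n : ℕ} (h : τ.IsKeys κ n) :
    eNum.eval τ = n := by
  rw [← h.num]; rfl

end State

/-- The entry in the pivot column is copied to `8`, and the scaled pivot row is kept in array `7`.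
Hence the row can be overwritten in place, even if it is the pivot row itself. Injectivity of `κ`
keeps distinct columns apart. -/
theorem wp_row (σ : State) (κ : ℕ → ℕ) (n : ℕ) (h : σ.IsKeys κ n)
    (hκ : ∀ i < n, ∀ j < n, κ i = κ j → i = j) :
    WP rowProg σ (300 * (n + 1)) (fun τ =>
      (∀ y, τ.val 2 y = σ.val 2 y + if y = κ (σ.nat 56 0) then
        σ.mat κ (σ.nat 56 0) (σ.nat 55 0) * σ.val 6 0 else 0) ∧
      (∀ j < n, τ.mat κ (σ.nat 56 0) j = σ.mat κ (σ.nat 56 0) j +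
        σ.mat κ (σ.nat 56 0) (σ.nat 55 0) * σ.val 7 j) ∧
      ∀ k y, k ≠ κ (σ.nat 56 0) → τ.val 3 (cell k y) = σ.val 3 (cell k y)) := by
  set p := σ.nat 55 0 with hpd
  set i := σ.nat 56 0 with hid
  set a := σ.mat κ i p with ha
  refine (((WP.of_loopFree (p := .assignVal 8 (.get 3 (eEntry (.var 56) (.var 55))) ;;
    .setVal 2 (eKey (.var 56)) (.add (.get 2 (eKey (.var 56))) (.mul (.var 8) (.var 6)))) rfl
    (Q := fun τ => τ.val 8 0 = a ∧
    ∀ y, τ.val 2 y = σ.val 2 y + if y = κ i then a * σ.val 6 0 else 0) ?_).mono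
    (show Prog.cost _ ≤ 100 by decide) (fun _ _ h => h)).seq fun τ hτ q =>
    (WP.forTo_const (fun m υ => (∀ j < n, υ.mat κ i j = σ.mat κ i j +
      if j < m then a * σ.val 7 j else 0) ∧
      ∀ k y, k ≠ κ i → υ.val 3 (cell k y) = σ.val 3 (cell k y)) n 100 rfl ?_ ?_ ?_).mono
      le_rfl (Q' := fun υ => (∀ y, υ.val 2 y = σ.val 2 y + if y = κ i then a * σ.val 6 0 else 0) ∧
        (∀ j < n, υ.mat κ i j = σ.mat κ i j + a * σ.val 7 j) ∧
        ∀ k y, k ≠ κ i → υ.val 3 (cell k y) = σ.val 3 (cell k y)) ?_).mono ?_ (fun _ _ h => h)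
  · have e₁ : (eEntry (.var 56) (.var 55)).eval σ = cell (κ i) (κ p + 1) := h.eval_eEntry _ _
    have h' : (σ.updateVal 8 0 a).IsKeys κ n := ⟨h.key, h.num⟩
    have e₂ : (eKey (.var 56)).eval (σ.updateVal 8 0 a) = κ i := h'.eval_eKey _
    have e₃ : σ.val 3 (cell (κ i) (κ p + 1)) = a := rfl
    simp only [Prog.run, NExpr.eval, VExpr.eval, e₁, e₃, e₂]
    refine ⟨by simp, fun y => ?_⟩
    by_cases hy : y = κ i
    · simp [hy]
    · simp [hy]
  · have e : τ.val 3 = σ.val 3 := hτ.val 3 rfl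
    simp [State.mat, e]
  · intro m υ _ hA
    exact (h.agree (p := rowProg) (hτ.seq_left.trans hA.seq_right) rfl rfl rfl).eval_eNum
  · rintro m υ hm ⟨h₁, h₂⟩ h57 hA
    have hA' : Agree rowProg σ υ := hτ.seq_left.trans hA.seq_right
    have hk := h.agree hA' rfl rfl rfl
    refine (WP.of_loopFree rfl ?_).mono (show Prog.cost _ ≤ 100 by decide) (fun _ _ h => h)
    have e56 : υ.nat 56 0 = i := congrFun (hA'.nat 56 rfl) 0
    have e8 : υ.val 8 0 = a := by rw [hA.val 8 rfl, q.1]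
    have e7 : υ.val 7 = σ.val 7 := hA'.val 7 rfl
    have e3 : υ.val 3 (cell (κ i) (κ m + 1)) = σ.mat κ i m := by simpa [State.mat] using h₁ m hm
    simp only [Prog.run, hk.eval_eEntry, e56, VExpr.eval, NExpr.eval, e8, e7, h57, e3]
    constructor
    · intro j hj
      have hc : cell (κ i) (κ j + 1) = cell (κ i) (κ m + 1) ↔ j = m :=
        ⟨fun h => hκ j hj m hm (by have := (cell_inj h).2; omega), fun h => by rw [h]⟩
      by_cases hjm : j = m
      · simp [State.mat, hjm]
      · have h₁ := h₁ j hj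
        simp only [State.mat] at h₁ ⊢
        simp only [State.updateNat_val, State.updateVal_val, hc, hjm, and_false, if_false, h₁]
        simp only [show j < m + 1 ↔ j < m by omega]
    · intro k y hk
      have hc : cell k y ≠ cell (κ i) (κ m + 1) := fun h => hk (cell_inj h).1
      simp [hc, h₂ k y hk]
  · rintro υ hυ ⟨⟨h₁, h₂⟩, -⟩
    refine ⟨fun y => by rw [hυ.val 2 rfl, q.2], fun j hj => by rw [h₁ j hj, if_pos hj], h₂⟩
  · simp only [eNum, NExpr.cost]
    ring_nf
    omega

theorem wp_pivot (σ : State) (κ : ℕ → ℕ) (n : ℕ) (h : σ.IsKeys κ n)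
    (hκ : ∀ i < n, ∀ j < n, κ i = κ j → i = j) (hp : σ.nat 55 0 < n) :
    WP pivotProg σ (1000 * (n + 1) ^ 2) (fun τ =>
      (∀ i < n, τ.val 2 (κ i) = σ.val 2 (κ i) + σ.mat κ i (σ.nat 55 0) *
        (star (σ.mat κ (σ.nat 55 0) (σ.nat 55 0)) * σ.val 2 (κ (σ.nat 55 0)))) ∧
      (∀ i < n, ∀ j < n, τ.mat κ i j = σ.mat κ i j + σ.mat κ i (σ.nat 55 0) *
        (star (σ.mat κ (σ.nat 55 0) (σ.nat 55 0)) * σ.mat κ (σ.nat 55 0) j)) ∧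
      (∀ y, (∀ i < n, y ≠ κ i) → τ.val 2 y = σ.val 2 y) ∧
      ∀ k y, (∀ i < n, k ≠ κ i) → τ.val 3 (cell k y) = σ.val 3 (cell k y)) := by
  set p := σ.nat 55 0 with hpd
  set s := star (σ.mat κ p p) with hs
  refine (((WP.of_loopFree (p := .assignVal 5
    (.inv (.sub .one (.get 3 (eEntry (.var 55) (.var 55))))) ;;
    .assignVal 6 (.mul (.var 5) (.get 2 (eKey (.var 55))))) rfl
    (Q := fun τ => τ.val 5 0 = s ∧ τ.val 6 0 = s * σ.val 2 (κ p)) ?_).mono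
    (show Prog.cost _ ≤ 100 by decide) (fun _ _ h => h)).seq fun τ hτ q =>
    ((WP.forTo_const (fun m υ => ∀ j < m, υ.val 7 j = s * σ.mat κ p j) n 100 rfl
      ?_ ?_ ?_).seq fun υ hυ q' =>
    WP.forTo_const (fun m ω =>
      (∀ i < n, ω.val 2 (κ i) = σ.val 2 (κ i) +
        if i < m then σ.mat κ i p * (s * σ.val 2 (κ p)) else 0) ∧
      (∀ i < n, ∀ j < n, ω.mat κ i j = σ.mat κ i j +
        if i < m then σ.mat κ i p * (s * σ.mat κ p j) else 0) ∧
      (∀ y, (∀ i < n, y ≠ κ i) → ω.val 2 y = σ.val 2 y) ∧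
      ∀ k y, (∀ i < n, k ≠ κ i) → ω.val 3 (cell k y) = σ.val 3 (cell k y))
      n (300 * (n + 1)) rfl ?_ ?_ ?_)).mono ?_ ?_
  · have e₁ : (eEntry (.var 55) (.var 55)).eval σ = cell (κ p) (κ p + 1) := h.eval_eEntry _ _
    have h' : (σ.updateVal 5 0 s).IsKeys κ n := ⟨h.key, h.num⟩
    have e₂ : (eKey (.var 55)).eval (σ.updateVal 5 0 s) = κ p := h'.eval_eKey _
    have e₃ : (1 - σ.val 3 (cell (κ p) (κ p + 1)))⁻¹ = s := rfl
    simp only [Prog.run, NExpr.eval, VExpr.eval, e₁, e₃, e₂]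
    simp
  · simp
  · intro m υ _ hA
    exact (h.agree (p := pivotProg) (hτ.seq_left.trans hA.seq_left.seq_right)
      rfl rfl rfl).eval_eNum
  · rintro m υ hm h₁ h57 hA
    have hA' : Agree pivotProg σ υ := hτ.seq_left.trans hA.seq_left.seq_right
    have hk := h.agree hA' rfl rfl rfl
    refine (WP.of_loopFree rfl ?_).mono (show Prog.cost _ ≤ 100 by decide) (fun _ _ h => h)
    have e55 : υ.nat 55 0 = p := congrFun (hA'.nat 55 rfl) 0
    have e5 : υ.val 5 0 = s := by rw [hA.val 5 rfl, q.1]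
    have e3 : υ.val 3 = σ.val 3 := (hA.val 3 rfl).trans (hτ.val 3 rfl)
    have e3' : σ.val 3 (cell (κ p) (κ m + 1)) = σ.mat κ p m := rfl
    simp only [Prog.run, hk.eval_eEntry, e55, VExpr.eval, NExpr.eval, e5, h57, e3, e3']
    intro j hj
    rcases Nat.lt_succ_iff_lt_or_eq.1 hj with hj | rfl
    · simp [hj.ne, h₁ j hj]
    · simp
  · have e2 : υ.val 2 = σ.val 2 := (hυ.val 2 rfl).trans (hτ.val 2 rfl)
    have e3 : υ.val 3 = σ.val 3 := (hυ.val 3 rfl).trans (hτ.val 3 rfl)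
    simp [State.mat, e2, e3]
  · intro m ω _ hA
    exact (h.agree (p := pivotProg) (hτ.seq_left.trans (hυ.seq_left.trans hA.seq_right).seq_right)
      rfl rfl rfl).eval_eNum
  · rintro m ω hm ⟨h₁, h₂, h₃, h₄⟩ h56 hA
    have hA' : Agree pivotProg σ ω := hτ.seq_left.trans (hυ.seq_left.trans hA.seq_right).seq_right
    have hk := h.agree hA' rfl rfl rfl
    have e55 : ω.nat 55 0 = p := congrFun (hA'.nat 55 rfl) 0
    have e6 : ω.val 6 0 = s * σ.val 2 (κ p) := by rw [hA.val 6 rfl, hυ.val 6 rfl, q.2]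
    have e7 : ∀ j < n, ω.val 7 j = s * σ.mat κ p j := fun j hj => by rw [hA.val 7 rfl, q'.1 j hj]
    -- Rows are updated in increasing order, so row `m` still has its old entries.
    have em : ω.mat κ m p = σ.mat κ m p := by rw [h₂ m hm p hp]; simp
    refine (wp_row ω κ n hk hκ).mono le_rfl ?_
    rw [e55, h56, e6, em]
    rintro τ' _ ⟨g₁, g₂, g₃⟩
    refine ⟨fun i hi => ?_, fun i hi j hj => ?_, fun y hy => ?_, fun k y hy => ?_⟩
    · rw [State.updateNat_val, g₁, h₁ i hi]
      by_cases him : i = m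
      · simp [him]
      · rw [if_neg fun h => him (hκ i hi m hm h), add_zero]
        simp only [show i < m + 1 ↔ i < m by omega]
    · change τ'.mat κ i j = _
      by_cases him : i = m
      · rw [him, g₂ j hj, h₂ m hm j hj, e7 j hj]
        simp
      · simp only [show i < m + 1 ↔ i < m by omega]
        rw [← h₂ i hi j hj]
        exact g₃ _ _ fun h => him (hκ i hi m hm h)
    · rw [State.updateNat_val, g₁, if_neg (hy m hm), add_zero, h₃ y hy]
    · rw [State.updateNat_val, g₃ _ _ (hy m hm), h₄ k y hy]
  · simp only [eNum, NExpr.cost]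
    ring_nf
    omega
  · rintro ω _ ⟨⟨h₁, h₂, h₃, h₄⟩, -⟩
    exact ⟨fun i hi => by rw [h₁ i hi, if_pos hi], fun i hi j hj => by rw [h₂ i hi j hj, if_pos hi],
      h₃, h₄⟩

theorem wp_elim (σ : State) (κ : ℕ → ℕ) (n : ℕ) (h : σ.IsKeys κ n)
    (hκ : ∀ i < n, ∀ j < n, κ i = κ j → i = j) :
    WP elimProg σ (1100 * (n + 1) ^ 3) (fun τ =>
      (∀ i < n, τ.val 2 (κ i) = (elim (σ.mat κ) (fun i => σ.val 2 (κ i)) n).2 i) ∧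
      (∀ y, (∀ i < n, y ≠ κ i) → τ.val 2 y = σ.val 2 y) ∧
      ∀ k y, (∀ i < n, k ≠ κ i) → τ.val 3 (cell k y) = σ.val 3 (cell k y)) := by
  set A := σ.mat κ with hA
  set b := fun i => σ.val 2 (κ i) with hb
  refine (WP.forTo_const (fun p τ => (∀ i < n, τ.val 2 (κ i) = (elim A b p).2 i) ∧
      (∀ i < n, ∀ j < n, τ.mat κ i j = (elim A b p).1 i j) ∧
      (∀ y, (∀ i < n, y ≠ κ i) → τ.val 2 y = σ.val 2 y) ∧
      ∀ k y, (∀ i < n, k ≠ κ i) → τ.val 3 (cell k y) = σ.val 3 (cell k y)) n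
      (1000 * (n + 1) ^ 2) rfl ?_ ?_ ?_).mono ?_ ?_
  · exact ⟨fun _ _ => rfl, fun _ _ _ _ => rfl, fun _ _ => rfl, fun _ _ _ => rfl⟩
  · intro m υ _ hA
    exact (h.agree (p := elimProg) hA rfl rfl rfl).eval_eNum
  · rintro p υ hp ⟨h₁, h₂, h₃, h₄⟩ h55 hA
    have hk := h.agree (p := elimProg) hA rfl rfl rfl
    refine (wp_pivot υ κ n hk hκ (by rwa [h55])).mono le_rfl ?_
    rw [h55]
    rintro τ _ ⟨g₁, g₂, g₃, g₄⟩
    refine ⟨fun i hi => ?_, fun i hi j hj => ?_, fun y hy => ?_, fun k y hy => ?_⟩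
    · rw [State.updateNat_val, g₁ i hi, h₁ i hi, h₁ p hp, h₂ i hi p hp, h₂ p hp p hp]
      rfl
    · change τ.mat κ i j = _
      rw [g₂ i hi j hj, h₂ i hi j hj, h₂ p hp j hj, h₂ i hi p hp, h₂ p hp p hp]
      rfl
    · rw [State.updateNat_val, g₃ y hy, h₃ y hy]
    · rw [State.updateNat_val, g₄ k y hy, h₄ k y hy]
  · simp only [eNum, NExpr.cost]
    ring_nf
    omega
  · rintro ω _ ⟨⟨h₁, h₂, h₃, h₄⟩, -⟩
    exact ⟨h₁, h₃, h₄⟩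


/-! ### The linear equations of one level -/

namespace State

variable {I : State} {rk : ℕ → ℕ} {c r n l t y : ℕ} {x X b w : ℕ → ℝ≥0∞} {d κ : ℕ → ℕ}

/-- The labels of rank `0` have no derivations. -/
theorem lfpK_eq_zero_of_rank (hok : ∀ r < I.numRules, I.RankOK rk r) (hl : rk l = 0) (t : ℕ) :
    I.lfpK (cell l t) = 0 := by
  classical
  have : I.lfpK ≤ fun k => if ∃ l t, k = cell l t ∧ rk l = 0 then 0 else ⊤ := by
    refine I.lfpK_le fun k => ?_
    by_cases hk : ∃ l t, k = cell l t ∧ rk l = 0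
    · simp only [if_pos hk, nonpos_iff_eq_zero]
      obtain ⟨l, t, rfl, hl⟩ := hk
      refine Finset.sum_eq_zero fun r hr => Finset.sum_eq_zero fun i _ => ?_
      rw [Finset.mem_range] at hr
      split_ifs with he
      · have hlr : I.lhs r = l := (cell_inj he).1
        rcases hok r hr with ⟨e, he, ht, h0⟩ | ⟨h₁, -⟩
        · refine Finset.prod_eq_zero (Finset.mem_range.2 he) ?_
          unfold edgeVal
          rw [if_pos ht]
          exact if_pos ⟨_, _, rfl, h0⟩
        · rw [hlr] at h₁
          omega
      · rfl
    · simp only [if_neg hk]; exact le_top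
  have h' := this (cell l t)
  simp only at h'
  rw [if_pos ⟨l, t, rfl, hl⟩] at h'
  exact nonpos_iff_eq_zero.1 h'

theorem exists_of_selKey_ne_zero (h : I.selKey rk c r d n ≠ 0) :
    ∃ e < n, I.Sel rk c r e ∧ I.selKey rk c r d n = I.edgeKey r d e + 1 := by
  classical
  induction n with
  | zero => exact absurd rfl h
  | succ n ih =>
    by_cases hs : I.Sel rk c r n
    · exact ⟨n, by omega, hs, by simp [selKey, hs]⟩
    · have e : I.selKey rk c r d (n + 1) = I.selKey rk c r d n := by simp [selKey, hs]
      rw [e] at h ⊢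
      obtain ⟨e, he, h'⟩ := ih h
      exact ⟨e, by omega, h'⟩

/-- Here `x` is the content of the memory and `X` a candidate for the true values; they agree at
lower ranks. At most one edge has rank `c`, so the product is linear in the values of `X` at rank
`c`. -/
theorem prod_edgeVal_eq (hX : ∀ l t, rk l < c → X (cell l t) = x (cell l t))
    (hle : ∀ e < n, I.IsNt (I.lab r e) → rk (I.lab r e) ≤ c)
    (hu : ∀ e < n, ∀ e' < n, I.Sel rk c r e → I.Sel rk c r e' → e = e') :
    ∏ e ∈ Finset.range n, I.edgeVal X r d e = I.openVal x rk c r d n *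
      (if I.selKey rk c r d n = 0 then 1 else X (I.selKey rk c r d n - 1)) := by
  classical
  induction n with
  | zero => simp [openVal, selKey]
  | succ n ih =>
    rw [Finset.prod_range_succ]
    by_cases hs : I.Sel rk c r n
    · have h0 : I.selKey rk c r d n = 0 := by
        by_contra h0
        obtain ⟨e, he, hse, -⟩ := exists_of_selKey_ne_zero h0
        have := hu e (by omega) n (by omega) hse hs
        omega
      rw [ih (fun e he => hle e (by omega)) (fun e he e' he' => hu e (by omega) e' (by omega)),
        if_pos h0]
      have e₁ : I.edgeVal X r d n = X (I.edgeKey r d n) := if_pos hs.1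
      simp [openVal, Finset.prod_range_succ, selKey, hs, e₁]
    · rw [ih (fun e he => hle e (by omega)) (fun e he e' he' => hu e (by omega) e' (by omega))]
      have e₁ : I.selKey rk c r d (n + 1) = I.selKey rk c r d n := by simp [selKey, hs]
      have e₂ : I.edgeVal X r d n = I.edgeVal x r d n := by
        unfold edgeVal
        split_ifs with ht
        · exact hX _ _ (lt_of_le_of_ne (hle n (by omega) ht) fun h => hs ⟨ht, h⟩)
        · rfl
      rw [e₁, e₂, openVal, openVal, Finset.prod_range_succ, if_neg hs]
      ring

/-- If the rule contains a nonterminal of rank 0, both sides have a factor 0. That edge is not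
selected since `c` is positive, so the factor is present on the right too. -/
theorem ruleVal_eq_openVal (hok : I.RankOK rk r) (hr : rk (I.lhs r) = c) (hc : 1 ≤ c)
    (hx : ∀ l t, rk l = 0 → x (cell l t) = 0)
    (hX : ∀ l t, rk l < c → X (cell l t) = x (cell l t)) :
    I.ruleVal X r d = I.openVal x rk c r d (I.numE r) * (if I.selKey rk c r d (I.numE r) = 0 then 1
      else X (I.selKey rk c r d (I.numE r) - 1)) := by
  rcases hok with ⟨e, he, ht, h0⟩ | ⟨-, h₂, h₃⟩
  · have e₁ : I.ruleVal X r d = 0 := by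
      refine Finset.prod_eq_zero (Finset.mem_range.2 he) ?_
      unfold edgeVal
      rw [if_pos ht]
      exact (hX _ _ (by omega)).trans (hx _ _ h0)
    have e₂ : I.openVal x rk c r d (I.numE r) = 0 := by
      refine Finset.prod_eq_zero (Finset.mem_range.2 he) ?_
      rw [if_neg (fun h => by have := h.2; omega)]
      unfold edgeVal
      rw [if_pos ht]
      exact hx _ _ h0
    rw [e₁, e₂, zero_mul]
  · exact prod_edgeVal_eq hX (fun e he ht => by rw [← hr]; exact h₂ e he ht)
      (fun e he e' he' hs hs' => h₃ e he e' he' hs.1 hs'.1 (by rw [hs.2, hr]) (by rw [hs'.2, hr]))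

/-- Rules of the same level do not disturb each other: their contributions change entries of rank
`c` only, and nonterminal edges of that rank are left out of the product. -/
theorem openVal_congr_of_rank (hX : ∀ l t, rk l ≠ c → X (cell l t) = x (cell l t)) :
    I.openVal X rk c r d n = I.openVal x rk c r d n := by
  refine Finset.prod_congr rfl fun e _ => ?_
  split_ifs with hs
  · rfl
  · unfold edgeVal
    split_ifs with ht
    · exact hX _ _ fun h => hs ⟨ht, h⟩
    · rfl

theorem addVec_congr (hX : ∀ l t, rk l ≠ c → X (cell l t) = x (cell l t)) :
    I.addVec X rk c r n = I.addVec x rk c r n := by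
  funext y
  simp only [addVec, openVal_congr_of_rank hX]

theorem addMat_congr (hX : ∀ l t, rk l ≠ c → X (cell l t) = x (cell l t)) :
    I.addMat X rk c r n = I.addMat x rk c r n := by
  funext y
  simp only [addMat, openVal_congr_of_rank hX]

theorem addMat_eq_zero (h : l ≠ I.lhs r) (x : ℕ → ℝ≥0∞) (rk : ℕ → ℕ) (c n t y : ℕ) :
    I.addMat x rk c r n (cell (cell l t) y) = 0 := by
  refine Finset.sum_eq_zero fun i _ => if_neg fun h' => h ?_
  exact (cell_inj (cell_inj h'.1).1).1.symm

variable (I x rk c) in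
/-- The contribution of the first `n` rules to the entry `y` of the vector of level `c`. -/
noncomputable def levelVec (n y : ℕ) : ℝ≥0∞ :=
  ∑ r ∈ Finset.range n, if rk (I.lhs r) = c then I.addVec x rk c r (I.numAsg r) y else 0

variable (I x rk c) in
/-- The contribution of the first `n` rules to the entry `y` of the matrix of level `c`. -/
noncomputable def levelMat (n y : ℕ) : ℝ≥0∞ :=
  ∑ r ∈ Finset.range n, if rk (I.lhs r) = c then I.addMat x rk c r (I.numAsg r) y else 0

theorem levelVec_eq_zero (h : rk l ≠ c) : I.levelVec rk c x n (cell l t) = 0 := by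
  refine Finset.sum_eq_zero fun r _ => ?_
  split_ifs with hr
  · exact addVec_eq_zero _ _ _ _ _ (fun h' => h (by rw [h', hr])) _
  · rfl

theorem levelMat_eq_zero (h : rk l ≠ c) : I.levelMat rk c x n (cell (cell l t) y) = 0 := by
  refine Finset.sum_eq_zero fun r _ => ?_
  split_ifs with hr
  · exact addMat_eq_zero (fun h' => h (by rw [h', hr])) _ _ _ _ _ _
  · rfl

variable (I rk c) in
/-- The key `y` belongs to an assignment of one of the first `n` rules, of level `c`. -/
def Listed (n y : ℕ) : Prop :=
  ∃ r < n, rk (I.lhs r) = c ∧ ∃ i < I.numAsg r, y = I.extKey r (I.asg r i)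

theorem Listed.exists_cell (h : I.Listed rk c n y) : ∃ l t, y = cell l t ∧ rk l = c := by
  obtain ⟨r, -, hr, i, -, rfl⟩ := h
  exact ⟨_, _, rfl, hr⟩

theorem levelVec_of_not_listed (h : ¬ I.Listed rk c n y) : I.levelVec rk c x n y = 0 := by
  refine Finset.sum_eq_zero fun r hr => ?_
  split_ifs with hc
  · refine Finset.sum_eq_zero fun i hi => if_neg fun h' => h ?_
    exact ⟨r, Finset.mem_range.1 hr, hc, i, Finset.mem_range.1 hi, h'.1.symm⟩
  · rfl

theorem stepK_of_not_listed (hl : rk l = c) (h : ¬ I.Listed rk c I.numRules (cell l t)) :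
    I.stepK X (cell l t) = 0 := by
  refine Finset.sum_eq_zero fun r hr => Finset.sum_eq_zero fun i hi => if_neg fun h' => h ?_
  exact ⟨r, Finset.mem_range.1 hr, (cell_inj h').1 ▸ hl, i, Finset.mem_range.1 hi, h'.symm⟩

/-- The equations of a level are linear. -/
theorem stepK_eq_level (hok : ∀ r < I.numRules, I.RankOK rk r) (hc : 1 ≤ c)
    (hx : ∀ l t, rk l = 0 → x (cell l t) = 0)
    (hX : ∀ l t, rk l < c → X (cell l t) = x (cell l t))
    (hX' : ∀ l t, rk l = c → (∀ j < n, κ j ≠ cell l t) → X (cell l t) = 0)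
    (hκ : ∀ i < n, ∀ j < n, κ i = κ j → i = j) (hl : rk l = c) :
    I.stepK X (cell l t) = ∑ j ∈ Finset.range n,
      I.levelMat rk c x I.numRules (cell (cell l t) (κ j + 1)) * X (κ j) +
        I.levelVec rk c x I.numRules (cell l t) := by
  simp only [levelMat, levelVec, Finset.sum_mul]
  rw [Finset.sum_comm, ← Finset.sum_add_distrib]
  refine Finset.sum_congr rfl fun r hr => ?_
  rw [Finset.mem_range] at hr
  by_cases hrc : rk (I.lhs r) = c
  · simp only [if_pos hrc, addMat, addVec, Finset.sum_mul]
    rw [Finset.sum_comm, ← Finset.sum_add_distrib]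
    refine Finset.sum_congr rfl fun i _ => ?_
    by_cases he : I.extKey r (I.asg r i) = cell l t
    · rw [if_pos he, ruleVal_eq_openVal (hok r hr) hrc hc hx hX, he]
      by_cases hs : I.selKey rk c r (I.asg r i) (I.numE r) = 0
      · simp [hs]
      · obtain ⟨e, -, hse, hk⟩ := exists_of_selKey_ne_zero hs
        rw [hk]
        set k := I.edgeKey r (I.asg r i) e with hkd
        set v := I.openVal x rk c r (I.asg r i) (I.numE r)
        have hcell : ∀ j, cell (cell l t) (k + 1) = cell (cell l t) (κ j + 1) ↔ κ j = k :=
          fun j => ⟨fun h => by have := (cell_inj h).2; omega, fun h => by rw [h]⟩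
        simp only [hcell, Nat.add_eq_zero_iff, one_ne_zero, and_false, if_false, ne_eq,
          not_false_eq_true, and_true, add_zero, Nat.add_sub_cancel]
        -- A key that no assignment produces has no column in the matrix; its value is 0 by `hX'`,
        -- so omitting the column is harmless.
        by_cases hj : ∃ j < n, κ j = k
        · obtain ⟨j, hj, hjk⟩ := hj
          rw [Finset.sum_eq_single j]
          · rw [if_pos hjk, hjk]
          · intro j' hj' hne
            rw [if_neg, zero_mul]
            exact fun h => hne (hκ j' (Finset.mem_range.1 hj') j hj (h.trans hjk.symm))
          · intro h
            exact absurd (Finset.mem_range.2 hj) h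
        · push Not at hj
          have h0 : X k = 0 := hX' _ _ hse.2 hj
          rw [h0, mul_zero]
          symm
          refine Finset.sum_eq_zero fun j hj' => ?_
          rw [if_neg (hj j (Finset.mem_range.1 hj')), zero_mul]
    · rw [if_neg he, if_neg fun h => he h.1, add_zero]
      symm
      refine Finset.sum_eq_zero fun j _ => ?_
      rw [if_neg fun h => he (cell_inj h.1).1, zero_mul]
  · simp only [if_neg hrc, zero_mul, Finset.sum_const_zero, add_zero]
    refine Finset.sum_eq_zero fun i _ => if_neg fun h => hrc ?_
    rw [← hl, ← (cell_inj h).1]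

/-- The solution of the linear system of a level. -/
theorem elim_eq_lfpK (hok : ∀ r < I.numRules, I.RankOK rk r) (hc : 1 ≤ c)
    (hx : ∀ l t, rk l < c → x (cell l t) = I.lfpK (cell l t))
    (hκ : ∀ i < n, ∀ j < n, κ i = κ j → i = j)
    (hlist : ∀ y, I.Listed rk c I.numRules y ↔ ∃ i < n, y = κ i) :
    ∀ i < n, (elim (fun i j => I.levelMat rk c x I.numRules (cell (κ i) (κ j + 1)))
      (fun i => I.levelVec rk c x I.numRules (κ i)) n).2 i = I.lfpK (κ i) := by
  classical
  set A := fun i j => I.levelMat rk c x I.numRules (cell (κ i) (κ j + 1))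
  set b := fun i => I.levelVec rk c x I.numRules (κ i)
  have hx0 : ∀ l t, rk l = 0 → x (cell l t) = 0 := fun l t h => by
    rw [hx l t (by omega), lfpK_eq_zero_of_rank hok h]
  have hcell : ∀ i < n, ∃ l t, κ i = cell l t ∧ rk l = c := fun i hi =>
    ((hlist _).2 ⟨i, hi, rfl⟩).exists_cell
  intro i hi
  -- The true values satisfy the linear system, so its least solution lies below them.
  refine le_antisymm (elim_le (x := fun i => I.lfpK (κ i)) (fun i hi => ?_) i hi) ?_
  · obtain ⟨l, t, hlt, hl⟩ := hcell i hi
    have := stepK_eq_level (X := I.lfpK) (κ := κ) (n := n) (t := t) hok hc hx0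
      (fun l t h => (hx l t h).symm) (fun l t hl h => by
        rw [← I.stepK_lfpK]
        refine stepK_of_not_listed hl fun h' => ?_
        obtain ⟨i, hi, h'⟩ := (hlist _).1 h'
        exact h i hi h'.symm) hκ hl
    rw [I.stepK_lfpK, ← hlt] at this
    exact this.ge
  · set z := (elim A b n).2 with hz
    -- For the converse, the solution is extended to a pre-fixed point of all equations: true values
    -- at lower ranks, 0 at unlisted keys of the level, and ∞ at all other keys.
    let X : ℕ → ℝ≥0∞ := fun k => if ∃ l t, k = cell l t ∧ rk l < c then I.lfpK k else
      if ∃ l t, k = cell l t ∧ rk l = c then (if h : ∃ i < n, κ i = k then z h.choose else 0) else ⊤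
    have X₁ : ∀ l t, rk l < c → X (cell l t) = I.lfpK (cell l t) := fun l t h =>
      if_pos ⟨l, t, rfl, h⟩
    have X₂ : ∀ i < n, X (κ i) = z i := fun i hi => by
      obtain ⟨l, t, hlt, hl⟩ := hcell i hi
      have h₁ : ¬ ∃ l t, κ i = cell l t ∧ rk l < c := by
        rintro ⟨l', t', h, h'⟩
        rw [(cell_inj (hlt.symm.trans h)).1] at hl
        omega
      have h₂ : ∃ i' < n, κ i' = κ i := ⟨i, hi, rfl⟩
      simp only [X]
      rw [if_neg h₁, if_pos ⟨l, t, hlt, hl⟩, dif_pos h₂]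
      exact congrArg z (hκ _ h₂.choose_spec.1 _ hi h₂.choose_spec.2)
    have X₃ : ∀ l t, rk l = c → (∀ j < n, κ j ≠ cell l t) → X (cell l t) = 0 := fun l t hl h => by
      have h₁ : ¬ ∃ l' t', cell l t = cell l' t' ∧ rk l' < c := by
        rintro ⟨l', t', h, h'⟩
        rw [(cell_inj h).1] at hl
        omega
      simp only [X]
      rw [if_neg h₁, if_pos ⟨l, t, rfl, hl⟩, dif_neg (by push Not; exact h)]
    suffices H : I.stepK X ≤ X by
      rw [← X₂ i hi]
      exact I.lfpK_le H _
    intro k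
    by_cases hk₁ : ∃ l t, k = cell l t ∧ rk l < c
    · obtain ⟨l, t, rfl, hl⟩ := hk₁
      rw [X₁ l t hl, ← I.stepK_lfpK]
      -- A rule for a lower rank either reads only lower ranks, where `X` is the least fixed point,
      -- or has a nonterminal of rank 0 and contributes 0.
      refine Finset.sum_le_sum fun r hr => Finset.sum_le_sum fun i _ => ?_
      rw [Finset.mem_range] at hr
      split_ifs with he
      · have hlr : I.lhs r = l := (cell_inj he).1
        rcases hok r hr with ⟨e, he, ht, h0⟩ | ⟨h₁, h₂, -⟩
        · refine le_of_eq_of_le (Finset.prod_eq_zero (Finset.mem_range.2 he) ?_) zero_le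
          unfold edgeVal
          rw [if_pos ht]
          exact (X₁ _ _ (by omega)).trans (lfpK_eq_zero_of_rank hok h0 _)
        · refine le_of_eq (Finset.prod_congr rfl fun e he => ?_)
          unfold edgeVal
          split_ifs with ht
          · have := h₂ e (Finset.mem_range.1 he) ht
            exact X₁ _ _ (by rw [hlr] at this; omega)
          · rfl
      · rfl
    · by_cases hk₂ : ∃ l t, k = cell l t ∧ rk l = c
      · obtain ⟨l, t, rfl, hl⟩ := hk₂
        by_cases hL : I.Listed rk c I.numRules (cell l t)
        · obtain ⟨i, hi, hlt⟩ := (hlist _).1 hL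
          rw [stepK_eq_level (κ := κ) (n := n) hok hc hx0
            (fun l t h => (X₁ l t h).trans (hx l t h).symm) X₃ hκ hl, hlt, X₂ i hi]
          refine le_of_eq (Eq.trans ?_ (elimStep_elim A b n i hi))
          refine congrArg₂ _ (Finset.sum_congr rfl fun j hj => ?_) rfl
          rw [X₂ j (Finset.mem_range.1 hj)]
        · rw [stepK_of_not_listed hl hL]
          exact zero_le
      · have : X k = ⊤ := by
          simp only [X]
          rw [if_neg hk₁, if_neg hk₂]
        rw [this]
        exact le_top

end State


/-! ### Linearly recursive grammars

Array `58` of natural numbers: number of levels that have been solved. -/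

/-- Sets up the linear system of the current level. -/
def setupProg : Prog := .forTo 20 (.get 0 (.lit 0))
  (.cond (.eq (.get 32 eLhs) (.var 31)) ruleProg .skip)

/-- The values are updated after each rule of the level, but all contributions can be expressed by
the initial ones, since the entries that change have rank `c` and are not read as factors. -/
theorem wp_setup : ∃ K, ∀ (I σ : State) (M s : ℕ), I.Inp σ → I.WellFormed → σ.KeysOK →
    (∀ r < I.numRules, I.numAsg r ≤ M) → (∀ r < I.numRules, I.size r ≤ s) →
    WP setupProg σ (K * (s + 1) * (M + 1) * (I.numRules + 1)) (fun τ =>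
      τ.KeysOK ∧ (∃ l, τ.keys = σ.keys ++ l) ∧
      (∀ y, y ∈ τ.keys ↔ y ∈ σ.keys ∨ I.Listed (σ.nat 32) (σ.nat 31 0) I.numRules y) ∧
      (∀ y, τ.val 2 y = σ.val 2 y + I.levelVec (σ.nat 32) (σ.nat 31 0) (σ.val 2) I.numRules y) ∧
      (∀ y, τ.val 3 y = σ.val 3 y +
        I.levelMat (σ.nat 32) (σ.nat 31 0) (σ.val 2) I.numRules y)) := by
  obtain ⟨K, hK⟩ := wp_rule
  refine ⟨K + 100, fun I σ M s hI hw hk hM hs => ?_⟩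
  set rk := σ.nat 32 with hrk
  set c := σ.nat 31 0 with hc
  set x := σ.val 2 with hx
  refine (WP.forTo_const (fun n τ => τ.KeysOK ∧ (∃ l, τ.keys = σ.keys ++ l) ∧
      (∀ y, y ∈ τ.keys ↔ y ∈ σ.keys ∨ I.Listed rk c n y) ∧
      (∀ y, τ.val 2 y = x y + I.levelVec rk c x n y) ∧
      (∀ y, τ.val 3 y = σ.val 3 y + I.levelMat rk c x n y)) I.numRules
      (K * (s + 1) * (M + 1) + 40) rfl ?_ ?_ ?_).mono ?_ (fun _ _ h => h.1)
  · have e : (σ.updateNat 20 0 0).keys = σ.keys :=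
      State.keys_congr (State.updateNat_nat_of_ne _ _ _ (by norm_num))
        (State.updateNat_nat_of_ne _ _ _ (by norm_num))
    refine ⟨hk.congr (State.updateNat_nat_of_ne _ _ _ (by norm_num))
      (State.updateNat_nat_of_ne _ _ _ (by norm_num))
      (State.updateNat_nat_of_ne _ _ _ (by norm_num)), ⟨[], by simp [e]⟩, ?_, ?_, ?_⟩
    · simp [e, State.Listed]
    · simp [State.levelVec, hx]
    · simp [State.levelMat]
  · intro j υ _ hA
    have hi := hI.agree (p := setupProg) hA rfl rfl
    simp [hi.nat, State.numRules]
  · rintro n υ hn ⟨h₁, ⟨l, h₂⟩, h₃, h₄, h₅⟩ h20 hA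
    have hi := hI.agree (p := setupProg) hA rfl rfl
    have e32 : υ.nat 32 = rk := hA.nat 32 rfl
    have e31 : υ.nat 31 0 = c := by rw [hA.nat 31 rfl]
    have htest : (Test.eq (.get 32 eLhs) (.var 31)).Holds υ ↔ rk (I.lhs n) = c := by
      simp [eLhs, e32, e31, h20, hi.nat, State.lhs]
    have hlist : ∀ y, I.Listed rk c (n + 1) y ↔ I.Listed rk c n y ∨
        (rk (I.lhs n) = c ∧ ∃ i < I.numAsg n, y = I.extKey n (I.asg n i)) := fun y => by
      constructor
      · rintro ⟨r, hr, h⟩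
        rcases Nat.lt_succ_iff_lt_or_eq.1 hr with hr | rfl
        exacts [.inl ⟨r, hr, h⟩, .inr h]
      · rintro (⟨r, hr, h⟩ | h)
        exacts [⟨r, by omega, h⟩, ⟨n, by omega, h⟩]
    have huk : ∀ τ : State, (τ.updateNat 20 0 (n + 1)).keys = τ.keys := fun τ =>
      State.keys_congr (State.updateNat_nat_of_ne _ _ _ (by norm_num))
        (State.updateNat_nat_of_ne _ _ _ (by norm_num))
    have huo : ∀ τ : State, τ.KeysOK → (τ.updateNat 20 0 (n + 1)).KeysOK := fun τ h =>
      h.congr (State.updateNat_nat_of_ne _ _ _ (by norm_num))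
        (State.updateNat_nat_of_ne _ _ _ (by norm_num))
        (State.updateNat_nat_of_ne _ _ _ (by norm_num))
    have hx' : ∀ l t, rk l ≠ c → υ.val 2 (cell l t) = x (cell l t) := fun l t h => by
      rw [h₄, State.levelVec_eq_zero h, add_zero]
    refine (WP.cond (T := K * (s + 1) * (M + 1) + 1) (fun ht => ?_) (fun ht => ?_)).mono
      ?_ (fun _ _ h => h)
    · rw [htest] at ht
      refine (hK I υ hi hw (by rwa [h20]) h₁ ?_).mono ?_ ?_
      · rw [h20, e32, e31]
        intro e _ _ h
        rw [h, ht]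
      · rw [h20]
        exact (Nat.mul_le_mul (Nat.mul_le_mul_left _ (Nat.succ_le_succ (hs n hn)))
          (Nat.succ_le_succ (hM n hn))).trans (Nat.le_succ _)
      · rw [h20, e32, e31]
        rintro τ _ ⟨g₁, ⟨l', g₂⟩, g₃, g₄, g₅⟩
        refine ⟨huo τ g₁, ⟨l ++ l', by rw [huk, g₂, h₂, List.append_assoc]⟩, fun y => ?_,
          fun y => ?_, fun y => ?_⟩
        · rw [huk, g₃, h₃, hlist, or_assoc, and_iff_right ht]
        · rw [State.updateNat_val, g₄, h₄, State.addVec_congr hx', State.levelVec, State.levelVec,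
            Finset.sum_range_succ, if_pos ht, add_assoc]
        · rw [State.updateNat_val, g₅, h₅, State.addMat_congr hx', State.levelMat, State.levelMat,
            Finset.sum_range_succ, if_pos ht, add_assoc]
    · rw [htest] at ht
      refine (WP.of_loopFree rfl ?_).mono (show Prog.cost _ ≤ _ by simp [Prog.cost])
        (fun _ _ h => h)
      refine ⟨huo υ h₁, ⟨l, by rw [huk]; exact h₂⟩, fun y => ?_, fun y => ?_, fun y => ?_⟩
      · rw [huk, hlist]
        simp only [ht, false_and, or_false]
        exact h₃ y
      · rw [State.updateNat_val, State.levelVec, Finset.sum_range_succ, if_neg ht, add_zero]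
        exact h₄ y
      · rw [State.updateNat_val, State.levelMat, Finset.sum_range_succ, if_neg ht, add_zero]
        exact h₅ y
    · have : (Test.eq (.get 32 eLhs) (.var 31)).cost ≤ 30 := by decide
      omega
  · simp only [NExpr.cost]
    refine Nat.mul_le_mul_right _ ?_
    have : 1 ≤ (s + 1) * (M + 1) := Nat.mul_pos (by omega) (by omega)
    rw [mul_assoc, mul_assoc]
    nlinarith

/-- Solves the equations of the next level. -/
def levelProg : Prog :=
  (.assign 31 (.add (.var 58) (.lit 1)) ;; .assign 36 (.var 35)) ;; setupProg ;; elimProg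

/-- The equations for the labels of ranks less than `c` have been solved. -/
structure State.Solved (I : State) (rk : ℕ → ℕ) (c : ℕ) (σ : State) : Prop where
  inp : I.Inp σ
  keysOK : σ.KeysOK
  key_cell : ∀ y ∈ σ.keys, ∃ l t, y = cell l t ∧ rk l < c
  rank : σ.nat 32 = rk
  vec : ∀ l t, rk l < c → σ.val 2 (cell l t) = I.lfpK (cell l t)
  vec_zero : ∀ l t, c ≤ rk l → σ.val 2 (cell l t) = 0
  mat_zero : ∀ l t y, c ≤ rk l → σ.val 3 (cell (cell l t) y) = 0

/-- A bound for the number of keys of a level. -/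
def State.levelSize (I : State) (rk : ℕ → ℕ) (c : ℕ) : ℕ :=
  ∑ r ∈ Finset.range I.numRules, if rk (I.lhs r) = c then I.numAsg r else 0

/-- Every listed key comes from a pair of a rule of the level and one of its assignments. This makes
the system size depend on the assignments of that level alone, not on the number of labels or of
tuples. -/
theorem State.length_le_levelSize {I : State} {rk : ℕ → ℕ} {c : ℕ} {l : List ℕ} (hl : l.Nodup)
    (h : ∀ y ∈ l, I.Listed rk c I.numRules y) : l.length ≤ I.levelSize rk c := by
  classical
  rw [← List.toFinset_card_of_nodup hl]
  calc l.toFinset.card ≤ ((Finset.range I.numRules).biUnion fun r =>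
        if rk (I.lhs r) = c then (Finset.range (I.numAsg r)).image fun i =>
          I.extKey r (I.asg r i) else ∅).card := by
        refine Finset.card_le_card fun y hy => ?_
        obtain ⟨r, hr, hc, i, hi, rfl⟩ := h y (by simpa using hy)
        refine Finset.mem_biUnion.2 ⟨r, Finset.mem_range.2 hr, ?_⟩
        rw [if_pos hc]
        exact Finset.mem_image.2 ⟨i, Finset.mem_range.2 hi, rfl⟩
    _ ≤ _ := by
        refine Finset.card_biUnion_le.trans (Finset.sum_le_sum fun r _ => ?_)
        split_ifs
        · exact Finset.card_image_le.trans (by simp)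
        · simp

/-- The setup only adds to the arrays. It produces the system of the level because values and matrix
rows at keys of rank at least `c` are still 0. Keys found earlier have smaller ranks, so the list
from position `36` on consists exactly of the keys of this level. -/
theorem wp_level : ∃ K, ∀ (I σ : State) (rk : ℕ → ℕ) (M s : ℕ), I.WellFormed →
    (∀ r < I.numRules, I.numAsg r ≤ M) → (∀ r < I.numRules, I.size r ≤ s) →
    (∀ r < I.numRules, I.RankOK rk r) → I.Solved rk (σ.nat 58 0 + 1) σ →
    WP levelProg σ (K * (s + 1) * (M + 1) * (I.numRules + 1) +
      K * (I.levelSize rk (σ.nat 58 0 + 1) + 1) ^ 3) (I.Solved rk (σ.nat 58 0 + 1 + 1)) := by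
  obtain ⟨K, hK⟩ := wp_setup
  refine ⟨K + 1200, fun I σ rk M s hw hM hs hok h => ?_⟩
  set c := σ.nat 58 0 + 1 with hc
  set N := I.levelSize rk c with hN
  refine (((WP.of_loopFree (p := .assign 31 (.add (.var 58) (.lit 1)) ;; .assign 36 (.var 35)) rfl
    (Q := fun τ => τ.nat 31 0 = c ∧ τ.nat 36 0 = σ.nat 35 0) ?_).mono
    (show Prog.cost _ ≤ 20 by decide) (fun _ _ h => h)).seq
    (T₂ := K * (s + 1) * (M + 1) * (I.numRules + 1) + 1100 * (N + 1) ^ 3) fun τ hτ q => ?_).mono ?_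
    (fun _ _ h => h)
  · simp [Prog.run, hc]
  · have hi := h.inp.agree hτ rfl rfl
    have e32 : τ.nat 32 = rk := (hτ.nat 32 rfl).trans h.rank
    have e2 : τ.val 2 = σ.val 2 := hτ.val 2 rfl
    have e3 : τ.val 3 = σ.val 3 := hτ.val 3 rfl
    have ek : τ.keys = σ.keys := State.keys_congr (hτ.nat 34 rfl) (hτ.nat 35 rfl)
    refine (hK I τ M s hi hw
      (h.keysOK.congr (hτ.nat 34 rfl) (hτ.nat 35 rfl) (hτ.nat 33 rfl)) hM hs).seq ?_
    rw [e32, q.1, e2, e3, ek]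
    rintro υ aυ ⟨g₁, ⟨l, g₂⟩, g₃, g₄, g₅⟩
    have hlen : σ.keys.length = σ.nat 35 0 := by simp [State.keys]
    have hlen' : υ.keys.length = υ.nat 35 0 := by simp [State.keys]
    have e36 : υ.nat 36 0 = σ.keys.length := by rw [aυ.nat 36 rfl, q.2, hlen]
    have hnum : υ.numKeys = l.length := by
      rw [State.numKeys, e36, ← hlen', g₂, List.length_append, Nat.add_sub_cancel_left]
    have hkey : ∀ (i : ℕ) (hi : i < l.length), υ.key i = l[i] := fun i hi => by
      have h₁ : υ.keys[σ.keys.length + i]'(by rw [g₂, List.length_append]; omega) = l[i] := by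
        simp [g₂]
      rw [← h₁, State.key, e36]
      simp [State.keys]
    have hnd : (σ.keys ++ l).Nodup := g₂ ▸ g₁.nodup
    have hl : l.Nodup := (List.nodup_append.1 hnd).2.1
    have hmem : ∀ y, I.Listed rk c I.numRules y ↔ y ∈ l := fun y => by
      have := g₃ y
      rw [g₂, List.mem_append] at this
      constructor
      · intro hy
        refine (this.2 (.inr hy)).resolve_left fun hσ => ?_
        obtain ⟨l₁, t₁, e₁, h₁⟩ := h.key_cell y hσ
        obtain ⟨l₂, t₂, e₂, h₂⟩ := hy.exists_cell
        rw [(cell_inj (e₁.symm.trans e₂)).1] at h₁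
        omega
      · intro hy
        refine (this.1 (.inr hy)).resolve_left fun hσ => ?_
        exact (List.nodup_append.1 hnd).2.2 y hσ y hy rfl
    have hlist : ∀ y, I.Listed rk c I.numRules y ↔ ∃ i < l.length, y = υ.key i := fun y => by
      rw [hmem, List.mem_iff_getElem]
      constructor
      · rintro ⟨i, hi, e⟩
        exact ⟨i, hi, by rw [hkey i hi, e]⟩
      · rintro ⟨i, hi, e⟩
        exact ⟨i, hi, by rw [e, hkey i hi]⟩
    have hκ : ∀ i < l.length, ∀ j < l.length, υ.key i = υ.key j → i = j := by
      intro i hi j hj hij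
      rw [hkey i hi, hkey j hj] at hij
      exact (List.Nodup.getElem_inj_iff hl).1 hij
    have hcell : ∀ i < l.length, ∃ l' t, υ.key i = cell l' t ∧ rk l' = c := fun i hi =>
      ((hlist _).2 ⟨i, hi, rfl⟩).exists_cell
    have hlN : l.length ≤ N := State.length_le_levelSize hl fun y hy => (hmem y).2 hy
    refine (wp_elim υ υ.key l.length ⟨rfl, hnum⟩ hκ).mono
      (Nat.mul_le_mul_left _ (Nat.pow_le_pow_left (Nat.succ_le_succ hlN) 3)) ?_
    rintro ω aω ⟨f₁, f₂, f₃⟩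
    have hb : ∀ i < l.length, υ.val 2 (υ.key i) = I.levelVec rk c (σ.val 2) I.numRules (υ.key i) := by
      intro i hi
      obtain ⟨l', t, e, hl'⟩ := hcell i hi
      rw [g₄, e, h.vec_zero _ _ hl'.ge, zero_add]
    have hA : ∀ i < l.length, ∀ j, υ.mat υ.key i j =
        I.levelMat rk c (σ.val 2) I.numRules (cell (υ.key i) (υ.key j + 1)) := by
      intro i hi j
      obtain ⟨l', t, e, hl'⟩ := hcell i hi
      rw [State.mat, g₅, e, h.mat_zero _ _ _ hl'.ge, zero_add]
    have hsol := State.elim_eq_lfpK hok (by omega) h.vec hκ hlist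
    have hne : ∀ l' t, rk l' ≠ c → ∀ i < l.length, cell l' t ≠ υ.key i := by
      intro l' t hl' i hi e
      obtain ⟨l'', t', e', h'⟩ := hcell i hi
      exact hl' ((cell_inj (e.trans e')).1 ▸ h')
    have ekω : ω.keys = σ.keys ++ l :=
      (State.keys_congr (aω.nat 34 rfl) (aω.nat 35 rfl)).trans g₂
    refine ⟨(hi.agree aυ rfl rfl).agree aω rfl rfl,
      g₁.congr (aω.nat 34 rfl) (aω.nat 35 rfl) (aω.nat 33 rfl), fun y hy => ?_,
      (aω.nat 32 rfl).trans ((aυ.nat 32 rfl).trans e32), fun l' t hl' => ?_, fun l' t hl' => ?_,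
      fun l' t y hl' => ?_⟩
    · rw [ekω, List.mem_append] at hy
      rcases hy with hy | hy
      · obtain ⟨l₁, t₁, e₁, h₁⟩ := h.key_cell y hy
        exact ⟨l₁, t₁, e₁, by omega⟩
      · obtain ⟨l₁, t₁, e₁, h₁⟩ := ((hmem y).2 hy).exists_cell
        exact ⟨l₁, t₁, e₁, by omega⟩
    · rcases Nat.lt_succ_iff_lt_or_eq.1 hl' with hl' | hl'
      · rw [f₂ _ (hne _ _ hl'.ne), g₄, State.levelVec_eq_zero hl'.ne, add_zero, h.vec _ _ hl']
      · by_cases hL : I.Listed rk c I.numRules (cell l' t)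
        · obtain ⟨i, hi, e⟩ := (hlist _).1 hL
          rw [e, f₁ i hi, ← hsol i hi]
          exact elim_congr hA hb i hi
        -- A key of the level that is not listed is untouched, and its true value is an empty sum.
        · rw [f₂ _ (fun i hi e => hL ((hlist _).2 ⟨i, hi, e⟩)), g₄, h.vec_zero _ _ hl'.ge,
            State.levelVec_of_not_listed hL, ← I.stepK_lfpK, State.stepK_of_not_listed hl' hL,
            add_zero]
    · rw [f₂ _ (hne _ _ (by omega)), g₄, State.levelVec_eq_zero (by omega), add_zero,
        h.vec_zero _ _ (by omega)]
    · rw [f₃ _ _ (hne _ _ (by omega)), g₅, State.levelMat_eq_zero (by omega), add_zero,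
        h.mat_zero _ _ _ (by omega)]
  · have h1 : 1 ≤ (N + 1) ^ 3 := Nat.one_le_pow _ _ (by omega)
    have h2 : K * (s + 1) * (M + 1) * (I.numRules + 1) ≤
        (K + 1200) * (s + 1) * (M + 1) * (I.numRules + 1) := by gcongr; omega
    have h3 : 1100 * (N + 1) ^ 3 + 20 ≤ (K + 1200) * (N + 1) ^ 3 := by nlinarith
    omega


/-- Each rule belongs to at most one level, namely that of the rank of its left-hand side. -/
theorem State.sum_levelSize_le (I : State) (rk : ℕ → ℕ) {M : ℕ}
    (hM : ∀ r < I.numRules, I.numAsg r ≤ M) (n : ℕ) :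
    ∑ c ∈ Finset.range n, I.levelSize rk (c + 1) ≤ I.numRules * M := by
  unfold State.levelSize
  rw [Finset.sum_comm]
  calc _ ≤ ∑ _r ∈ Finset.range I.numRules, M := Finset.sum_le_sum fun r hr => ?_
    _ = _ := by simp
  rw [Finset.mem_range] at hr
  by_cases h : ∃ c < n, rk (I.lhs r) = c + 1
  · obtain ⟨c, hc, h⟩ := h
    rw [Finset.sum_eq_single c]
    · rw [if_pos h]; exact hM r hr
    · intro c' _ hne
      exact if_neg (by omega)
    · intro hc'
      exact absurd (Finset.mem_range.2 hc) hc'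
  · push Not at h
    rw [Finset.sum_eq_zero fun c hc => if_neg (h c (Finset.mem_range.1 hc))]
    exact Nat.zero_le _

theorem State.levelSize_le (I : State) (rk : ℕ → ℕ) {M : ℕ}
    (hM : ∀ r < I.numRules, I.numAsg r ≤ M) (c : ℕ) : I.levelSize rk c ≤ I.numRules * M := by
  calc _ ≤ ∑ _r ∈ Finset.range I.numRules, M := Finset.sum_le_sum fun r hr => ?_
    _ = _ := by simp
  split_ifs
  · exact hM r (Finset.mem_range.1 hr)
  · exact Nat.zero_le _

/-- Computes the sum–product of a linearly recursive grammar. -/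
def linProg : Prog :=
  rankProg ;; .forTo 58 (.get 0 (.lit 0)) levelProg ;;
    .assignVal 1 (.get 2 (.cell (.get 0 (.lit 1)) (.lit 0)))

theorem wp_linear : ∃ C, ∀ (I : State) (ρ : ℕ → ℕ) (M s : ℕ), I.Fresh → I.WellFormed →
    (∀ r < I.numRules, I.RankOK ρ r) → (∀ l, ρ l ≤ I.numRules) → 0 < M → 0 < I.numRules →
    (∀ r < I.numRules, I.numAsg r ≤ M) → (∀ r < I.numRules, I.size r ≤ s) →
    WP linProg I (C * (s + 1) * (I.numRules ^ 3 * M ^ 3)) (fun τ =>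
      τ.val 1 0 = I.lfpK (cell I.start 0)) := by
  obtain ⟨K, hK⟩ := wp_level
  refine ⟨16000 + 12 * K + 200, fun I ρ M s hF hw hρ hle hM hR hN hs => ?_⟩
  set R := I.numRules with hRdef
  set B := K * (s + 1) * (M + 1) * (R + 1) with hB
  set P := R * M with hP
  have hP1 : 1 ≤ P := Nat.mul_pos hR hM
  have hRP : R ≤ P := Nat.le_mul_of_pos_right _ hM
  refine (WP.seq (wp_rank I I ρ s (.refl I) hρ hle hs (hF.nat 32 (by norm_num)))
    (T₂ := R * B + K * (8 * P ^ 3) + (2 + 20) * (R + 1) + 20)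
    fun τ₁ a₁ ⟨hok, hrk⟩ => ?_).mono ?_ (fun _ _ h => h)
  · set rk := τ₁.nat 32 with hrkd
    have i₁ : I.Inp τ₁ := (State.Inp.refl I).agree a₁ rfl rfl
    have hsum : ∑ c ∈ Finset.range R, (B + K * (I.levelSize rk (c + 1) + 1) ^ 3) ≤
        R * B + K * (8 * P ^ 3) := by
      rw [Finset.sum_add_distrib, Finset.sum_const, Finset.card_range, smul_eq_mul,
        ← Finset.mul_sum]
      refine Nat.add_le_add_left (Nat.mul_le_mul_left _ ?_) _
      -- Two of the three factors are bounded by `2 * P` and the third is summed over the levels.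
      -- The total is cubic in `P`, without a further factor for the number of levels.
      calc _ ≤ ∑ c ∈ Finset.range R, (2 * P) ^ 2 * (I.levelSize rk (c + 1) + 1) := by
            refine Finset.sum_le_sum fun c _ => ?_
            rw [pow_succ]
            have : I.levelSize rk (c + 1) ≤ P := I.levelSize_le rk hN _
            exact Nat.mul_le_mul_right _ (Nat.pow_le_pow_left (by omega) 2)
        _ = (2 * P) ^ 2 * (∑ c ∈ Finset.range R, I.levelSize rk (c + 1) + R) := by
            rw [← Finset.mul_sum, Finset.sum_add_distrib]
            simp
        _ ≤ (2 * P) ^ 2 * (P + P) :=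
            Nat.mul_le_mul_left _ (Nat.add_le_add (I.sum_levelSize_le rk hN R) hRP)
        _ = _ := by ring
    refine ((WP.forTo (fun c τ => I.Solved rk (c + 1) τ) R
      (fun c => B + K * (I.levelSize rk (c + 1) + 1) ^ 3) rfl ?_ ?_ ?_).mono
      (Nat.add_le_add_right hsum _) (fun _ _ h => h)).seq fun τ₂ a₂ h₂ => ?_
    · have e : (τ₁.updateNat 58 0 0).keys = [] := by
        simp [State.keys, a₁.nat 35 rfl, hF.nat]
      refine ⟨⟨fun a ha => ?_, by simp [i₁.val]⟩, ⟨by simp [e], fun k => ?_⟩, by simp [e], ?_, ?_,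
        ?_, ?_⟩
      · rw [State.updateNat_nat_of_ne _ _ _ (by omega), i₁.nat a ha]
      · simp [e, a₁.nat 33 rfl, hF.nat]
      · rw [State.updateNat_nat_of_ne _ _ _ (by norm_num)]
      -- Rank 0 needs no work: its labels have the value 0, like fresh memory.
      · intro l t hl
        rw [State.updateNat_val, a₁.val 2 rfl, hF.val 2 (by norm_num),
          State.lfpK_eq_zero_of_rank hok (by omega)]
      · intro l t _
        rw [State.updateNat_val, a₁.val 2 rfl, hF.val 2 (by norm_num)]
      · intro l t y _
        rw [State.updateNat_val, a₁.val 3 rfl, hF.val 3 (by norm_num)]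
    · intro c υ h _
      simp [h.inp.nat, hRdef, State.numRules]
    · rintro c υ hc h h58 _
      rw [← h58] at h ⊢
      refine (hK I υ rk M s hw hN hs hok h).mono le_rfl fun τ _ h' => ?_
      have ek : ∀ n, (τ.updateNat 58 0 n).keys = τ.keys := fun n =>
        State.keys_congr (State.updateNat_nat_of_ne _ _ _ (by norm_num))
          (State.updateNat_nat_of_ne _ _ _ (by norm_num))
      exact ⟨⟨fun a ha => by rw [State.updateNat_nat_of_ne _ _ _ (by omega), h'.inp.nat a ha],
        by rw [State.updateNat_val, h'.inp.val]⟩,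
        h'.keysOK.congr (State.updateNat_nat_of_ne _ _ _ (by norm_num))
          (State.updateNat_nat_of_ne _ _ _ (by norm_num))
          (State.updateNat_nat_of_ne _ _ _ (by norm_num)),
        by rw [ek]; exact h'.key_cell,
        by rw [State.updateNat_nat_of_ne _ _ _ (by norm_num), h'.rank],
        h'.vec, h'.vec_zero, h'.mat_zero⟩
    · refine (WP.of_loopFree rfl ?_).mono (show Prog.cost _ ≤ 20 by decide) (fun _ _ h => h)
      simp only [Prog.run, VExpr.eval, NExpr.eval, NExpr.eval_cell, State.updateVal_val, and_self,
        if_true, h₂.1.inp.nat 0 (by norm_num)]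
      -- Ranks do not exceed the number of rules, so the start symbol belongs to a solved level.
      exact h₂.1.vec _ _ (Nat.lt_succ_of_le (hrk _))
  · rw [← mul_pow, ← hP]
    have hs1 : P ^ 3 ≤ (s + 1) * P ^ 3 := Nat.le_mul_of_pos_left _ (by omega)
    have hPP : P ≤ P ^ 3 := Nat.le_self_pow (by norm_num) P
    have hPP2 : P * P ≤ P ^ 3 := by
      calc P * P ≤ P * P * P := Nat.le_mul_of_pos_right _ hP1
        _ = _ := by ring
    have t₁ : 2000 * (s + 1) * (R + 1) ^ 3 ≤ 16000 * ((s + 1) * P ^ 3) := by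
      calc _ ≤ 2000 * (s + 1) * (2 * P) ^ 3 :=
            Nat.mul_le_mul_left _ (Nat.pow_le_pow_left (by omega) 3)
        _ = _ := by ring
    have t₂ : R * B ≤ 4 * K * ((s + 1) * P ^ 3) := by
      have h₁ : (M + 1) * (R + 1) ≤ 4 * P := by nlinarith
      calc R * B = K * (s + 1) * (R * ((M + 1) * (R + 1))) := by rw [hB]; ring
        _ ≤ K * (s + 1) * (P * (4 * P)) := Nat.mul_le_mul_left _ (Nat.mul_le_mul hRP h₁)
        _ = 4 * K * ((s + 1) * (P * P)) := by ring
        _ ≤ _ := Nat.mul_le_mul_left _ (Nat.mul_le_mul_left _ hPP2)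
    have t₃ := Nat.mul_le_mul_left (8 * K) hs1
    calc _ = 2000 * (s + 1) * (R + 1) ^ 3 + (R * B + 8 * K * P ^ 3 + (22 * (R + 1) + 20)) := by
          ring
      _ ≤ 16000 * ((s + 1) * P ^ 3) + (4 * K * ((s + 1) * P ^ 3) + 8 * K * ((s + 1) * P ^ 3) +
          200 * ((s + 1) * P ^ 3)) := by omega
      _ = _ := by ring

end RAM

/-! ### The system of equations -/

/-- Products of series in `[0, ∞]`. -/
theorem ENNReal.tsum_pi_prod {ι : Type*} [Fintype ι] {β : ι → Type*}
    (f : ∀ i, β i → ℝ≥0∞) : ∑' b : ∀ i, β i, ∏ i, f i (b i) = ∏ i, ∑' b, f i b := by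
  classical
  revert β
  refine Fintype.induction_empty_option (P := fun ι [Fintype ι] => ∀ {β : ι → Type _}
    (f : ∀ i, β i → ℝ≥0∞), ∑' b : ∀ i, β i, ∏ i, f i (b i) = ∏ i, ∑' b, f i b) ?_ ?_ ?_ ι
  · intro α α' _ e ih β f
    let := Fintype.ofEquiv α' e.symm
    rw [← Equiv.prod_comp e, ← ih fun i => f (e i), ← (Equiv.piCongrLeft β e).tsum_eq]
    refine tsum_congr fun b => ?_
    rw [← Equiv.prod_comp e]
    refine Finset.prod_congr rfl fun i _ => ?_
    rw [Equiv.piCongrLeft_apply_apply]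
  · intro β f
    simp
  · intro α _ ih β f
    rw [Fintype.prod_option, ← ih fun i => f (some i), ← (Equiv.piOptionEquivProd).symm.tsum_eq,
      ENNReal.tsum_prod', ← ENNReal.tsum_mul_right]
    refine tsum_congr fun b => ?_
    rw [← ENNReal.tsum_mul_left]
    refine tsum_congr fun c => ?_
    rw [Fintype.prod_option]
    rfl

/-- The edges of a replacement carry the instance `Fintype.ofFinite`, not the one of the sum type by
which products over them are split. -/
theorem prod_univ_instance {α M : Type*} [CommMonoid M] (i j : Fintype α) (f : α → M) :
    @Finset.prod α M _ (@Finset.univ α i) f = @Finset.prod α M _ (@Finset.univ α j) f := by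
  rw [Subsingleton.elim i j]

theorem heq_apply {α : Sort*} {β : α → Sort*} (f : ∀ a, β a) {a b : α} (h : a = b) :
    HEq (f a) (f b) := by
  subst h
  rfl

/-! ### Assignments of a derived graph -/

namespace Fragment

variable {LV : Type*} {LE : Type*} {type : LE → List LV} {L M : Set LE} {τ : List LV}
  {Ω : LV → Type*} (R : Fragment type L τ) (A : Set LE)
  (H : ∀ e : {e : R.E // R.labE e ∈ A}, Fragment type M (type (R.labE e.1)))
  (hL : ∀ t ∈ L, t ∉ A → t ∈ M)

/-- The assignments of the result of a replacement. -/
noncomputable def replaceAsgEquiv : (R.replace A H hL).Asg Ω ≃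
    Σ ξ : R.Asg Ω, ∀ e : {e : R.E // R.labE e ∈ A},
      {η : (H e).Asg Ω // (H e).readExt η = R.readAtt ξ e.1} where
  toFun ζ := ⟨fun v => ζ (Quot.mk _ (.inl v)), fun e => ⟨fun u => ζ (Quot.mk _ (.inr ⟨e, u⟩)), by
    funext j
    -- An endpoint of `e` and the corresponding external node of `H e` are one node of the quotient.
    -- Its value is transported to the tuple along two different label equations, hence the
    -- heterogeneous equality.
    exact eq_of_heq ((cast_heq _ _).trans ((heq_apply ζ
      (Quot.sound (Identify.mk (R := R) (A := A) (H := H) e j)).symm).trans (cast_heq _ _).symm))⟩⟩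
  invFun x q := Quot.hrecOn (motive := fun q => Ω ((R.replace A H hL).labV q)) q
    (fun a => match a with
      | .inl v => x.1 v
      | .inr ⟨e, u⟩ => (x.2 e).1 u) (by
    rintro _ _ ⟨e, j⟩
    have h := congrFun (x.2 e).2 j
    unfold readExt readAtt at h
    exact (cast_heq _ _).symm.trans ((heq_of_eq h.symm).trans (cast_heq _ _)))
  left_inv ζ := by
    funext q
    induction q using Quot.ind with
    | mk a => rcases a with v | ⟨e, u⟩ <;> rfl
  right_inv x := rfl

end Fragment

namespace FGG

variable {LV : Type*} {LE : Type*} {type : LE → List LV} {Ω : LV → Type*} (G : FGG type Ω)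

open scoped Classical in
/-- The product of the factors of the terminal edges of a rule. -/
noncomputable def termVal (r : G.Rule) (ξ : (G.rhs r).Asg Ω) : ℝ≥0∞ :=
  ∏ e : TEdge G r, (G.F ⟨_, e.2⟩ ((G.rhs r).readAtt ξ e.1) : ℝ≥0∞)

open scoped Classical in
/-- The contribution of an assignment of the right-hand side of a rule. -/
noncomputable def nodeVal (r : G.Rule)
    (g : ∀ e : NEdge G r, Args Ω (type ((G.rhs r).labE e.1)) → ℝ≥0∞) (ξ : (G.rhs r).Asg Ω) :
    ℝ≥0∞ :=
  G.termVal r ξ * ∏ e : NEdge G r, g e ((G.rhs r).readAtt ξ e.1)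

theorem nodeVal_mono {r : G.Rule}
    {g g' : ∀ e : NEdge G r, Args Ω (type ((G.rhs r).labE e.1)) → ℝ≥0∞}
    (h : ∀ e ξ, g e ξ ≤ g' e ξ) (ξ : (G.rhs r).Asg Ω) : G.nodeVal r g ξ ≤ G.nodeVal r g' ξ :=
  mul_le_mul_right (Finset.prod_le_prod' fun e _ => h e _) _

open scoped Classical in
-- The edges of the derived graph are the terminal edges of the right-hand side, since labels
-- outside of `N` lie in `T`, and the edges of the children.
theorem weight_derived_node (r : G.Rule) (c : ∀ e : NEdge G r, Deriv G ((G.rhs r).labE e.1))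
    (ζ : (G.derived (.node r c)).Asg Ω) :
    (G.weight (G.derived (.node r c)) ζ : ℝ≥0∞) = G.termVal r
        ((G.rhs r).replaceAsgEquiv {t | t ∈ G.N} (fun e => G.derived (c e))
          (fun _ h hN => h.resolve_left hN) ζ).1 *
      ∏ e : NEdge G r, (G.weight (G.derived (c e))
        (((G.rhs r).replaceAsgEquiv {t | t ∈ G.N} (fun e => G.derived (c e))
          (fun _ h hN => h.resolve_left hN) ζ).2 e).1 : ℝ≥0∞) := by
  have key : G.weight (G.derived (.node r c)) ζ =
      ∏ e : {e : (G.rhs r).E // (G.rhs r).labE e ∉ {t | t ∈ G.N}} ⊕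
        (Σ e : NEdge G r, (G.derived (c e)).E),
      G.F ⟨(G.derived (.node r c)).labE e, (G.derived (.node r c)).labE_mem e⟩
        ((G.derived (.node r c)).readAtt ζ e) :=
    prod_univ_instance _ _ _
  refine (congrArg ((↑) : ℝ≥0 → ℝ≥0∞) key).trans ?_
  rw [Fintype.prod_sum_type, Fintype.prod_sigma]
  push_cast
  congr 1
  · unfold termVal
    refine Fintype.prod_equiv (Equiv.subtypeEquivRight fun e => ?_) _ _ fun e => rfl
    exact ⟨fun h => ((G.rhs r).labE_mem e).resolve_left h,
      fun h h' => Finset.disjoint_left.1 G.disjoint h' h⟩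
  · refine Finset.prod_congr rfl fun e _ => ?_
    unfold weight
    push_cast
    rfl

/-- Once the assignment of the right-hand side is fixed, the assignments of the children are
independent of each other, so the sum of products is a product of sums. -/
theorem derivSum_node (r : G.Rule) (c : ∀ e : NEdge G r, Deriv G ((G.rhs r).labE e.1))
    (ξ : Args Ω (type (G.lhs r))) :
    G.derivSum (.node r c) ξ = ∑' ξ' : {ξ' : (G.rhs r).Asg Ω // (G.rhs r).readExt ξ' = ξ},
      G.nodeVal r (fun e => G.derivSum (c e)) ξ'.1 := by
  classical
  let Φ := (G.rhs r).replaceAsgEquiv (Ω := Ω) {t | t ∈ G.N} (fun e => G.derived (c e))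
    (fun _ h hN => h.resolve_left hN)
  let Ψ : {ζ : (G.derived (.node r c)).Asg Ω // (G.derived (.node r c)).readExt ζ = ξ} ≃
      Σ ξ' : {ξ' : (G.rhs r).Asg Ω // (G.rhs r).readExt ξ' = ξ}, ∀ e : NEdge G r,
        {η : (G.derived (c e)).Asg Ω //
          (G.derived (c e)).readExt η = (G.rhs r).readAtt ξ'.1 e.1} :=
    { toFun := fun ζ => ⟨⟨(Φ ζ.1).1, ζ.2⟩, (Φ ζ.1).2⟩
      invFun := fun x => ⟨Φ.symm ⟨x.1.1, x.2⟩, x.1.2⟩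
      left_inv := fun ζ => Subtype.ext (Φ.left_inv ζ.1)
      right_inv := fun x => rfl }
  rw [derivSum, ← Ψ.symm.tsum_eq, ENNReal.tsum_sigma']
  refine tsum_congr fun ξ' => ?_
  rw [nodeVal]
  simp only [derivSum]
  rw [← ENNReal.tsum_pi_prod, ← ENNReal.tsum_mul_left]
  refine tsum_congr fun η => ?_
  exact G.weight_derived_node r c _

/-- Derivation trees are given by their root and their subtrees. -/
def Deriv.equivSigma {G : FGG type Ω} (X : LE) : Deriv G X ≃
    Σ r : {r : G.Rule // G.lhs r = X}, ∀ e : NEdge G r.1, Deriv G ((G.rhs r.1).labE e.1) where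
  toFun | .node r c => ⟨⟨r, rfl⟩, c⟩
  invFun := fun ⟨⟨r, h⟩, c⟩ => h ▸ .node r c
  left_inv := by rintro ⟨r, c⟩; rfl
  right_inv := by rintro ⟨⟨r, rfl⟩, c⟩; rfl

open scoped Classical in
-- This is the distributive law for the independent choices of children, after exchanging two sums
-- of nonnegative terms.
theorem tsum_nodeVal (r : G.Rule) (ξ : Args Ω (type (G.lhs r)))
    (g : ∀ {X : LE}, Deriv G X → Args Ω (type X) → ℝ≥0∞) :
    ∑' c : (∀ e : NEdge G r, Deriv G ((G.rhs r).labE e.1)),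
      ∑' ξ' : {ξ' : (G.rhs r).Asg Ω // (G.rhs r).readExt ξ' = ξ},
        G.nodeVal r (fun e => g (c e)) ξ'.1 =
    ∑' ξ' : {ξ' : (G.rhs r).Asg Ω // (G.rhs r).readExt ξ' = ξ},
      G.nodeVal r (fun _ ξ => ∑' D, g D ξ) ξ'.1 := by
  rw [ENNReal.tsum_comm]
  refine tsum_congr fun ξ' => ?_
  simp only [nodeVal]
  rw [ENNReal.tsum_mul_left, ENNReal.tsum_pi_prod
    (fun (e : NEdge G r) D => g D ((G.rhs r).readAtt ξ'.1 e.1))]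

/-- Tuples of values for the type of the left-hand side of a rule. -/
def castArgs {r : G.Rule} {X : LE} (h : G.lhs r = X) (ξ : Args Ω (type X)) :
    Args Ω (type (G.lhs r)) :=
  fun i => cast (by simp [h]) (ξ (i.cast (by rw [h])))

theorem tsum_deriv (X : LE) (ξ : Args Ω (type X))
    (f : ∀ {X : LE}, Deriv G X → Args Ω (type X) → ℝ≥0∞) :
    ∑' D : Deriv G X, f D ξ = ∑' r : {r : G.Rule // G.lhs r = X},
      ∑' c : (∀ e : NEdge G r.1, Deriv G ((G.rhs r.1).labE e.1)),
        f (.node r.1 c) (G.castArgs r.2 ξ) := by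
  rw [← (Deriv.equivSigma X).symm.tsum_eq, ENNReal.tsum_sigma']
  refine tsum_congr ?_
  rintro ⟨r, rfl⟩
  rfl

/-- The sum–product of a derivation of height less than `n`. -/
noncomputable def truncSum (G : FGG type Ω) :
    ℕ → {X : LE} → Deriv G X → Args Ω (type X) → ℝ≥0∞
  | 0, _, _, _ => 0
  | n + 1, _, .node r c, ξ => ∑' ξ' : {ξ' : (G.rhs r).Asg Ω // (G.rhs r).readExt ξ' = ξ},
      G.nodeVal r (fun e => G.truncSum n (c e)) ξ'.1

/-- Derivations are finite trees with finitely many children, so each has a finite height, beyond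
which truncation has no effect. -/
theorem exists_truncSum_eq {X : LE} (D : Deriv G X) :
    ∃ n, ∀ n' ≥ n, ∀ ξ, G.truncSum n' D ξ = G.derivSum D ξ := by
  classical
  induction D with
  | node r c ih =>
    choose n hn using ih
    refine ⟨Finset.univ.sup n + 1, fun n' hn' ξ => ?_⟩
    obtain ⟨m, rfl⟩ : ∃ m, n' = m + 1 := ⟨n' - 1, by omega⟩
    rw [derivSum_node, truncSum]
    refine tsum_congr fun ξ' => ?_
    congr! 2 with e
    funext ξ
    refine hn e m ?_ ξ
    have := Finset.le_sup (f := n) (Finset.mem_univ e)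
    omega

section Finite

variable [∀ ℓ, Fintype (Ω ℓ)]

theorem evalSystem_psi (x : Unknown G → ℝ≥0∞) (X : {X // X ∈ G.N}) (ξ : Args Ω (type X.1)) :
    G.evalSystem x (.psi X ξ) =
      ∑' r : {r : G.Rule // G.lhs r = X.1}, x (.tau r.1 (G.castArgs r.2 ξ)) := by
  classical
  rw [tsum_fintype, evalSystem, system, map_sum]
  simp only [MvPolynomial.aeval_X]
  rfl

theorem evalSystem_tau (x : Unknown G → ℝ≥0∞) (r : G.Rule) (ξ : Args Ω (type (G.lhs r))) :
    G.evalSystem x (.tau r ξ) =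
      ∑' ξ' : {ξ' : (G.rhs r).Asg Ω // (G.rhs r).readExt ξ' = ξ},
        G.nodeVal r (fun e ξ => x (.psi ⟨_, e.2⟩ ξ)) ξ'.1 := by
  classical
  rw [tsum_fintype, evalSystem, system, map_sum]
  simp only [map_mul, map_prod, MvPolynomial.aeval_X, MvPolynomial.aeval_C]
  rfl

theorem evalSystem_mono : Monotone G.evalSystem := by
  intro x y h u
  cases u with
  | psi X ξ =>
    rw [evalSystem_psi, evalSystem_psi]
    exact ENNReal.tsum_le_tsum fun _ => h _
  | tau r ξ =>
    rw [evalSystem_tau, evalSystem_tau]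
    refine ENNReal.tsum_le_tsum fun ξ' => G.nodeVal_mono (fun e _ => h _) _

theorem evalSystem_inside (u : Unknown G) : G.inside u = G.evalSystem G.inside u := by
  cases u with
  | psi X ξ =>
    rw [evalSystem_psi]
    exact G.tsum_deriv X.1 ξ G.derivSum
  | tau r ξ =>
    rw [evalSystem_tau]
    simp only [inside, derivSum_node]
    exact G.tsum_nodeVal r ξ G.derivSum

/-- By induction on the height, cutting off at the roots applies the equations once to the sums of
smaller height, and the equations are monotone. -/
theorem tsum_truncSum_le {x : Unknown G → ℝ≥0∞} (hx : G.evalSystem x ≤ x) (n : ℕ)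
    (X : {X // X ∈ G.N}) (ξ : Args Ω (type X.1)) :
    ∑' D : Deriv G X.1, G.truncSum n D ξ ≤ x (.psi X ξ) := by
  induction n generalizing X with
  | zero => simp [truncSum]
  | succ n ih =>
    rw [G.tsum_deriv X.1 ξ (G.truncSum (n + 1))]
    refine le_trans ?_ (hx _)
    rw [evalSystem_psi]
    refine ENNReal.tsum_le_tsum fun r => ?_
    refine le_trans ?_ (hx _)
    simp only [truncSum]
    rw [evalSystem_tau, G.tsum_nodeVal r.1 _ (G.truncSum n)]
    refine ENNReal.tsum_le_tsum fun ξ' => G.nodeVal_mono (fun e _ => ?_) _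
    exact ih ⟨_, e.2⟩ _

/-- A sum in [0, ∞] is the supremum of its finite partial sums, and finitely many derivations have a
common bound for their heights. For rules the bound then follows from their equation. -/
theorem inside_le {x : Unknown G → ℝ≥0∞} (hx : G.evalSystem x ≤ x) : G.inside ≤ x := by
  have h : ∀ X ξ, G.inside (.psi X ξ) ≤ x (.psi X ξ) := by
    intro X ξ
    refine (ENNReal.tsum_eq_iSup_sum (f := fun D : Deriv G X.1 => G.derivSum D ξ)).trans_le
      (iSup_le fun s => ?_)
    choose n hn using fun D : Deriv G X.1 => G.exists_truncSum_eq D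
    refine le_trans ?_ (G.tsum_truncSum_le hx (s.sup n) X ξ)
    refine le_trans (le_of_eq ?_) (ENNReal.sum_le_tsum s)
    exact Finset.sum_congr rfl fun D hD => (hn D _ (Finset.le_sup hD) ξ).symm
  intro u
  cases u with
  | psi X ξ => exact h X ξ
  | tau r ξ =>
    rw [evalSystem_inside]
    refine le_trans ?_ (hx _)
    rw [evalSystem_tau, evalSystem_tau]
    refine ENNReal.tsum_le_tsum fun ξ' => G.nodeVal_mono (fun e _ => ?_) _
    exact h _ _

theorem isLeast_inside : IsLeast {x : Unknown G → ℝ≥0∞ | ∀ u, x u = G.evalSystem x u} G.inside :=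
  ⟨G.evalSystem_inside, fun _ hx => G.inside_le fun u => (hx u).ge⟩

end Finite

/-- The type of the start symbol is empty, so the condition on the external nodes holds for every
assignment. -/
theorem inside_startUnknown : G.inside G.startUnknown = G.Z := by
  refine tsum_congr fun D => ?_
  have : IsEmpty (Fin (type G.S).length) := by rw [G.type_S]; exact Fin.isEmpty
  exact (Equiv.subtypeUnivEquiv fun ξ' => Subsingleton.elim _ _).tsum_eq
    (fun ξ' => (G.weight (G.derived D) ξ' : ℝ≥0∞))

end FGG

/-! ### The grammar in memory -/

namespace FGG

open RAM

theorem _root_.RAM.table_apply {ι α : Type*} [Zero α] {pos : ι → ℕ} (h : Function.Injective pos)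
    (value : ι → α) (x : ι) : table pos value (pos x) = value x :=
  h.extend_apply _ _ _

variable {LV : Type*} {LE : Type*} {type : LE → List LV} {Ω : LV → Type*}
  [Fintype LV] [Fintype LE] [∀ ℓ, Fintype (Ω ℓ)] {G : FGG type Ω} (ν : Numbering G)

namespace Numbering

theorem labE_inj {t t' : LE} : (ν.labE t).val = (ν.labE t').val ↔ t = t' := by
  rw [← Fin.ext_iff, ν.labE.injective.eq_iff]

theorem labV_val_injective : Function.Injective fun ℓ : LV => (ν.labV ℓ).val :=
  Fin.val_injective.comp ν.labV.injective

theorem labE_val_injective : Function.Injective fun t : LE => (ν.labE t).val :=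
  Fin.val_injective.comp ν.labE.injective

theorem rule_val_injective : Function.Injective fun r : G.Rule => (ν.rule r).val :=
  Fin.val_injective.comp ν.rule.injective

theorem tuple_injective (τ : List LV) : Function.Injective fun ξ : Args Ω τ => ν.tuple ξ := by
  intro ξ ξ' h
  have h' := (finPiFinEquiv (m := τ.length)).injective (Fin.val_injective h)
  funext i
  exact (ν.value _).injective (congrFun h' i)

theorem value_cast {ℓ ℓ' : LV} (h : ℓ = ℓ') (h' : Ω ℓ = Ω ℓ') (x : Ω ℓ) :
    (ν.value ℓ' (cast h' x)).val = (ν.value ℓ x).val := by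
  subst h
  rfl

/-- This connects the positions in the input tables with those computed by the machine from node
numbers. -/
theorem tuple_eq_tup {τ : List LV} (ξ : Args Ω τ) {s a d : ℕ → ℕ}
    (hd : ∀ j : Fin τ.length, d (a j) = (ν.value _ (ξ j)).val)
    (hs : ∀ j : Fin τ.length, s (a j) = Fintype.card (Ω (τ.get j))) :
    ν.tuple ξ = tup s a d τ.length := by
  rw [tup, Numbering.tuple, finPiFinEquiv_apply, Finset.sum_range]
  refine Finset.sum_congr rfl fun j _ => ?_
  rw [hd, Finset.prod_range]
  congr 1
  refine Finset.prod_congr rfl fun i _ => ?_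
  exact (hs (Fin.castLE j.is_lt.le i)).symm

end Numbering

/-! The numbers of a rule, of its nodes and of its edges. -/

theorem encode_numRules : (G.encode ν).numRules = Fintype.card G.Rule := rfl

theorem encode_start : (G.encode ν).start = (ν.labE G.S).val := rfl

theorem encode_lhs (r : G.Rule) : (G.encode ν).lhs (ν.rule r).val = (ν.labE (G.lhs r)).val :=
  table_apply ν.rule_val_injective (fun r => (ν.labE (G.lhs r)).val) r

theorem encode_numV (r : G.Rule) :
    (G.encode ν).numV (ν.rule r).val = Fintype.card (G.rhs r).V :=
  table_apply ν.rule_val_injective (fun r => Fintype.card (G.rhs r).V) r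

theorem encode_numE (r : G.Rule) :
    (G.encode ν).numE (ν.rule r).val = Fintype.card (G.rhs r).E :=
  table_apply ν.rule_val_injective (fun r => Fintype.card (G.rhs r).E) r

theorem encode_len (t : LE) : (G.encode ν).len (ν.labE t).val = (type t).length :=
  table_apply ν.labE_val_injective (fun t => (type t).length) t

open scoped Classical in
theorem encode_isNt (t : LE) : (G.encode ν).IsNt (ν.labE t).val ↔ t ∈ G.N := by
  have : (G.encode ν).nat 4 (ν.labE t).val = if t ∈ G.N then 1 else 0 :=
    table_apply ν.labE_val_injective (fun t => if t ∈ G.N then 1 else 0) t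
  rw [State.IsNt, this]
  split_ifs with h <;> simp [h]

theorem encode_dom (r : G.Rule) (v : (G.rhs r).V) :
    (G.encode ν).dom (ν.rule r).val (ν.node r v).val = Fintype.card (Ω ((G.rhs r).labV v)) := by
  have h₁ : (G.encode ν).nat 8 (cell (ν.rule r).val (ν.node r v).val) =
      (ν.labV ((G.rhs r).labV v)).val := by
    refine table_apply (ι := Σ r : G.Rule, (G.rhs r).V)
      (pos := fun x => cell (ν.rule x.1).val (ν.node x.1 x.2).val) ?_
      (fun x => (ν.labV ((G.rhs x.1).labV x.2)).val) ⟨r, v⟩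
    rintro ⟨r, v⟩ ⟨r', v'⟩ h
    obtain ⟨h₁, h₂⟩ := cell_inj h
    obtain rfl := ν.rule_val_injective h₁
    obtain rfl : v = v' := (ν.node r).injective (Fin.val_injective h₂)
    rfl
  rw [State.dom, h₁]
  exact table_apply ν.labV_val_injective (fun ℓ => Fintype.card (Ω ℓ)) _

theorem encode_lab (r : G.Rule) (e : (G.rhs r).E) :
    (G.encode ν).lab (ν.rule r).val (ν.edge r e).val = (ν.labE ((G.rhs r).labE e)).val := by
  refine table_apply (ι := Σ r : G.Rule, (G.rhs r).E)
    (pos := fun x => cell (ν.rule x.1).val (ν.edge x.1 x.2).val) ?_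
    (fun x => (ν.labE ((G.rhs x.1).labE x.2)).val) ⟨r, e⟩
  rintro ⟨r, v⟩ ⟨r', v'⟩ h
  obtain ⟨h₁, h₂⟩ := cell_inj h
  obtain rfl := ν.rule_val_injective h₁
  obtain rfl : v = v' := (ν.edge r).injective (Fin.val_injective h₂)
  rfl

theorem encode_att (r : G.Rule) (e : (G.rhs r).E) (j : Fin (type ((G.rhs r).labE e)).length) :
    (G.encode ν).att (ν.rule r).val (ν.edge r e).val j = (ν.node r ((G.rhs r).att e j)).val := by
  refine table_apply
    (ι := Σ r : G.Rule, Σ e : (G.rhs r).E, Fin (type ((G.rhs r).labE e)).length)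
    (pos := fun x => cell (cell (ν.rule x.1).val (ν.edge x.1 x.2.1).val) x.2.2.val) ?_
    (fun x => (ν.node x.1 ((G.rhs x.1).att x.2.1 x.2.2)).val) ⟨r, e, j⟩
  rintro ⟨r, e, j⟩ ⟨r', e', j'⟩ h
  obtain ⟨h₁, h₃⟩ := cell_inj h
  obtain ⟨h₁, h₂⟩ := cell_inj h₁
  obtain rfl := ν.rule_val_injective h₁
  obtain rfl := (ν.edge r).injective (Fin.val_injective h₂)
  obtain rfl : j = j' := Fin.val_injective h₃
  rfl

theorem encode_ext (r : G.Rule) (j : Fin (type (G.lhs r)).length) :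
    (G.encode ν).ext (ν.rule r).val j = (ν.node r ((G.rhs r).ext j)).val := by
  refine table_apply (ι := Σ r : G.Rule, Fin (type (G.lhs r)).length)
    (pos := fun x => cell (ν.rule x.1).val x.2.val) ?_
    (fun x => (ν.node x.1 ((G.rhs x.1).ext x.2)).val) ⟨r, j⟩
  rintro ⟨r, j⟩ ⟨r', j'⟩ h
  obtain ⟨h₁, h₂⟩ := cell_inj h
  obtain rfl := ν.rule_val_injective h₁
  obtain rfl : j = j' := Fin.val_injective h₂
  rfl

theorem encode_factor (t : {t // t ∈ G.T}) (ξ : Args Ω (type t.1)) :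
    (G.encode ν).val 0 (cell (ν.labE t.1).val (ν.tuple ξ)) = G.F t ξ := by
  refine table_apply (ι := Σ t : {t // t ∈ G.T}, Args Ω (type t.1))
    (pos := fun x => cell (ν.labE x.1.1).val (ν.tuple x.2)) ?_
    (fun x => (G.F x.1 x.2 : ℝ≥0∞)) ⟨t, ξ⟩
  rintro ⟨t, ξ⟩ ⟨t', ξ'⟩ h
  obtain ⟨h₁, h₂⟩ := cell_inj h
  obtain rfl := Subtype.ext (ν.labE_inj.1 h₁)
  obtain rfl : ξ = ξ' := ν.tuple_injective _ h₂
  rfl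

theorem encode_fresh : (G.encode ν).Fresh where
  nat a ha i := by
    obtain ⟨b, rfl⟩ : ∃ b, a = b + 12 := ⟨a - 12, by omega⟩
    rfl
  val a ha i := by
    obtain ⟨b, rfl⟩ : ∃ b, a = b + 1 := ⟨a - 1, by omega⟩
    rfl

theorem exists_rule {r : ℕ} (hr : r < (G.encode ν).numRules) : ∃ r', r = (ν.rule r').val :=
  ⟨ν.rule.symm ⟨r, hr⟩, by simp⟩

theorem exists_edge {r : G.Rule} {e : ℕ} (he : e < (G.encode ν).numE (ν.rule r).val) :
    ∃ e', e = (ν.edge r e').val := by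
  rw [encode_numE] at he
  exact ⟨(ν.edge r).symm ⟨e, he⟩, by simp⟩

theorem encode_wellFormed : (G.encode ν).WellFormed where
  att_lt r hr e he j hj := by
    obtain ⟨r, rfl⟩ := exists_rule ν hr
    obtain ⟨e, rfl⟩ := exists_edge ν he
    rw [encode_lab, encode_len] at hj
    rw [encode_att ν r e ⟨j, hj⟩, encode_numV]
    exact Fin.is_lt _
  ext_lt r hr j hj := by
    obtain ⟨r, rfl⟩ := exists_rule ν hr
    rw [encode_lhs, encode_len] at hj
    rw [encode_ext ν r ⟨j, hj⟩, encode_numV]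
    exact Fin.is_lt _

theorem encode_size (r : G.Rule) : (G.encode ν).size (ν.rule r).val = (G.rhs r).size := by
  rw [State.size, Fragment.size, encode_numV, encode_numE, encode_lhs, encode_len,
    Finset.sum_range, ← Equiv.sum_comp (ν.edge r)]
  simp only [encode_lab, encode_len]

theorem encode_numAsg (r : G.Rule) : (G.encode ν).numAsg (ν.rule r).val =
    ∏ v : (G.rhs r).V, Fintype.card (Ω ((G.rhs r).labV v)) := by
  rw [State.numAsg, encode_numV, Finset.prod_range, ← Equiv.prod_comp (ν.node r)]
  simp only [encode_dom]

theorem encode_numAsg_le {m k : ℕ} (hm : 0 < m) (r : G.Rule)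
    (h : ∀ v : (G.rhs r).V, Fintype.card (Ω ((G.rhs r).labV v)) ≤ m)
    (hk : Fintype.card (G.rhs r).V ≤ k + 1) :
    (G.encode ν).numAsg (ν.rule r).val ≤ m ^ (k + 1) := by
  rw [encode_numAsg]
  calc _ ≤ ∏ _v : (G.rhs r).V, m := Finset.prod_le_prod' fun v _ => h v
    _ = m ^ Fintype.card (G.rhs r).V := by simp
    _ ≤ _ := Nat.pow_le_pow_right hm hk

/-! Numbers of assignments. -/

/-- The numbers of the values of the nodes. -/
def asgDigits (r : G.Rule) (ξ : (G.rhs r).Asg Ω) (v : ℕ) : ℕ :=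
  if h : v < Fintype.card (G.rhs r).V then (ν.value _ (ξ ((ν.node r).symm ⟨v, h⟩))).val else 0

theorem asgDigits_node (r : G.Rule) (ξ : (G.rhs r).Asg Ω) (v : (G.rhs r).V) :
    asgDigits ν r ξ (ν.node r v).val = (ν.value _ (ξ v)).val := by
  have h : ∀ v' : (G.rhs r).V, v' = v → (ν.value _ (ξ v')).val = (ν.value _ (ξ v)).val := by
    rintro _ rfl
    rfl
  rw [asgDigits, dif_pos (Fin.is_lt _)]
  exact h _ (by simp)

theorem exists_node {r : G.Rule} {v : ℕ} (hv : v < (G.encode ν).numV (ν.rule r).val) :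
    ∃ v', v = (ν.node r v').val := by
  rw [encode_numV] at hv
  exact ⟨(ν.node r).symm ⟨v, hv⟩, by simp⟩

/-- The number of an assignment. -/
noncomputable def asgCode (r : G.Rule) (ξ : (G.rhs r).Asg Ω) : ℕ :=
  tup ((G.encode ν).dom (ν.rule r).val) id (asgDigits ν r ξ) ((G.encode ν).numV (ν.rule r).val)

theorem asgDigits_lt (r : G.Rule) (ξ : (G.rhs r).Asg Ω) :
    ∀ v < (G.encode ν).numV (ν.rule r).val,
      asgDigits ν r ξ v < (G.encode ν).dom (ν.rule r).val v := by
  intro v hv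
  obtain ⟨v, rfl⟩ := exists_node ν hv
  rw [asgDigits_node, encode_dom]
  exact Fin.is_lt _

theorem asg_asgCode (r : G.Rule) (ξ : (G.rhs r).Asg Ω) :
    ∀ v < (G.encode ν).numV (ν.rule r).val,
      (G.encode ν).asg (ν.rule r).val (asgCode ν r ξ) v = asgDigits ν r ξ v :=
  fun _ hv => digit_tup_id (asgDigits_lt ν r ξ) hv

/-- The counter of the machine reaches every assignment exactly once, because mixed radix expansion
is a bijection. -/
theorem sum_asgCode (r : G.Rule) (f : ℕ → ℝ≥0∞) :
    ∑ i ∈ Finset.range ((G.encode ν).numAsg (ν.rule r).val), f i =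
      ∑' ξ : (G.rhs r).Asg Ω, f (asgCode ν r ξ) := by
  classical
  rw [tsum_fintype]
  symm
  refine Finset.sum_nbij (asgCode ν r) (fun ξ _ => ?_) (fun ξ _ ξ' _ h => ?_) (fun i hi => ?_)
    fun _ _ => rfl
  · exact Finset.mem_range.2 (tup_id_lt (asgDigits_lt ν r ξ))
  · funext v
    have hv : (ν.node r v).val < (G.encode ν).numV (ν.rule r).val := by
      rw [encode_numV]
      exact Fin.is_lt _
    have := asg_asgCode ν r ξ _ hv
    rw [h, asg_asgCode ν r ξ' _ hv, asgDigits_node, asgDigits_node] at this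
    exact ((ν.value _).injective (Fin.val_injective this)).symm
  · rw [Finset.mem_coe, Finset.mem_range] at hi
    have hlt : ∀ v : (G.rhs r).V, (G.encode ν).asg (ν.rule r).val i (ν.node r v).val <
        Fintype.card (Ω ((G.rhs r).labV v)) := fun v => by
      rw [← encode_dom ν]
      refine digit_lt hi ?_
      rw [encode_numV]
      exact Fin.is_lt _
    refine ⟨fun v => (ν.value _).symm ⟨_, hlt v⟩, by simp, ?_⟩
    refine Eq.trans ?_ ((tup_id_digit _ i _).trans (Nat.mod_eq_of_lt hi))
    refine tup_congr (fun v hv => ?_) fun _ _ => rfl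
    obtain ⟨v, rfl⟩ := exists_node ν hv
    rw [id, asgDigits_node, Equiv.apply_symm_apply]
    rfl

theorem edgeKey_asgCode (r : G.Rule) (ξ : (G.rhs r).Asg Ω) (e : (G.rhs r).E) :
    (G.encode ν).edgeKey (ν.rule r).val ((G.encode ν).asg (ν.rule r).val (asgCode ν r ξ))
      (ν.edge r e).val =
        cell (ν.labE ((G.rhs r).labE e)).val (ν.tuple ((G.rhs r).readAtt ξ e)) := by
  rw [State.edgeKey_congr (encode_wellFormed ν) (Fin.is_lt _) (asg_asgCode ν r ξ)
    (by rw [encode_numE]; exact Fin.is_lt _), State.edgeKey, encode_lab, encode_len]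
  congr 1
  symm
  refine ν.tuple_eq_tup _ (fun j => ?_) fun j => ?_
  · rw [encode_att, asgDigits_node]
    exact (ν.value_cast ((G.rhs r).labV_att e j) _ _).symm
  · rw [encode_att, encode_dom, (G.rhs r).labV_att]

theorem extKey_asgCode (r : G.Rule) (ξ : (G.rhs r).Asg Ω) :
    (G.encode ν).extKey (ν.rule r).val ((G.encode ν).asg (ν.rule r).val (asgCode ν r ξ)) =
      cell (ν.labE (G.lhs r)).val (ν.tuple ((G.rhs r).readExt ξ)) := by
  rw [State.extKey_congr (encode_wellFormed ν) (Fin.is_lt _) (asg_asgCode ν r ξ),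
    State.extKey, encode_lhs, encode_len]
  congr 1
  symm
  refine ν.tuple_eq_tup _ (fun j => ?_) fun j => ?_
  · rw [encode_ext, asgDigits_node]
    exact (ν.value_cast ((G.rhs r).labV_ext j) _ _).symm
  · rw [encode_ext, encode_dom, (G.rhs r).labV_ext]

theorem ruleVal_asgCode (x : ℕ → ℝ≥0∞) (r : G.Rule) (ξ : (G.rhs r).Asg Ω) :
    (G.encode ν).ruleVal x (ν.rule r).val ((G.encode ν).asg (ν.rule r).val (asgCode ν r ξ)) =
      G.nodeVal r (fun e η => x (cell (ν.labE ((G.rhs r).labE e.1)).val (ν.tuple η))) ξ := by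
  classical
  rw [State.ruleVal, encode_numE, Finset.prod_range, ← Equiv.prod_comp (ν.edge r),
    ← Fintype.prod_subtype_mul_prod_subtype (fun e => (G.rhs r).labE e ∈ G.N), mul_comm, nodeVal]
  congr 1
  · unfold termVal
    refine Fintype.prod_equiv (Equiv.subtypeEquivRight fun e => ?_) _ _ fun e => ?_
    · exact ⟨fun h => ((G.rhs r).labE_mem e).resolve_left h,
        fun h h' => Finset.disjoint_left.1 G.disjoint h' h⟩
    · have h : ¬ (G.encode ν).IsNt ((G.encode ν).lab (ν.rule r).val (ν.edge r e.1).val) := by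
        rw [encode_lab, encode_isNt]
        exact e.2
      rw [State.edgeVal, if_neg h, edgeKey_asgCode]
      exact encode_factor ν ⟨_, ((G.rhs r).labE_mem e.1).resolve_left e.2⟩ _
  · refine Fintype.prod_congr _ _ fun e => ?_
    have h : (G.encode ν).IsNt ((G.encode ν).lab (ν.rule r).val (ν.edge r e.1).val) := by
      rw [encode_lab, encode_isNt]
      exact e.2
    rw [State.edgeVal, if_pos h, edgeKey_asgCode]

theorem stepK_encode (x : ℕ → ℝ≥0∞) (X : LE) (ξ : Args Ω (type X)) :
    (G.encode ν).stepK x (cell (ν.labE X).val (ν.tuple ξ)) =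
      ∑' r : {r : G.Rule // G.lhs r = X},
        ∑' ξ' : {ξ' : (G.rhs r.1).Asg Ω // (G.rhs r.1).readExt ξ' = G.castArgs r.2 ξ},
          G.nodeVal r.1 (fun e η => x (cell (ν.labE ((G.rhs r.1).labE e.1)).val (ν.tuple η)))
            ξ'.1 := by
  classical
  let g : G.Rule → ℝ≥0∞ := fun r => if h : G.lhs r = X then
    ∑' ξ' : {ξ' : (G.rhs r).Asg Ω // (G.rhs r).readExt ξ' = G.castArgs h ξ},
      G.nodeVal r (fun e η => x (cell (ν.labE ((G.rhs r).labE e.1)).val (ν.tuple η))) ξ'.1 else 0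
  have hg : ∑' r : {r : G.Rule // G.lhs r = X}, g r.1 = ∑' r, g r := by
    refine Function.Injective.tsum_eq Subtype.val_injective fun r hr => ?_
    rw [Subtype.range_coe_subtype]
    by_contra h
    exact hr (dif_neg h)
  refine Eq.trans ?_ (hg.symm.trans (tsum_congr fun r => dif_pos r.2))
  rw [State.stepK, encode_numRules, Finset.sum_range, ← Equiv.sum_comp ν.rule, tsum_fintype]
  refine Finset.sum_congr rfl fun r _ => ?_
  rw [sum_asgCode ν r fun i => if (G.encode ν).extKey (ν.rule r).val
    ((G.encode ν).asg (ν.rule r).val i) = cell (ν.labE X).val (ν.tuple ξ) then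
      (G.encode ν).ruleVal x (ν.rule r).val ((G.encode ν).asg (ν.rule r).val i) else 0]
  simp only [extKey_asgCode, ruleVal_asgCode, g]
  split_ifs with h
  · subst h
    have hc : G.castArgs rfl ξ = ξ := rfl
    rw [hc]
    let f : (G.rhs r).Asg Ω → ℝ≥0∞ := fun ξ' => if cell (ν.labE (G.lhs r)).val
      (ν.tuple ((G.rhs r).readExt ξ')) = cell (ν.labE (G.lhs r)).val (ν.tuple ξ) then
      G.nodeVal r (fun e η => x (cell (ν.labE ((G.rhs r).labE e.1)).val (ν.tuple η))) ξ' else 0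
    have hf : ∑' ξ' : {ξ' : (G.rhs r).Asg Ω // (G.rhs r).readExt ξ' = ξ}, f ξ'.1 = ∑' ξ', f ξ' := by
      refine Function.Injective.tsum_eq Subtype.val_injective fun ξ' hξ' => ?_
      rw [Subtype.range_coe_subtype]
      by_contra h
      exact hξ' (if_neg fun h' => h (ν.tuple_injective _ (cell_inj h').2))
    refine hf.symm.trans (tsum_congr fun ξ' => if_pos ?_)
    rw [ξ'.2]
  · rw [ENNReal.tsum_eq_zero]
    exact fun ξ' => if_neg fun h' => h (ν.labE_inj.1 (cell_inj h').1)

/-- One step over keys is the equation for ψ with the equations for τ substituted into it. -/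
theorem stepK_eq_evalSystem (x : ℕ → ℝ≥0∞) (y : Unknown G → ℝ≥0∞)
    (hy : ∀ X ξ, y (.psi X ξ) = x (cell (ν.labE X.1).val (ν.tuple ξ)))
    (hy' : ∀ r ξ, y (.tau r ξ) = G.evalSystem y (.tau r ξ)) (X : {X // X ∈ G.N})
    (ξ : Args Ω (type X.1)) :
    (G.encode ν).stepK x (cell (ν.labE X.1).val (ν.tuple ξ)) = G.evalSystem y (.psi X ξ) := by
  rw [stepK_encode, evalSystem_psi]
  refine tsum_congr fun r => ?_
  rw [hy', evalSystem_tau]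
  simp only [hy]

/-- Each of the two least fixed points is turned into a pre-fixed point of the other system, and
minimality is applied on both sides. -/
theorem lfpK_encode : (G.encode ν).lfpK (cell (G.encode ν).start 0) = G.Z := by
  classical
  have h0 : ν.tuple (fun i => absurd i.2 (by simp [G.type_S]) : Args Ω (type G.S)) = 0 := by
    have := G.type_S
    rw [ν.tuple_eq_tup (s := 0) (a := 0) (d := 0) _ (fun j => absurd j.2 (by simp [G.type_S]))
      (fun j => absurd j.2 (by simp [G.type_S]))]
    simp [tup, this]
  rw [← inside_startUnknown, encode_start, ← h0]
  refine le_antisymm ?_ ?_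
  · let pos : (Σ X : {X // X ∈ G.N}, Args Ω (type X.1)) → ℕ :=
      fun p => cell (ν.labE p.1.1).val (ν.tuple p.2)
    have hpos : Function.Injective pos := by
      rintro ⟨t, ξ⟩ ⟨t', ξ'⟩ h
      obtain ⟨h₁, h₂⟩ := cell_inj h
      obtain rfl := Subtype.ext (ν.labE_inj.1 h₁)
      obtain rfl : ξ = ξ' := ν.tuple_injective _ h₂
      rfl
    -- Numbers that are not the key of any unknown get the value ∞, where the inequality to be
    -- proved is trivial.
    let x : ℕ → ℝ≥0∞ := Function.extend pos (fun p => G.inside (.psi p.1 p.2)) fun _ => ⊤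
    have hx : ∀ X ξ, G.inside (.psi X ξ) = x (cell (ν.labE X.1).val (ν.tuple ξ)) := fun X ξ =>
      (hpos.extend_apply (fun p => G.inside (.psi p.1 p.2)) (fun _ => ⊤) ⟨X, ξ⟩).symm
    have hle : (G.encode ν).lfpK ≤ x := by
      refine State.lfpK_le _ fun k => ?_
      by_cases hk : ∃ p, pos p = k
      · obtain ⟨⟨X, ξ⟩, rfl⟩ := hk
        change (G.encode ν).stepK x (cell (ν.labE X.1).val (ν.tuple ξ)) ≤
          x (cell (ν.labE X.1).val (ν.tuple ξ))
        rw [stepK_eq_evalSystem ν x G.inside hx (fun _ _ => G.evalSystem_inside _), ← hx,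
          ← evalSystem_inside]
      · have : x k = ⊤ := Function.extend_apply' _ _ _ hk
        rw [this]
        exact le_top
    exact (hle _).trans_eq (hx ⟨G.S, G.S_mem⟩ _).symm
  · let x := (G.encode ν).lfpK
    -- The equation for τ reads only ψ, so any values of τ, here 0, may be used in order to define τ
    -- from ψ.
    let y' : Unknown G → ℝ≥0∞ := fun u => match u with
      | .psi X ξ => x (cell (ν.labE X.1).val (ν.tuple ξ))
      | .tau _ _ => 0
    let y : Unknown G → ℝ≥0∞ := fun u => match u with
      | .psi X ξ => x (cell (ν.labE X.1).val (ν.tuple ξ))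
      | .tau r ξ => G.evalSystem y' (.tau r ξ)
    have hy : ∀ r ξ, y (.tau r ξ) = G.evalSystem y (.tau r ξ) := fun r ξ => by
      rw [evalSystem_tau]
      exact evalSystem_tau _ _ _ _
    refine G.inside_le (x := y) (fun u => ?_) _
    cases u with
    | psi X ξ =>
      rw [← stepK_eq_evalSystem ν x y (fun _ _ => rfl) hy, State.stepK_lfpK]
    | tau r ξ => exact (hy r ξ).ge

end FGG

/-! ### Ranks of nonterminals -/

namespace FGG

variable {LV : Type*} {LE : Type*} {type : LE → List LV} {Ω : LV → Type*} (G : FGG type Ω)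

/-- All nonterminals of the right-hand side have derivations. -/
def Productive (r : G.Rule) : Prop := ∀ e : NEdge G r, Nonempty (Deriv G ((G.rhs r).labE e.1))

/-- `Y` occurs in the right-hand side of a productive rule for `X`. -/
def Step (X Y : LE) : Prop :=
  ∃ r, G.Productive r ∧ G.lhs r = X ∧ ∃ e : NEdge G r, (G.rhs r).labE e.1 = Y

variable {G}

/-- The children at edges in `s` are prescribed, and productivity supplies the remaining ones. In
this way local witnesses become one derivation. -/
theorem exists_hasProper {r : G.Rule} (hr : G.Productive r) {s : Set (NEdge G r)} {X : LE}
    (h : ∀ e ∈ s, ∃ D : Deriv G ((G.rhs r).labE e.1), (G.rhs r).labE e.1 = X ∨ D.HasProper X) :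
    ∃ c : (∀ e : NEdge G r, Deriv G ((G.rhs r).labE e.1)),
      ∀ e ∈ s, (G.rhs r).labE e.1 = X ∨ (c e).HasProper X := by
  classical
  choose D hD using h
  refine ⟨fun e => if he : e ∈ s then D e he else (hr e).some, fun e he => ?_⟩
  simp only [dif_pos he]
  exact hD e he

theorem exists_of_reach {X Y : LE} (h : Relation.ReflTransGen G.Step X Y)
    (hY : Nonempty (Deriv G Y)) : ∃ D : Deriv G X, X = Y ∨ D.HasProper Y := by
  induction h using Relation.ReflTransGen.head_induction_on with
  | refl => exact ⟨hY.some, .inl rfl⟩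
  | head h _ ih =>
    obtain ⟨r, hr, rfl, e, rfl⟩ := h
    obtain ⟨c, hc⟩ := exists_hasProper hr (s := {e}) (X := Y) fun e' he' => by
      rw [Set.mem_singleton_iff.1 he']
      exact ih
    exact ⟨.node r c, .inr ⟨e, hc e rfl⟩⟩

theorem nonempty_deriv_of_step {X Y : LE} (h : G.Step X Y) :
    Nonempty (Deriv G X) ∧ Nonempty (Deriv G Y) := by
  obtain ⟨r, hr, rfl, e, rfl⟩ := h
  exact ⟨⟨.node r fun e => (hr e).some⟩, hr e⟩

theorem nonempty_deriv_of_reach {X Y : LE} (h : Relation.ReflTransGen G.Step X Y)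
    (hX : Nonempty (Deriv G X)) : Nonempty (Deriv G Y) := by
  induction h with
  | refl => exact hX
  | tail _ h _ => exact (nonempty_deriv_of_step h).2

theorem exists_lhs_of_deriv {X : LE} (D : Deriv G X) : ∃ r, G.lhs r = X := by
  cases D with
  | node r _ => exact ⟨r, rfl⟩

variable (G) in
open scoped Classical in
/-- The nonterminals that are reachable from `X`, if `X` has a derivation. -/
noncomputable def reachable (X : LE) : Finset LE :=
  (Finset.univ.image G.lhs).filter fun Y =>
    Nonempty (Deriv G X) ∧ Relation.ReflTransGen G.Step X Y

variable (G) in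
/-- The rank of a label is the number of nonterminals that are reachable from it, and `0` for labels
without derivations. -/
noncomputable def rank (X : LE) : ℕ := (G.reachable X).card

theorem mem_reachable {X Y : LE} : Y ∈ G.reachable X ↔
    Nonempty (Deriv G X) ∧ Relation.ReflTransGen G.Step X Y := by
  classical
  simp only [reachable, Finset.mem_filter, Finset.mem_image, Finset.mem_univ, true_and,
    and_iff_right_iff_imp]
  rintro ⟨hX, h⟩
  exact exists_lhs_of_deriv (nonempty_deriv_of_reach h hX).some

/-- Everything reachable from a label with a derivation has a derivation, so it is the left-hand
side of a rule. Counting left-hand sides bounds the rank by the number of rules instead of the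
number of labels. -/
theorem rank_le (X : LE) : G.rank X ≤ Fintype.card G.Rule := by
  classical
  exact (Finset.card_filter_le _ _).trans Finset.card_image_le

theorem rank_ne_zero {X : LE} : G.rank X ≠ 0 ↔ Nonempty (Deriv G X) := by
  rw [rank, Finset.card_ne_zero]
  constructor
  · rintro ⟨Y, hY⟩
    exact (mem_reachable.1 hY).1
  · exact fun h => ⟨X, mem_reachable.2 ⟨h, .refl⟩⟩

theorem reachable_subset {X Y : LE} (h : G.Step X Y) : G.reachable Y ⊆ G.reachable X :=
  fun _ hZ => mem_reachable.2 ⟨(nonempty_deriv_of_step h).1, .head h (mem_reachable.1 hZ).2⟩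

theorem rank_mono {X Y : LE} (h : G.Step X Y) : G.rank Y ≤ G.rank X :=
  Finset.card_le_card (reachable_subset h)

/-- If the rank does not decrease, `X` is reachable from `Y`. -/
theorem exists_of_rank_eq {X Y : LE} (h : G.Step X Y) (heq : G.rank X ≤ G.rank Y) :
    ∃ D : Deriv G Y, Y = X ∨ D.HasProper X := by
  have he := Finset.eq_of_subset_of_card_le (reachable_subset h) heq
  have hX : X ∈ G.reachable Y := he ▸ mem_reachable.2 ⟨(nonempty_deriv_of_step h).1, .refl⟩
  exact exists_of_reach (mem_reachable.1 hX).2 (nonempty_deriv_of_step h).1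

theorem rank_rule (r : G.Rule) : (∃ e : NEdge G r, G.rank ((G.rhs r).labE e.1) = 0) ∨
    (G.Productive r ∧ 1 ≤ G.rank (G.lhs r)) := by
  refine or_iff_not_imp_left.2 fun h => ?_
  push Not at h
  have hr : G.Productive r := fun e => rank_ne_zero.1 (h e)
  exact ⟨hr, Nat.one_le_iff_ne_zero.2 (rank_ne_zero.2 ⟨.node r fun e => (hr e).some⟩)⟩

/-- If the rank did not drop, the left-hand side would be reachable from the nonterminal, and a
derivation below this edge would repeat the type of the root. -/
theorem rank_lt (hG : ¬ G.Recursive) {r : G.Rule} (hr : G.Productive r) (e : NEdge G r) :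
    G.rank ((G.rhs r).labE e.1) < G.rank (G.lhs r) := by
  have hs : G.Step (G.lhs r) ((G.rhs r).labE e.1) := ⟨r, hr, rfl, e, rfl⟩
  by_contra hle
  have hD := exists_of_rank_eq hs (not_lt.1 hle)
  obtain ⟨c, hc⟩ := exists_hasProper hr (s := {e}) (X := G.lhs r) fun e' he' => by
    rw [Set.mem_singleton_iff.1 he']
    exact hD
  exact hG ⟨_, .node r c, e, hc e rfl⟩

/-- Two edges that keep the rank would both lead back to the left-hand side, and one derivation
would contain two disjoint copies of its own type. -/
theorem eq_of_rank_eq (hG : G.LinearlyRecursive) {r : G.Rule} (hr : G.Productive r)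
    {e e' : NEdge G r} (h : G.rank ((G.rhs r).labE e.1) = G.rank (G.lhs r))
    (h' : G.rank ((G.rhs r).labE e'.1) = G.rank (G.lhs r)) : e = e' := by
  by_contra hne
  obtain ⟨c, hc⟩ := exists_hasProper hr (s := {e, e'}) (X := G.lhs r) fun e'' he'' => by
    refine exists_of_rank_eq ⟨r, hr, rfl, e'', rfl⟩ ?_
    rcases he'' with rfl | he''
    · exact h.ge
    · rw [Set.mem_singleton_iff.1 he'']
      exact h'.ge
  exact hG.2 ⟨hG.1, _, .node r c, .inr ⟨e, e', hne, hc e (by simp), hc e' (by simp)⟩⟩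

open RAM

variable [Fintype LV] [Fintype LE] [∀ ℓ, Fintype (Ω ℓ)] (ν : Numbering G)

/-- The rank of a label given by its number. -/
noncomputable def rankNum (l : ℕ) : ℕ :=
  if h : l < Fintype.card LE then G.rank (ν.labE.symm ⟨l, h⟩) else 0

theorem rankNum_labE (t : LE) : rankNum ν (ν.labE t).val = G.rank t := by
  rw [rankNum, dif_pos (Fin.is_lt _)]
  simp

theorem rankNum_le (l : ℕ) : rankNum ν l ≤ (G.encode ν).numRules := by
  rw [rankNum]
  split_ifs
  · exact rank_le _
  · exact Nat.zero_le _

theorem rankNum_lab (r : G.Rule) (e : (G.rhs r).E) :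
    rankNum ν ((G.encode ν).lab (ν.rule r).val (ν.edge r e).val) = G.rank ((G.rhs r).labE e) := by
  rw [encode_lab, rankNum_labE]

theorem rankNum_lhs (r : G.Rule) :
    rankNum ν ((G.encode ν).lhs (ν.rule r).val) = G.rank (G.lhs r) := by
  rw [encode_lhs, rankNum_labE]

theorem exists_nEdge {r : G.Rule} {e : ℕ} (he : e < (G.encode ν).numE (ν.rule r).val)
    (ht : (G.encode ν).IsNt ((G.encode ν).lab (ν.rule r).val e)) :
    ∃ e' : NEdge G r, e = (ν.edge r e'.1).val := by
  obtain ⟨e, rfl⟩ := exists_edge ν he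
  rw [encode_lab, encode_isNt] at ht
  exact ⟨⟨e, ht⟩, rfl⟩

theorem rankNum_rule (r : G.Rule) :
    (∃ e < (G.encode ν).numE (ν.rule r).val,
      (G.encode ν).IsNt ((G.encode ν).lab (ν.rule r).val e) ∧
        rankNum ν ((G.encode ν).lab (ν.rule r).val e) = 0) ∨
      (G.Productive r ∧ 1 ≤ rankNum ν ((G.encode ν).lhs (ν.rule r).val)) := by
  rw [rankNum_lhs]
  refine (rank_rule r).imp_left ?_
  rintro ⟨e, he⟩
  refine ⟨(ν.edge r e.1).val, by rw [encode_numE]; exact Fin.is_lt _, ?_, by rwa [rankNum_lab]⟩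
  rw [encode_lab, encode_isNt]
  exact e.2

theorem acyclic_rankNum (hG : ¬ G.Recursive) : (G.encode ν).Acyclic (rankNum ν) := by
  intro r hr
  obtain ⟨r, rfl⟩ := exists_rule ν hr
  refine (rankNum_rule ν r).imp_right fun ⟨hr, h1⟩ => ⟨h1, fun e he ht => ?_⟩
  obtain ⟨e, rfl⟩ := exists_nEdge ν he ht
  rw [rankNum_lab, rankNum_lhs]
  exact rank_lt hG hr e

theorem rankOK_rankNum (hG : G.LinearlyRecursive) :
    ∀ r < (G.encode ν).numRules, (G.encode ν).RankOK (rankNum ν) r := by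
  intro r hr
  obtain ⟨r, rfl⟩ := exists_rule ν hr
  refine (rankNum_rule ν r).imp_right fun ⟨hr, h1⟩ => ⟨h1, fun e he ht => ?_,
    fun e he e' he' ht ht' h h' => ?_⟩
  · obtain ⟨e, rfl⟩ := exists_nEdge ν he ht
    rw [rankNum_lab, rankNum_lhs]
    exact rank_mono ⟨r, hr, rfl, e, rfl⟩
  · obtain ⟨e, rfl⟩ := exists_nEdge ν he ht
    obtain ⟨e', rfl⟩ := exists_nEdge ν he' ht'
    rw [rankNum_lab, rankNum_lhs] at h h'
    rw [eq_of_rank_eq hG hr h h']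

end FGG

/-! ### The theorem -/

theorem mainTheorem2 :
    (∀ (LV : Type*) (LE : Type*) [Fintype LV] [Fintype LE] (type : LE → List LV)
        (Ω : LV → Type*) [∀ ℓ, Fintype (Ω ℓ)] (G : FGG type Ω),
      Monotone G.evalSystem ∧
      IsLeast {x : FGG.Unknown G → ℝ≥0∞ | ∀ u, x u = G.evalSystem x u} G.inside ∧
      G.inside G.startUnknown = G.Z) ∧
    (∃ (p : RAM.Prog) (C : ℕ),
      ∀ (LV : Type*) (LE : Type*) [Fintype LV] [Fintype LE] (type : LE → List LV)
        (Ω : LV → Type*) [∀ ℓ, Fintype (Ω ℓ)] (G : FGG type Ω) (ν : G.Numbering) (m k s : ℕ),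
      0 < m → Nonempty G.Rule →
      (∀ (r : G.Rule) (v : (G.rhs r).V), Fintype.card (Ω ((G.rhs r).labV v)) ≤ m) →
      (∀ r : G.Rule, Fintype.card (G.rhs r).V ≤ k + 1) →
      (∀ r : G.Rule, (G.rhs r).size ≤ s) →
      ¬ G.Recursive →
      RAM.ComputesWithin p (G.encode ν) G.Z
        (C * (s + 1) * (Fintype.card G.Rule * m ^ (k + 1)))) ∧
    (∃ (p : RAM.Prog) (C : ℕ),
      ∀ (LV : Type*) (LE : Type*) [Fintype LV] [Fintype LE] (type : LE → List LV)
        (Ω : LV → Type*) [∀ ℓ, Fintype (Ω ℓ)] (G : FGG type Ω) (ν : G.Numbering) (m k s : ℕ),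
      0 < m → Nonempty G.Rule →
      (∀ (r : G.Rule) (v : (G.rhs r).V), Fintype.card (Ω ((G.rhs r).labV v)) ≤ m) →
      (∀ r : G.Rule, Fintype.card (G.rhs r).V ≤ k + 1) →
      (∀ r : G.Rule, (G.rhs r).size ≤ s) →
      G.LinearlyRecursive →
      RAM.ComputesWithin p (G.encode ν) G.Z
        (C * (s + 1) * (Fintype.card G.Rule ^ 3 * m ^ (3 * (k + 1))))) := by
  refine ⟨fun LV LE _ _ type Ω _ G => ⟨G.evalSystem_mono, G.isLeast_inside,
    G.inside_startUnknown⟩, ?_, ?_⟩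
  · obtain ⟨C, hC⟩ := RAM.wp_nonrec
    refine ⟨RAM.nonrecProg, C, fun LV LE _ _ type Ω _ G ν m k s hm hne hd hk hs hG => ?_⟩
    rw [← FGG.lfpK_encode ν]
    refine hC (G.encode ν) _ (m ^ (k + 1)) s (FGG.encode_fresh ν) (FGG.encode_wellFormed ν)
      (FGG.acyclic_rankNum ν hG) (by positivity) Fintype.card_pos (fun r hr => ?_) fun r hr => ?_
    · obtain ⟨r, rfl⟩ := FGG.exists_rule ν hr
      exact FGG.encode_numAsg_le ν hm r (hd r) (hk r)
    · obtain ⟨r, rfl⟩ := FGG.exists_rule ν hr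
      exact (FGG.encode_size ν r).trans_le (hs r)
  · obtain ⟨C, hC⟩ := RAM.wp_linear
    refine ⟨RAM.linProg, C, fun LV LE _ _ type Ω _ G ν m k s hm hne hd hk hs hG => ?_⟩
    rw [← FGG.lfpK_encode ν, mul_comm 3, pow_mul]
    refine hC (G.encode ν) _ (m ^ (k + 1)) s (FGG.encode_fresh ν) (FGG.encode_wellFormed ν)
      (FGG.rankOK_rankNum ν hG) (FGG.rankNum_le ν) (by positivity) Fintype.card_pos
      (fun r hr => ?_) fun r hr => ?_
    · obtain ⟨r, rfl⟩ := FGG.exists_rule ν hr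
      exact FGG.encode_numAsg_le ν hm r (hd r) (hk r)
    · obtain ⟨r, rfl⟩ := FGG.exists_rule ν hr
      exact (FGG.encode_size ν r).trans_le (hs r)
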